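/- Let $n\ge 1$, let $\Omega\subset\mathbb R^n$ be a bounded open set, and let $V,W$ be finite-dimensional normed real vector spaces. Let $\mathbb A=\sum_{\alpha=1}^n \mathbb A_\alpha\partial_\alpha$, with $\mathbb A_\alpha\in\mathcal L(V,W)$, be a first order linear differential operator with constant coefficients that is $\mathbb R$-elliptic, i.e. the symbol $\mathbb A[\xi]=\sum_\alpha \xi_\alpha\mathbb A_\alpha\colon V\to W$ is injective for every $\xi\in\mathbb R^n\setminus\{0\}$ (in particular, $\mathbb A$ may be any $\mathbb C$-elliptic operator). Let $1<p<\infty$ and let $g\colon W\to\mathbb R$ be a convex function for which there are constants $c,\theta,C>0$ with $$c|z|^p-\theta\le g(z)\le C(1+|z|^p)\qquad\text{for all } z\in W.$$ Let $u_0\in \mathrm W^{1,p}(\Omega;V)$, and let $\mathrm W^{1,p}_0(\Omega;V)$ be the closure of $C_c^\infty(\Omega;V)$ in $\mathrm W^{1,p}(\Omega;V)$. For $u\in u_0+\mathrm W^{1,p}_0(\Omega;V)$ put $\mathbb A u=\sum_\alpha\mathbb A_\alpha\partial_\alpha u$, with weak derivatives $\partial_\alpha u$. Then $g(\mathbb A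 u)$ is integrable on $\Omega$ for every such $u$, and the functional $G\colon \mathrm L^1(\Omega;V)\to(-\infty,+\infty]$, $$G[u]=\begin{cases}\displaystyle\int_\Omega g(\mathbb A u)\,\mathrm dx, & u\in u_0+\mathrm W^{1,p}_0(\Omega;V),\\[1ex] +\infty, & u\in \mathrm L^1(\Omega;V)\setminus\big(u_0+\mathrm W^{1,p}_0(\Omega;V)\big),\end{cases}$$ is lower semicontinuous with respect to the norm topology of $\mathrm L^1(\Omega;V)$. -/

import Mathlib

open MeasureTheory
open scoped ENNReal ContDiff

noncomputable section

namespace DirichletClass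

/-- Euclidean space `ℝⁿ`. -/
abbrev E (n : ℕ) : Type := EuclideanSpace ℝ (Fin n)

section Operators

variable {n : ℕ} {V W : Type*} [NormedAddCommGroup V] [NormedSpace ℝ V]
  [NormedAddCommGroup W] [NormedSpace ℝ W]

/-- The symbol `𝔸[ξ] = ∑ α, ξ_α 𝔸_α` of the first order operator `𝔸 = ∑ α, 𝔸_α ∂_α`, which is
given by its coefficients `𝔸_α ∈ L(V, W)`. -/
def symbol (A : Fin n → V →L[ℝ] W) (ξ : E n) : V →L[ℝ] W := ∑ α, ξ α • A α

/-- `ℝ`-ellipticity: the symbol is injective for every nonzero real frequency. -/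
def IsRElliptic (A : Fin n → V →L[ℝ] W) : Prop :=
  ∀ ξ : E n, ξ ≠ 0 → Function.Injective (symbol A ξ)

/-- `∑ α, 𝔸_α (D e_α)`: the value of `𝔸 u` at a point where `u` has the (weak) gradient `D`. -/
def applyGrad (A : Fin n → V →L[ℝ] W) (D : E n →L[ℝ] V) : W :=
  ∑ α, A α (D (EuclideanSpace.single α 1))

end Operators

section Sobolev

variable {n : ℕ} {V : Type*} [NormedAddCommGroup V] [NormedSpace ℝ V]

/-- `φ ∈ C_c^∞(Ω; V)`, as a function on the whole space. -/
structure IsTest (Ω : Set (E n)) (φ : E n → V) : Prop where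
  contDiff : ContDiff ℝ ∞ φ
  hasCompactSupport : HasCompactSupport φ
  tsupport_subset : tsupport φ ⊆ Ω

/-- `D` is the weak gradient of `u` on `Ω`: both are locally integrable on `Ω` and
`∫_Ω (∂_e φ) u = - ∫_Ω φ (D e)` for all scalar test functions `φ` and all directions `e`. -/
structure IsWeakGrad (Ω : Set (E n)) (u : E n → V) (D : E n → E n →L[ℝ] V) : Prop where
  locallyIntegrableOn : LocallyIntegrableOn u Ω
  locallyIntegrableOn_grad : LocallyIntegrableOn D Ω
  integral_eq : ∀ φ : E n → ℝ, IsTest Ω φ → ∀ e : E n,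
    ∫ x in Ω, (fderiv ℝ φ x e) • u x = - ∫ x in Ω, φ x • D x e

open Classical in
/-- The weak gradient of `u` on `Ω` (unique up to null sets), and `0` if there is none. -/
def weakGrad (Ω : Set (E n)) (u : E n → V) : E n → E n →L[ℝ] V :=
  if h : ∃ D, IsWeakGrad Ω u D then h.choose else 0

/-- `u ∈ W^{1,p}(Ω; V)`. -/
structure MemW1 (Ω : Set (E n)) (p : ℝ≥0∞) (u : E n → V) : Prop where
  exists_weakGrad : ∃ D, IsWeakGrad Ω u D
  memLp : MemLp u p (volume.restrict Ω)
  memLp_grad : MemLp (weakGrad Ω u) p (volume.restrict Ω)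

/-- `u ∈ W^{1,p}_0(Ω; V)`: `u` lies in the closure of `C_c^∞(Ω; V)` in `W^{1,p}(Ω; V)`. -/
structure MemW10 (Ω : Set (E n)) (p : ℝ≥0∞) (u : E n → V) : Prop where
  memW1 : MemW1 Ω p u
  exists_approx : ∀ ε : ℝ≥0∞, 0 < ε → ∃ φ : E n → V, IsTest Ω φ ∧
    eLpNorm (fun x => u x - φ x) p (volume.restrict Ω) < ε ∧
    eLpNorm (fun x => weakGrad Ω u x - fderiv ℝ φ x) p (volume.restrict Ω) < ε

/-- `u ∈ u₀ + W^{1,p}_0(Ω; V)`. -/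
def MemDirichlet (Ω : Set (E n)) (p : ℝ≥0∞) (u₀ u : E n → V) : Prop :=
  MemW10 Ω p (fun x => u x - u₀ x)

theorem weakGrad_spec {Ω : Set (E n)} {u : E n → V} (h : ∃ D, IsWeakGrad Ω u D) :
    IsWeakGrad Ω u (weakGrad Ω u) := by
  rw [weakGrad, dif_pos h]
  exact h.choose_spec

end Sobolev

section Functional

variable {n : ℕ} {V W : Type*} [NormedAddCommGroup V] [NormedSpace ℝ V]
  [NormedAddCommGroup W] [NormedSpace ℝ W]

open Classical in
/-- The functional `G : L¹(Ω; V) → [-∞, ∞]` that equals `∫_Ω g(𝔸u) dx` on the Dirichlet class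
`u₀ + W^{1,p}_0(Ω; V)` and `+∞` elsewhere. -/
def energy (A : Fin n → V →L[ℝ] W) (Ω : Set (E n)) (p : ℝ≥0∞) (g : W → ℝ) (u₀ : E n → V)
    (u : Lp V 1 ((volume : Measure (E n)).restrict Ω)) : EReal :=
  if MemDirichlet Ω p u₀ u then
    ((∫ x in Ω, g (applyGrad A (weakGrad Ω u x)) : ℝ) : EReal)
  else ⊤

end Functional

end DirichletClass

end

set_option linter.unusedSectionVars false

namespace DirichletClass

/-! ### A Minkowski type inequality -/

section Minkowski

/-! Lower semicontinuity means that sublevel sets are closed in `L¹`. After subtraction of `u₀`, let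
`v` be an `L¹` limit of functions `w ∈ W₀^{1,p}` with `∫ g(𝔸w + 𝔸u₀) ≤ t`. The lower growth bound
controls `𝔸w + 𝔸u₀` in `L^p`. Weak compactness and Mazur's lemma are replaced by a direct argument.
The sets of admissible `w` within `L¹` distance `1/(k+1)` of `v` decrease and are midpoint convex.
Near-minimisers of a Euclidean `p`-energy of `𝔸w + 𝔸u₀` on them have vanishing midpoint defect,
because the infima increase to a finite limit. By uniform convexity, `𝔸w_k` is then Cauchy in `L^p`
(`exists_seq_eLpNorm_sub_le`). Korn's and Poincaré's inequalities turn this into convergence in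
`W^{1,p}`. The limit lies in `W₀^{1,p}` and equals `v`, and Fatou's lemma gives `∫ g(𝔸v + 𝔸u₀) ≤ t`
(`memW10_and_integral_le_of_approx`).

The analytic core is the Korn inequality `‖∇φ‖_p ≤ C ‖𝔸φ‖_p` for test functions
(`exists_eLpNorm_fderiv_le`), the only place where ellipticity enters. Injectivity of the symbol
gives the smooth left inverse `(B*B)⁻¹B*`, homogeneous of degree `-1`. Hence the components of `∇φ`
come from those of `𝔸φ` by Fourier multipliers `M` that are smooth off the origin, even and
homogeneous of degree zero.

Such multipliers are bounded on `L^p` by the method of rotations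
(`exists_enorm_integral_homogeneous_le`). The identity `M = ∑ (ξ_l M/|ξ|)(ξ_l/|ξ|)` writes `M`
through odd factors. Each odd factor is, up to a constant, `∫ b(tξ) dt/t` with `b` smooth and
supported in an annulus, hence the multiplier of `∫ K(y) H_y dy`. Here `K` is the Schwartz function
with `𝓕 K = b`, and `H_y` is the Hilbert transform along `y`. Minkowski's inequality and Fubini
reduce everything to one dimension. There M. Riesz' theorem is proved for conjugate Poisson
integrals: for `p ≤ 2` by integrating the `p`-th power of a Cauchy transform along a contour, for `p
> 2` by duality. Truncated kernels keep all integrals absolutely convergent, with bounds uniform in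
the truncation. -/

theorem lintegral_mul_rpow_le {Y : Type*} [MeasurableSpace Y] {ν : Measure Y} {p : ℝ} (hp : 1 < p)
    {κ G : Y → ℝ≥0∞} (hκ : AEMeasurable κ ν) (hG : AEMeasurable G ν) :
    (∫⁻ y, κ y * G y ∂ν) ^ p ≤ (∫⁻ y, κ y ∂ν) ^ (p - 1) * ∫⁻ y, κ y * G y ^ p ∂ν := by
  have hpq := Real.HolderConjugate.conjExponent hp
  set q := p.conjExponent with hq
  have hp0 : 0 < p := by linarith
  have hq0 : 0 < q := hpq.symm.pos
  have hsum : 1 / q + 1 / p = 1 := by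
    have := hpq.inv_add_inv_eq_one
    rw [one_div, one_div]; linarith
  -- Hölder for the splitting `κ G = κ^{1/q} · (κ^{1/p} G)`.
  have key := ENNReal.lintegral_mul_le_Lp_mul_Lq ν hpq.symm
    (f := fun y => κ y ^ (1 / q)) (g := fun y => κ y ^ (1 / p) * G y)
    (hκ.pow_const _) ((hκ.pow_const _).mul hG)
  have e1 : ∀ y, ((fun y => κ y ^ (1 / q)) * fun y => κ y ^ (1 / p) * G y) y = κ y * G y := by
    intro y
    simp only [Pi.mul_apply]
    rw [← mul_assoc, ← ENNReal.rpow_add_of_nonneg _ _ (by positivity) (by positivity), hsum,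
      ENNReal.rpow_one]
  have e2 : ∀ y, (κ y ^ (1 / q)) ^ q = κ y := by
    intro y; rw [← ENNReal.rpow_mul, one_div_mul_cancel hq0.ne', ENNReal.rpow_one]
  have e3 : ∀ y, (κ y ^ (1 / p) * G y) ^ p = κ y * G y ^ p := by
    intro y
    rw [ENNReal.mul_rpow_of_nonneg _ _ hp0.le, ← ENNReal.rpow_mul, one_div_mul_cancel hp0.ne',
      ENNReal.rpow_one]
  simp only [e1, e2, e3] at key
  calc (∫⁻ y, κ y * G y ∂ν) ^ p
      ≤ ((∫⁻ y, κ y ∂ν) ^ (1 / q) * (∫⁻ y, κ y * G y ^ p ∂ν) ^ (1 / p)) ^ p :=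
        ENNReal.rpow_le_rpow key hp0.le
    _ = _ := by
        rw [ENNReal.mul_rpow_of_nonneg _ _ hp0.le, ← ENNReal.rpow_mul, ← ENNReal.rpow_mul,
          one_div_mul_cancel hp0.ne', ENNReal.rpow_one]
        congr 2
        have : 1 / q = 1 - 1 / p := by linarith
        rw [this]; field_simp

/-- Hölder with respect to the weight `κ` leaves `∫ κ G^p`, to which Tonelli applies. -/
theorem lintegral_lintegral_mul_rpow_le {X Y : Type*} [MeasurableSpace X] [MeasurableSpace Y]
    {μ : Measure X} {ν : Measure Y} [SFinite μ] [SFinite ν] {p : ℝ} (hp : 1 < p)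
    {κ : Y → ℝ≥0∞} {G : X → Y → ℝ≥0∞} (hκ : Measurable κ) (hG : Measurable (Function.uncurry G))
    {D : ℝ≥0∞} (hD : ∀ y, ∫⁻ x, G x y ^ p ∂μ ≤ D) :
    ∫⁻ x, (∫⁻ y, κ y * G x y ∂ν) ^ p ∂μ ≤ (∫⁻ y, κ y ∂ν) ^ p * D := by
  have hmeas : Measurable (Function.uncurry fun x y => κ y * G x y ^ p) :=
    (hκ.comp measurable_snd).mul (hG.pow_const _)
  calc ∫⁻ x, (∫⁻ y, κ y * G x y ∂ν) ^ p ∂μ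
      ≤ ∫⁻ x, (∫⁻ y, κ y ∂ν) ^ (p - 1) * ∫⁻ y, κ y * G x y ^ p ∂ν ∂μ :=
        lintegral_mono fun x => lintegral_mul_rpow_le hp hκ.aemeasurable
          (hG.comp measurable_prodMk_left).aemeasurable
    _ = (∫⁻ y, κ y ∂ν) ^ (p - 1) * ∫⁻ x, ∫⁻ y, κ y * G x y ^ p ∂ν ∂μ :=
        lintegral_const_mul _ hmeas.lintegral_prod_right
    _ = (∫⁻ y, κ y ∂ν) ^ (p - 1) * ∫⁻ y, κ y * ∫⁻ x, G x y ^ p ∂μ ∂ν := by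
        rw [lintegral_lintegral_swap hmeas.aemeasurable]
        congr 1
        refine lintegral_congr fun y => ?_
        rw [lintegral_const_mul]
        exact (hG.comp measurable_prodMk_right).pow_const _
    _ ≤ (∫⁻ y, κ y ∂ν) ^ (p - 1) * ∫⁻ y, κ y * D ∂ν := by
        gcongr with y; exact hD y
    _ = (∫⁻ y, κ y ∂ν) ^ p * D := by
        rw [lintegral_mul_const _ hκ, ← mul_assoc]
        congr 1
        nth_rewrite 2 [← ENNReal.rpow_one (∫⁻ y, κ y ∂ν)]
        rw [← ENNReal.rpow_add_of_nonneg _ _ (by linarith) zero_le_one]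
        congr 1; ring

/-- Minkowski's integral inequality for a superposition of functions with bounded `L^p` norm. -/
theorem eLpNorm_integral_smul_le {X Y F : Type*} [MeasurableSpace X] [MeasurableSpace Y]
    [NormedAddCommGroup F] [NormedSpace ℝ F]
    {μ : Measure X} {ν : Measure Y} [SFinite μ] [SFinite ν] {p : ℝ} (hp : 1 < p)
    {k : X → Y → F} {κ : Y → ℝ≥0∞} {G : X → Y → ℝ} (hκ : Measurable κ)
    (hG : Measurable (Function.uncurry G)) (hk : ∀ x y, ‖k x y‖ₑ ≤ κ y * ‖G x y‖ₑ)
    {D : ℝ≥0∞} (hD : ∀ y, eLpNorm (fun x => G x y) (ENNReal.ofReal p) μ ≤ D) :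
    eLpNorm (fun x => ∫ y, k x y ∂ν) (ENNReal.ofReal p) μ ≤ (∫⁻ y, κ y ∂ν) * D := by
  have hp0 : 0 < p := by linarith
  have h1 : ENNReal.ofReal p ≠ 0 := by simpa using hp0
  have h2 : (ENNReal.ofReal p).toReal = p := ENNReal.toReal_ofReal hp0.le
  have hD' : ∀ y, ∫⁻ x, ‖G x y‖ₑ ^ p ∂μ ≤ D ^ p := by
    intro y
    have := ENNReal.rpow_le_rpow (hD y) hp0.le
    rw [eLpNorm_eq_lintegral_rpow_enorm_toReal h1 ENNReal.ofReal_ne_top, h2, ← ENNReal.rpow_mul,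
      one_div_mul_cancel hp0.ne', ENNReal.rpow_one] at this
    exact this
  have key := lintegral_lintegral_mul_rpow_le (μ := μ) (ν := ν) (G := fun x y => ‖G x y‖ₑ) hp hκ hG.enorm hD'
  rw [eLpNorm_eq_lintegral_rpow_enorm_toReal h1 ENNReal.ofReal_ne_top, h2]
  calc (∫⁻ x, ‖∫ y, k x y ∂ν‖ₑ ^ p ∂μ) ^ (1 / p)
      ≤ ((∫⁻ y, κ y ∂ν) ^ p * D ^ p) ^ (1 / p) := by
        refine ENNReal.rpow_le_rpow (le_trans (lintegral_mono fun x => ?_) key) (by positivity)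
        refine ENNReal.rpow_le_rpow ?_ hp0.le
        exact (enorm_integral_le_lintegral_enorm _).trans (lintegral_mono fun y => hk x y)
    _ = _ := by
        rw [← ENNReal.mul_rpow_of_nonneg _ _ hp0.le, ← ENNReal.rpow_mul, mul_one_div_cancel hp0.ne',
          ENNReal.rpow_one]

end Minkowski

/-! ### Bounded functions with bounded support -/

/-- Bounded measurable functions with bounded support. -/
structure IsBddSupp {X : Type*} [NormedAddCommGroup X] [MeasurableSpace X] (f : X → ℝ) :
    Prop where
  measurable : Measurable f
  bounded : ∃ B, ∀ x, |f x| ≤ B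
  support : ∃ R, ∀ x, R < ‖x‖ → f x = 0

/-! ### The pointwise inequality behind M. Riesz' theorem -/

/-- Away from the imaginary axis the real part dominates `|z|`. Near it, `arg (z ^ p)` lies beyond
`π/2`, so `-Re (z ^ p)` is comparable to `|z| ^ p`. The last term integrates to zero along boundary
values of holomorphic functions. -/
theorem exists_abs_im_rpow_le {p : ℝ} (hp : 1 < p) (hp2 : p ≤ 2) :
    ∃ A B : ℝ, 0 ≤ A ∧ 0 ≤ B ∧ ∀ z : ℂ, 0 ≤ z.re →
      |z.im| ^ p ≤ A * z.re ^ p - B * (z ^ (p : ℂ)).re := by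
  have hπ := Real.pi_pos
  -- The threshold angle is the midpoint of `π/(2p)` and `π/2`, so that `φ < π/2 < φ p`. `B`
  -- normalises the sector beyond `φ`, and `A` absorbs the error `B |z|^p` in the sector before it.
  set φ : ℝ := Real.pi / 4 * (1 + 1 / p) with hφ
  have hp0 : 0 < p := by linarith
  have hpinv : 1 / p < 1 := by rw [div_lt_one hp0]; exact hp
  have hpinv0 : 0 < 1 / p := by positivity
  have hφ0 : 0 < φ := by positivity
  have hφ1 : φ < Real.pi / 2 := by rw [hφ]; nlinarith
  have hpφ : φ * p = Real.pi / 4 * (p + 1) := by rw [hφ]; field_simp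
  have hc1 : Real.cos (φ * p) < 0 := by
    apply Real.cos_neg_of_pi_div_two_lt_of_lt
    · rw [hpφ]; nlinarith
    · rw [hpφ]; nlinarith
  have hδ : 0 < Real.cos φ := Real.cos_pos_of_mem_Ioo ⟨by linarith, hφ1⟩
  set B : ℝ := 1 / (-Real.cos (φ * p)) with hB
  have hB0 : 0 < B := by rw [hB]; exact one_div_pos.mpr (by linarith)
  set A : ℝ := (1 + B) / Real.cos φ ^ p with hA
  have hA0 : 0 < A := by positivity
  refine ⟨A, B, hA0.le, hB0.le, fun z hz => ?_⟩
  have harg : |z.arg| ≤ Real.pi / 2 := Complex.abs_arg_le_pi_div_two_iff.mpr hz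
  have hre : (z ^ (p : ℂ)).re = ‖z‖ ^ p * Real.cos (|z.arg| * p) := by
    rw [Complex.cpow_ofReal]
    have : Real.cos (|z.arg| * p) = Real.cos (z.arg * p) := by
      rw [← Real.cos_abs (z.arg * p), abs_mul, abs_of_pos hp0]
    rw [this]
    rw [Complex.re_ofReal_mul]
    simp [-Complex.ofReal_cos, -Complex.ofReal_sin]
  have hzre : z.re = ‖z‖ * Real.cos (|z.arg|) := by
    rw [Real.cos_abs, Complex.norm_mul_cos_arg]
  have him : |z.im| ^ p ≤ ‖z‖ ^ p :=
    Real.rpow_le_rpow (abs_nonneg _) (Complex.abs_im_le_norm z) hp0.le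
  have hzn : 0 ≤ ‖z‖ ^ p := by positivity
  rw [hre]
  rcases le_total |z.arg| φ with h | h
  · have hcos : Real.cos φ ≤ Real.cos |z.arg| :=
      Real.cos_le_cos_of_nonneg_of_le_pi (abs_nonneg _) (by linarith) h
    have h3 : Real.cos φ ^ p ≤ Real.cos |z.arg| ^ p := Real.rpow_le_rpow hδ.le hcos hp0.le
    have h4 : z.re ^ p = ‖z‖ ^ p * Real.cos |z.arg| ^ p := by
      rw [hzre, Real.mul_rpow (norm_nonneg _) (hδ.le.trans hcos)]
    have h5 : (1 + B) * ‖z‖ ^ p ≤ A * z.re ^ p := by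
      rw [h4, hA, div_mul_eq_mul_div, le_div_iff₀ (by positivity)]
      nlinarith [mul_le_mul_of_nonneg_left h3 (mul_nonneg (by positivity : 0 ≤ 1 + B) hzn)]
    have h6 : B * (‖z‖ ^ p * Real.cos (|z.arg| * p)) ≤ B * ‖z‖ ^ p := by
      have := mul_le_mul_of_nonneg_left (Real.cos_le_one (|z.arg| * p)) hzn
      nlinarith
    linarith
  · have hcos : Real.cos (|z.arg| * p) ≤ Real.cos (φ * p) := by
      apply Real.cos_le_cos_of_nonneg_of_le_pi (by positivity)
      -- Here `p ≤ 2` keeps `|arg z| p` inside `[0, π]`, where the cosine decreases.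
      · nlinarith
      · exact mul_le_mul_of_nonneg_right h hp0.le
    have h7 : 1 ≤ B * (-Real.cos (|z.arg| * p)) := by
      rw [hB, div_mul_eq_mul_div, one_mul, le_div_iff₀ (by linarith)]; linarith
    have h8 : 0 ≤ A * z.re ^ p := by positivity
    nlinarith [mul_le_mul_of_nonneg_left h7 hzn]

/-! ### The Cauchy transform in the upper half plane -/

/-- `i ∫ f(t) / (z - t) dt`. -/
noncomputable def cauchyTransform (f : ℝ → ℝ) (z : ℂ) : ℂ :=
  ∫ t : ℝ, (f t : ℂ) * (Complex.I / (z - t))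

theorem IsBddSupp.integrable_real {f : ℝ → ℝ} (hf : IsBddSupp f) : Integrable f := by
  obtain ⟨B, hB⟩ := hf.bounded
  obtain ⟨R, hR⟩ := hf.support
  have h : IntegrableOn f (Metric.closedBall (0 : ℝ) R) :=
    Measure.integrableOn_of_bounded (M := B) (by rw [Real.volume_closedBall]; exact ENNReal.ofReal_ne_top)
      hf.measurable.aestronglyMeasurable (Filter.Eventually.of_forall hB)
  refine (integrableOn_iff_integrable_of_support_subset fun x hx => ?_).mp h
  by_contra hc
  exact hx (hR x (by simpa using hc))

theorem im_le_norm_sub_ofReal (z : ℂ) (t : ℝ) : z.im ≤ ‖z - t‖ := by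
  have := Complex.abs_im_le_norm (z - t)
  simp only [Complex.sub_im, Complex.ofReal_im, sub_zero] at this
  exact (le_abs_self _).trans this

theorem measurable_cauchy_integrand {f : ℝ → ℝ} (hf : Measurable f) (z : ℂ) :
    Measurable fun t : ℝ => (f t : ℂ) * (Complex.I / (z - t)) := by fun_prop

theorem integrable_cauchy_integrand {f : ℝ → ℝ} (hf : Integrable f) (hm : Measurable f) {z : ℂ}
    (hz : 0 < z.im) : Integrable fun t : ℝ => (f t : ℂ) * (Complex.I / (z - t)) := by
  refine (hf.norm.div_const z.im).mono' (measurable_cauchy_integrand hm z).aestronglyMeasurable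
    (Filter.Eventually.of_forall fun t => ?_)
  simp only [norm_mul, norm_div, Complex.norm_I, Complex.norm_real]
  rw [mul_one_div]
  exact div_le_div_of_nonneg_left (norm_nonneg _) hz (im_le_norm_sub_ofReal z t)

theorem differentiableAt_cauchyTransform {f : ℝ → ℝ} (hf : Integrable f) (hm : Measurable f)
    {z : ℂ} (hz : 0 < z.im) : DifferentiableAt ℂ (cauchyTransform f) z := by
  have hs : {w : ℂ | z.im / 2 < w.im} ∈ nhds z :=
    (isOpen_lt continuous_const Complex.continuous_im).mem_nhds (by
      simp only [Set.mem_ofPred_eq]; linarith)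
  refine (hasDerivAt_integral_of_dominated_loc_of_deriv_le
    (F := fun (w : ℂ) (t : ℝ) => (f t : ℂ) * (Complex.I / (w - t)))
    (F' := fun (w : ℂ) (t : ℝ) => (f t : ℂ) * (-Complex.I / (w - t) ^ 2))
    (bound := fun t => ‖f t‖ / (z.im / 2) ^ 2)
    hs ?_ (integrable_cauchy_integrand hf hm hz) ?_ ?_ ?_ ?_).2.differentiableAt
  · exact Filter.Eventually.of_forall fun w => (measurable_cauchy_integrand hm w).aestronglyMeasurable
  · have : Measurable fun t : ℝ => (f t : ℂ) * (-Complex.I / (z - t) ^ 2) := by fun_prop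
    exact this.aestronglyMeasurable
  · refine Filter.Eventually.of_forall fun t w hw => ?_
    simp only [Set.mem_ofPred_eq] at hw
    simp only [norm_mul, norm_div, norm_neg, Complex.norm_I, Complex.norm_real, norm_pow]
    rw [mul_one_div]
    have := im_le_norm_sub_ofReal w t
    exact div_le_div_of_nonneg_left (norm_nonneg _) (by positivity)
      (pow_le_pow_left₀ (by positivity) (by linarith) 2)
  · exact hf.norm.div_const _
  · refine Filter.Eventually.of_forall fun t w hw => ?_
    simp only [Set.mem_ofPred_eq] at hw
    have hne : w - t ≠ 0 := by
      intro h
      have := im_le_norm_sub_ofReal w t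
      rw [h, norm_zero] at this; linarith
    have h1 : HasDerivAt (fun w : ℂ => w - t) 1 w := (hasDerivAt_id w).sub_const _
    have h2 := (h1.inv hne).const_mul ((f t : ℂ) * Complex.I)
    refine (h2.congr_deriv ?_).congr_of_eventuallyEq (Filter.Eventually.of_forall fun w => ?_)
    · ring
    · simp only [Pi.inv_apply]; ring

theorem norm_cauchyTransform_le_of_lt_norm {f : ℝ → ℝ} (hf : Integrable f) {R : ℝ}
    (hR : ∀ x, R < ‖x‖ → f x = 0) {z : ℂ} (hz : R < ‖z‖) :
    ‖cauchyTransform f z‖ ≤ (∫ t, ‖f t‖) / (‖z‖ - R) := by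
  rw [div_eq_mul_inv, ← integral_mul_const]
  refine norm_integral_le_of_norm_le (hf.norm.mul_const _) (Filter.Eventually.of_forall fun t => ?_)
  simp only [norm_mul, norm_div, Complex.norm_I, Complex.norm_real]
  by_cases h : R < ‖t‖
  · simp [hR t h]
  · rw [one_div]
    have := norm_sub_norm_le z t
    rw [Complex.norm_real] at this
    exact mul_le_mul_of_nonneg_left
      (inv_anti₀ (by linarith) (by linarith [not_lt.mp h])) (norm_nonneg _)

theorem norm_cauchyTransform_le {f : ℝ → ℝ} (hf : Integrable f) {z : ℂ} (hz : 0 < z.im) :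
    ‖cauchyTransform f z‖ ≤ (∫ t, ‖f t‖) / z.im := by
  rw [div_eq_mul_inv, ← integral_mul_const]
  refine norm_integral_le_of_norm_le (hf.norm.mul_const _) (Filter.Eventually.of_forall fun t => ?_)
  simp only [norm_mul, norm_div, Complex.norm_I, Complex.norm_real]
  rw [one_div]
  gcongr
  exact im_le_norm_sub_ofReal z t

/-- The real part is the Poisson kernel (of mass `π`), the imaginary part its conjugate. For real
`f` the Cauchy transform thus couples a convolution with an integrable kernel to the operator that
has to be bounded. -/
theorem div_sub_ofReal_eq (x ε t : ℝ) (hε : 0 < ε) :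
    Complex.I / ((x + ε * Complex.I : ℂ) - t) =
      ((ε / ((x - t) ^ 2 + ε ^ 2) : ℝ) : ℂ) + (((x - t) / ((x - t) ^ 2 + ε ^ 2) : ℝ) : ℂ) * Complex.I := by
  have h1 : ((x : ℂ) + ε * Complex.I) - t ≠ 0 := by
    intro h
    have := congrArg Complex.im h
    simp at this; exact hε.ne' this
  have h2 : (((x - t) ^ 2 + ε ^ 2 : ℝ) : ℂ) ≠ 0 := by
    have : 0 < (x - t) ^ 2 + ε ^ 2 := by positivity
    exact_mod_cast this.ne'
  push_cast at h2 ⊢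
  rw [div_eq_iff h1]
  field_simp
  ring_nf
  simp only [Complex.I_sq]
  ring

theorem cauchyTransform_re {f : ℝ → ℝ} (hf : Integrable f) (hm : Measurable f) (x : ℝ) {ε : ℝ}
    (hε : 0 < ε) : (cauchyTransform f (x + ε * Complex.I)).re =
      ∫ t, ε / ((x - t) ^ 2 + ε ^ 2) * f t := by
  have := integral_re (𝕜 := ℂ) (integrable_cauchy_integrand hf hm (z := x + ε * Complex.I)
    (by simpa using hε))
  simp only [RCLike.re_to_complex] at this
  rw [cauchyTransform, ← this]
  refine integral_congr_ae (Filter.Eventually.of_forall fun t => ?_)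
  simp only [div_sub_ofReal_eq x ε t hε, Complex.re_ofReal_mul]
  simp [-Complex.ofReal_div, -Complex.ofReal_add, -Complex.ofReal_sub, -Complex.ofReal_pow]
  ring

theorem cauchyTransform_im {f : ℝ → ℝ} (hf : Integrable f) (hm : Measurable f) (x : ℝ) {ε : ℝ}
    (hε : 0 < ε) : (cauchyTransform f (x + ε * Complex.I)).im =
      ∫ t, (x - t) / ((x - t) ^ 2 + ε ^ 2) * f t := by
  have := integral_im (𝕜 := ℂ) (integrable_cauchy_integrand hf hm (z := x + ε * Complex.I)
    (by simpa using hε))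
  simp only [RCLike.im_to_complex] at this
  rw [cauchyTransform, ← this]
  refine integral_congr_ae (Filter.Eventually.of_forall fun t => ?_)
  simp only [div_sub_ofReal_eq x ε t hε, Complex.im_ofReal_mul]
  simp [-Complex.ofReal_div, -Complex.ofReal_add, -Complex.ofReal_sub, -Complex.ofReal_pow]
  ring

/-! ### Duality for Lebesgue norms -/

/-- The duality map `s ↦ |s| ^ (p - 2) s`. -/
noncomputable def dualPow (p s : ℝ) : ℝ := max s 0 ^ (p - 1) - max (-s) 0 ^ (p - 1)

theorem dualPow_zero (p : ℝ) : dualPow p 0 = 0 := by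
  simp [dualPow]

theorem continuous_dualPow {p : ℝ} (hp : 1 < p) : Continuous (dualPow p) := by
  unfold dualPow
  have h : 0 ≤ p - 1 := by linarith
  exact ((continuous_id.max continuous_const).rpow_const fun _ => Or.inr h).sub
    ((continuous_neg.max continuous_const).rpow_const fun _ => Or.inr h)

theorem abs_dualPow {p : ℝ} (hp : 1 < p) (s : ℝ) : |dualPow p s| = |s| ^ (p - 1) := by
  have h0 : (0 : ℝ) ^ (p - 1) = 0 := Real.zero_rpow (by linarith)
  unfold dualPow
  rcases le_total 0 s with h | h
  · rw [max_eq_left h, max_eq_right (by linarith : -s ≤ 0), h0, sub_zero, abs_of_nonneg h,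
      abs_of_nonneg (by positivity)]
  · rw [max_eq_right h, max_eq_left (by linarith : 0 ≤ -s), h0, zero_sub, abs_neg,
      abs_of_nonpos h, abs_of_nonneg (Real.rpow_nonneg (by linarith) _)]

theorem mul_dualPow {p : ℝ} (hp : 1 < p) (s : ℝ) : s * dualPow p s = |s| ^ p := by
  have h0 : (0 : ℝ) ^ (p - 1) = 0 := Real.zero_rpow (by linarith)
  have h1 : ∀ r : ℝ, 0 ≤ r → r * r ^ (p - 1) = r ^ p := by
    intro r hr
    rcases hr.eq_or_lt with rfl | hr
    · rw [zero_mul, Real.zero_rpow (by linarith)]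
    · nth_rewrite 1 [← Real.rpow_one r]
      rw [← Real.rpow_add hr]; congr 1; ring
  unfold dualPow
  rcases le_total 0 s with h | h
  · rw [max_eq_left h, max_eq_right (by linarith : -s ≤ 0), h0, sub_zero, abs_of_nonneg h, h1 s h]
  · rw [max_eq_right h, max_eq_left (by linarith : 0 ≤ -s), h0, zero_sub, abs_of_nonpos h,
      ← h1 (-s) (by linarith)]
    ring

/-- Converse Hölder with the extremal test function: as `(p - 1) q = p`, the hypothesis reads `I ≤ C
I^{1/q}` with `I = ∫ |v|^p`. Finiteness of `I` is what allows the division. -/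
theorem eLpNorm_le_of_integral_mul_dualPow_le {X : Type*} [MeasurableSpace X] {μ : Measure X}
    {p q : ℝ} (hpq : p.HolderConjugate q) {v : X → ℝ} (hv : MemLp v (ENNReal.ofReal p) μ)
    {C : ℝ≥0∞}
    (h : ENNReal.ofReal (∫ x, v x * dualPow p (v x) ∂μ) ≤
      C * eLpNorm (fun x => dualPow p (v x)) (ENNReal.ofReal q) μ) :
    eLpNorm v (ENNReal.ofReal p) μ ≤ C := by
  have hp := hpq.lt
  have hp0 : 0 < p := by linarith
  have hq0 : 0 < q := hpq.symm.pos
  have hp1 : ENNReal.ofReal p ≠ 0 := by simpa using hp0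
  have hq1 : ENNReal.ofReal q ≠ 0 := by simpa using hq0
  set I : ℝ≥0∞ := ∫⁻ x, ‖v x‖ₑ ^ p ∂μ with hI
  have hIfin : I < ⊤ := by
    have := lintegral_rpow_enorm_lt_top_of_eLpNorm_lt_top hp1 ENNReal.ofReal_ne_top hv.2
    rwa [ENNReal.toReal_ofReal hp0.le] at this
  have hnv : eLpNorm v (ENNReal.ofReal p) μ = I ^ (1 / p) := by
    rw [eLpNorm_eq_lintegral_rpow_enorm_toReal hp1 ENNReal.ofReal_ne_top,
      ENNReal.toReal_ofReal hp0.le]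
  have hnw : eLpNorm (fun x => dualPow p (v x)) (ENNReal.ofReal q) μ = I ^ (1 / q) := by
    rw [eLpNorm_eq_lintegral_rpow_enorm_toReal hq1 ENNReal.ofReal_ne_top,
      ENNReal.toReal_ofReal hq0.le, hI]
    congr 1
    refine lintegral_congr fun x => ?_
    rw [← ofReal_norm, ← ofReal_norm, Real.norm_eq_abs, Real.norm_eq_abs, abs_dualPow hp,
      ENNReal.ofReal_rpow_of_nonneg (by positivity) hq0.le,
      ENNReal.ofReal_rpow_of_nonneg (by positivity) hp0.le, ← Real.rpow_mul (abs_nonneg _),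
      hpq.sub_one_mul_conj]
  have hint : ENNReal.ofReal (∫ x, v x * dualPow p (v x) ∂μ) = I := by
    simp only [mul_dualPow hp, ← Real.norm_eq_abs]
    rw [integral_eq_lintegral_of_nonneg_ae (Filter.Eventually.of_forall fun x => by positivity)
      ((hv.1.norm.aemeasurable.pow_const p).aestronglyMeasurable)]
    have : ∫⁻ x, ENNReal.ofReal (‖v x‖ ^ p) ∂μ = I := by
      refine lintegral_congr fun x => ?_
      rw [← ofReal_norm, ENNReal.ofReal_rpow_of_nonneg (norm_nonneg _) hp0.le]
    rw [this, ENNReal.ofReal_toReal hIfin.ne]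
  rw [hint, hnw] at h
  rw [hnv]
  rcases eq_or_ne I 0 with h0 | h0
  · rw [h0, ENNReal.zero_rpow_of_pos (by positivity)]; exact zero_le
  · have hsum : 1 / p + 1 / q = 1 := by
      have := hpq.inv_add_inv_eq_one
      rw [one_div, one_div]; linarith
    have h3 : I ^ (1 / p) * I ^ (1 / q) ≤ C * I ^ (1 / q) := by
      rw [← ENNReal.rpow_add _ _ h0 hIfin.ne, hsum, ENNReal.rpow_one]; exact h
    refine (ENNReal.mul_le_mul_iff_left ?_ ?_).mp h3
    · exact (ENNReal.rpow_pos (pos_iff_ne_zero.mpr h0) hIfin.ne).ne'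
    · exact ENNReal.rpow_ne_top_of_nonneg (by positivity) hIfin.ne

theorem abs_integral_mul_le_eLpNorm_mul_eLpNorm {X : Type*} [MeasurableSpace X] {μ : Measure X}
    {𝕜 : Type*} [RCLike 𝕜]
    {p q : ℝ} (hpq : p.HolderConjugate q) {f g : X → 𝕜} (hf : AEStronglyMeasurable f μ)
    (hg : AEStronglyMeasurable g μ) :
    ‖∫ x, f x * g x ∂μ‖ₑ ≤
      eLpNorm f (ENNReal.ofReal p) μ * eLpNorm g (ENNReal.ofReal q) μ := by
  have hp0 : 0 < p := hpq.pos
  have hq0 : 0 < q := hpq.symm.pos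
  have hp1 : ENNReal.ofReal p ≠ 0 := by simpa using hp0
  have hq1 : ENNReal.ofReal q ≠ 0 := by simpa using hq0
  rw [eLpNorm_eq_lintegral_rpow_enorm_toReal hp1 ENNReal.ofReal_ne_top,
    ENNReal.toReal_ofReal hp0.le,
    eLpNorm_eq_lintegral_rpow_enorm_toReal hq1 ENNReal.ofReal_ne_top,
    ENNReal.toReal_ofReal hq0.le]
  refine (enorm_integral_le_lintegral_enorm _).trans ?_
  refine le_trans (le_of_eq ?_) (ENNReal.lintegral_mul_le_Lp_mul_Lq μ hpq hf.enorm hg.enorm)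
  refine lintegral_congr fun x => ?_
  simp [enorm_mul]

/-! ### The contour integral of a power of the Cauchy transform -/

theorem exists_norm_cauchyTransform_le {f : ℝ → ℝ} (hf : IsBddSupp f) {ε : ℝ} (hε : 0 < ε) :
    ∃ K, 0 ≤ K ∧ ∀ z : ℂ, ε ≤ z.im → ‖cauchyTransform f z‖ ≤ K / (1 + ‖z‖) := by
  obtain ⟨R₀, hR₀⟩ := hf.support
  have hint := hf.integrable_real
  set R := max R₀ 0 with hRdef
  have hR : ∀ x, R < ‖x‖ → f x = 0 := fun x hx => hR₀ x ((le_max_left _ _).trans_lt hx)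
  have hR0 : 0 ≤ R := le_max_right _ _
  set M := ∫ t, ‖f t‖ with hM
  have hM0 : 0 ≤ M := integral_nonneg fun t => norm_nonneg _
  -- For `‖z‖ > 2R + 1` one has `1 + ‖z‖ ≤ 2(‖z‖ - R)`, which gives `2M`. Otherwise `1 + ‖z‖ ≤ 2R +
  -- 2`, and the bound `M / ε` suffices.
  refine ⟨2 * M + M / ε * (2 * R + 2), by positivity, fun z hz => ?_⟩
  have hz1 : 0 < 1 + ‖z‖ := by positivity
  rw [le_div_iff₀ hz1]
  have hq : 0 ≤ M / ε := by positivity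
  rcases lt_or_ge (2 * R + 1) ‖z‖ with h | h
  · have h1 := norm_cauchyTransform_le_of_lt_norm hint hR (z := z) (by linarith)
    rw [le_div_iff₀ (by linarith)] at h1
    have h2 : 0 ≤ ‖cauchyTransform f z‖ := norm_nonneg _
    nlinarith [mul_nonneg hq hR0]
  · have h1 := norm_cauchyTransform_le hint (z := z) (by linarith)
    have h2 : M / z.im ≤ M / ε := div_le_div_of_nonneg_left hM0 hε hz
    have h3 : ‖cauchyTransform f z‖ ≤ M / ε := h1.trans h2
    calc ‖cauchyTransform f z‖ * (1 + ‖z‖) ≤ M / ε * (2 * R + 2) := by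
          apply mul_le_mul h3 (by linarith) hz1.le hq
      _ ≤ _ := by linarith

theorem poisson_kernel_pos {ε : ℝ} (hε : 0 < ε) (t : ℝ) : 0 < ε / (t ^ 2 + ε ^ 2) := by
  positivity

/-- The Cauchy transform of a nonnegative, nonzero function stays in the open right half plane,
where the principal branch of `z ^ p` is holomorphic. -/
theorem cauchyTransform_re_pos {f : ℝ → ℝ} (hf : IsBddSupp f) (hf0 : ∀ x, 0 ≤ f x)
    (hne : ¬ f =ᵐ[volume] 0) {z : ℂ} (hz : 0 < z.im) : 0 < (cauchyTransform f z).re := by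
  have h := cauchyTransform_re hf.integrable_real hf.measurable z.re hz
  rw [Complex.re_add_im] at h
  rw [h]
  have hnn : ∀ t, 0 ≤ z.im / ((z.re - t) ^ 2 + z.im ^ 2) * f t := fun t =>
    mul_nonneg (poisson_kernel_pos hz _).le (hf0 t)
  have hi : Integrable fun t => z.im / ((z.re - t) ^ 2 + z.im ^ 2) * f t := by
    have hmeas : Measurable fun t => z.im / ((z.re - t) ^ 2 + z.im ^ 2) * f t := by
      have := hf.measurable
      fun_prop
    refine (hf.integrable_real.norm.const_mul (1 / z.im)).mono' hmeas.aestronglyMeasurable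
      (Filter.Eventually.of_forall fun t => ?_)
    rw [norm_mul]
    gcongr
    rw [Real.norm_of_nonneg (poisson_kernel_pos hz _).le, div_le_div_iff₀ (by positivity) hz]
    nlinarith [sq_nonneg (z.re - t)]
  refine lt_of_le_of_ne (integral_nonneg hnn) fun h0 => hne ?_
  have := (integral_eq_zero_iff_of_nonneg hnn hi).mp h0.symm
  filter_upwards [this] with t ht
  exact (mul_eq_zero.mp ht).resolve_left (poisson_kernel_pos hz _).ne'

theorem integrable_rpow_of_norm_le {E : Type*} [NormedAddCommGroup E] {F : ℝ → E} {K p : ℝ}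
    (hK : 0 ≤ K) (hp : 1 < p) (hm : AEStronglyMeasurable F)
    (hF : ∀ x, ‖F x‖ ≤ (K / (1 + |x|)) ^ p) : Integrable F := by
  have h : Integrable fun x : ℝ => K ^ p * (1 + ‖x‖) ^ (-p) :=
    (integrable_one_add_norm (by simpa using hp)).const_mul _
  refine h.mono' hm (Filter.Eventually.of_forall fun x => (hF x).trans (le_of_eq ?_))
  rw [Real.div_rpow hK (by positivity), Real.rpow_neg (by positivity), Real.norm_eq_abs]
  rfl

/-- Cauchy's theorem in the half plane above height `ε`. The power decays like `|z|^{-p}`, so `p >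
1` gives integrability and kills the far part of the contour. -/
theorem integral_cauchyTransform_cpow_eq_zero {f : ℝ → ℝ} (hf : IsBddSupp f)
    (hf0 : ∀ x, 0 ≤ f x) (hne : ¬ f =ᵐ[volume] 0) {ε p : ℝ} (hε : 0 < ε) (hp : 1 < p) :
    Integrable (fun x : ℝ => cauchyTransform f (x + ε * Complex.I) ^ (p : ℂ)) ∧
    ∫ x : ℝ, cauchyTransform f (x + ε * Complex.I) ^ (p : ℂ) = 0 := by
  obtain ⟨K, hK, hbound⟩ := exists_norm_cauchyTransform_le hf hε
  have hp0 : 0 < p := by linarith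
  set G : ℂ → ℂ := fun z => cauchyTransform f z ^ (p : ℂ) with hG
  have hGd : ∀ z : ℂ, 0 < z.im → DifferentiableAt ℂ G z := fun z hz =>
    (differentiableAt_cauchyTransform hf.integrable_real hf.measurable hz).cpow_const
      (Or.inl (cauchyTransform_re_pos hf hf0 hne hz))
  have hGn : ∀ z : ℂ, ε ≤ z.im → ‖G z‖ ≤ (K / (1 + ‖z‖)) ^ p := by
    intro z hz
    rw [hG]; simp only
    rw [Complex.norm_cpow_real]
    exact Real.rpow_le_rpow (norm_nonneg _) (hbound z hz) hp0.le
  have hGn' : ∀ (z : ℂ) (r : ℝ), 0 ≤ r → ε ≤ z.im → r ≤ ‖z‖ → ‖G z‖ ≤ (K / (1 + r)) ^ p := by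
    intro z r hr hz hrz
    refine (hGn z hz).trans (Real.rpow_le_rpow (by positivity) ?_ hp0.le)
    exact div_le_div_of_nonneg_left hK (by positivity) (by linarith)
  have hcont : Continuous fun x : ℝ => G (x + ε * Complex.I) := by
    refine continuous_iff_continuousAt.mpr fun x => ?_
    have h1 : ContinuousAt G (x + ε * Complex.I) := (hGd _ (by simpa using hε)).continuousAt
    exact ContinuousAt.comp (f := fun x : ℝ => (x : ℂ) + ε * Complex.I) h1
      (by fun_prop)
  have hint : Integrable fun x : ℝ => G (x + ε * Complex.I) := by
    refine integrable_rpow_of_norm_le hK hp hcont.aestronglyMeasurable fun x => ?_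
    refine hGn' _ _ (abs_nonneg x) (by simp) ?_
    have := Complex.abs_re_le_norm ((x : ℂ) + ε * Complex.I)
    simpa using this
  refine ⟨hint, ?_⟩
  have hlim := intervalIntegral_tendsto_integral hint Filter.tendsto_neg_atTop_atBot
    Filter.tendsto_id
  refine tendsto_nhds_unique hlim ?_
  have hdecay : Filter.Tendsto (fun N : ℝ => 4 * K ^ p * (1 + N) ^ (-(p - 1))) Filter.atTop
      (nhds 0) := by
    have h1 : Filter.Tendsto (fun N : ℝ => 1 + N) Filter.atTop Filter.atTop :=
      Filter.tendsto_atTop_add_const_left _ _ Filter.tendsto_id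
    have h2 := (tendsto_rpow_neg_atTop (by linarith : 0 < p - 1)).comp h1
    simpa using h2.const_mul (4 * K ^ p)
  refine squeeze_zero_norm' ?_ hdecay
  filter_upwards [Filter.eventually_gt_atTop 0] with N hN
  -- The rectangle `[-N, N] × [ε, ε + N]`: its other three sides have total length `4N` and stay at
  -- distance at least `N` from the origin, so they contribute `O(N^{1-p})`.
  have hrect := Complex.integral_boundary_rect_eq_zero_of_differentiableOn G
    (⟨-N, ε⟩ : ℂ) (⟨N, ε + N⟩ : ℂ) (by
      intro z hz
      refine (hGd z ?_).differentiableWithinAt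
      have h2 : z.im ∈ Set.uIcc ε (ε + N) := hz.2
      rw [Set.uIcc_of_le (by linarith)] at h2
      exact hε.trans_le h2.1)
  simp only at hrect
  have e1 : ‖∫ x in (-N)..N, G (x + ((ε + N : ℝ) : ℂ) * Complex.I)‖ ≤
      (K / (1 + N)) ^ p * |N - (-N)| := by
    refine intervalIntegral.norm_integral_le_of_norm_le_const fun x _ => ?_
    refine hGn' _ N hN.le (by simpa using hN.le) ?_
    have := Complex.abs_im_le_norm ((x : ℂ) + ((ε + N : ℝ) : ℂ) * Complex.I)
    simp only [Complex.add_im, Complex.ofReal_im, Complex.mul_im, Complex.ofReal_re, Complex.I_im,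
      Complex.I_re, mul_one, mul_zero, zero_add, add_zero] at this
    exact (by linarith [le_abs_self (ε + N)] : N ≤ |ε + N|).trans this
  have e2 : ∀ s : ℝ, |s| = N → ‖∫ y in ε..(ε + N), G ((s : ℂ) + y * Complex.I)‖ ≤
      (K / (1 + N)) ^ p * |ε + N - ε| := by
    intro s hs
    refine intervalIntegral.norm_integral_le_of_norm_le_const fun y hy => ?_
    rw [Set.uIoc_of_le (by linarith)] at hy
    refine hGn' _ N hN.le (by simpa using hy.1.le) ?_
    have := Complex.abs_re_le_norm ((s : ℂ) + y * Complex.I)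
    simp only [Complex.add_re, Complex.ofReal_re, Complex.mul_re, Complex.I_re, mul_zero,
      Complex.ofReal_im, Complex.I_im, mul_one, sub_self, add_zero] at this
    rwa [hs] at this
  have e3 := e2 N (abs_of_pos hN)
  have e4 := e2 (-N) (by rw [abs_neg, abs_of_pos hN])
  have hsolve : ∫ x in (-N)..N, G (x + ε * Complex.I) =
      (∫ x in (-N)..N, G (x + ((ε + N : ℝ) : ℂ) * Complex.I))
      - Complex.I • (∫ y in ε..(ε + N), G ((N : ℂ) + y * Complex.I))
      + Complex.I • (∫ y in ε..(ε + N), G (((-N : ℝ) : ℂ) + y * Complex.I)) := by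
    linear_combination hrect
  have hfin : ‖∫ x in (-N)..N, G (x + ε * Complex.I)‖ ≤ 4 * N * (K / (1 + N)) ^ p := by
    rw [hsolve]
    refine (norm_add_le _ _).trans ((add_le_add_left (norm_sub_le _ _) _).trans ?_)
    rw [norm_smul, norm_smul, Complex.norm_I, one_mul, one_mul]
    have a1 : |N - (-N)| = 2 * N := by rw [abs_of_pos (by linarith)]; ring
    have a2 : |ε + N - ε| = N := by rw [abs_of_pos (by linarith)]; ring
    rw [a1] at e1; rw [a2] at e3 e4
    linarith
  refine hfin.trans ?_
  have h1N : 0 < 1 + N := by linarith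
  rw [Real.div_rpow hK h1N.le, neg_sub, Real.rpow_sub h1N, Real.rpow_one]
  have : 0 ≤ K ^ p / (1 + N) ^ p := by positivity
  calc 4 * N * (K ^ p / (1 + N) ^ p) ≤ 4 * (1 + N) * (K ^ p / (1 + N) ^ p) := by
        nlinarith
    _ = _ := by ring

/-! ### The conjugate Poisson integral on the line -/

/-- The conjugate Poisson kernel. -/
noncomputable def conjKernel (ε t : ℝ) : ℝ := t / (t ^ 2 + ε ^ 2)

theorem continuous_conjKernel {ε : ℝ} (hε : 0 < ε) : Continuous (conjKernel ε) := by
  unfold conjKernel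
  exact continuous_id.div (by fun_prop) fun t => by positivity

theorem conjKernel_neg (ε t : ℝ) : conjKernel ε (-t) = -conjKernel ε t := by
  unfold conjKernel; rw [neg_sq, neg_div]

theorem abs_conjKernel_le {ε : ℝ} (hε : 0 < ε) (t : ℝ) : |conjKernel ε t| ≤ 1 / ε := by
  unfold conjKernel
  rw [abs_div, abs_of_pos (by positivity : 0 < t ^ 2 + ε ^ 2),
    div_le_div_iff₀ (by positivity) hε]
  nlinarith [sq_nonneg (|t| - ε), sq_abs t, sq_nonneg t, sq_nonneg ε]

/-- The conjugate Poisson integral. -/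
noncomputable def conjPoisson (ε : ℝ) (f : ℝ → ℝ) (x : ℝ) : ℝ := ∫ t, conjKernel ε (x - t) * f t

theorem integrable_conjKernel_mul {f : ℝ → ℝ} (hf : IsBddSupp f) {ε : ℝ} (hε : 0 < ε) (x : ℝ) :
    Integrable fun t => conjKernel ε (x - t) * f t := by
  have h1 : Continuous fun t => conjKernel ε (x - t) :=
    (continuous_conjKernel hε).comp (by fun_prop)
  exact hf.integrable_real.bdd_mul h1.aestronglyMeasurable
    (Filter.Eventually.of_forall fun t => abs_conjKernel_le hε _)

theorem measurable_conjPoisson {f : ℝ → ℝ} (hf : Measurable f) {ε : ℝ} (hε : 0 < ε) :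
    Measurable (conjPoisson ε f) := by
  have h : StronglyMeasurable (Function.uncurry fun x t => conjKernel ε (x - t) * f t) := by
    have := (continuous_conjKernel hε).measurable
    exact Measurable.stronglyMeasurable (by unfold Function.uncurry; fun_prop)
  exact h.integral_prod_right.measurable

theorem abs_conjPoisson_le {f : ℝ → ℝ} (hf : IsBddSupp f) {ε : ℝ} (hε : 0 < ε) (x : ℝ) :
    |conjPoisson ε f x| ≤ 1 / ε * ∫ t, ‖f t‖ := by
  rw [← integral_const_mul, ← Real.norm_eq_abs]
  refine norm_integral_le_of_norm_le (hf.integrable_real.norm.const_mul _)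
    (Filter.Eventually.of_forall fun t => ?_)
  rw [norm_mul]
  exact mul_le_mul_of_nonneg_right (abs_conjKernel_le hε _) (norm_nonneg _)

theorem lintegral_poisson_kernel {ε : ℝ} (hε : 0 < ε) :
    ∫⁻ t : ℝ, ENNReal.ofReal (ε / (t ^ 2 + ε ^ 2)) = ENNReal.ofReal Real.pi := by
  have h : ∀ t : ℝ, ε / (t ^ 2 + ε ^ 2) = 1 / ε * (1 + (t / ε) ^ 2)⁻¹ := by
    intro t; field_simp; ring
  have hint : Integrable fun t : ℝ => ε / (t ^ 2 + ε ^ 2) := by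
    simp only [h]
    exact (integrable_inv_one_add_sq.comp_div hε.ne').const_mul _
  rw [← ofReal_integral_eq_lintegral_ofReal hint
    (Filter.Eventually.of_forall fun t => (poisson_kernel_pos hε t).le)]
  congr 1
  simp only [h]
  rw [integral_const_mul, Measure.integral_comp_div (fun t : ℝ => (1 + t ^ 2)⁻¹),
    integral_univ_inv_one_add_sq, abs_of_pos hε, smul_eq_mul]
  field_simp

theorem eLpNorm_poisson_le {f : ℝ → ℝ} (hf : Measurable f) {ε p : ℝ} (hε : 0 < ε) (hp : 1 < p) :
    eLpNorm (fun x => ∫ t, ε / ((x - t) ^ 2 + ε ^ 2) * f t) (ENNReal.ofReal p) volume ≤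
      ENNReal.ofReal Real.pi * eLpNorm f (ENNReal.ofReal p) volume := by
  have h : ∀ x, ∫ t, ε / ((x - t) ^ 2 + ε ^ 2) * f t = ∫ t, ε / (t ^ 2 + ε ^ 2) * f (x - t) := by
    intro x
    rw [← integral_sub_left_eq_self (fun t => ε / (t ^ 2 + ε ^ 2) * f (x - t)) volume x]
    simp
  simp only [h]
  rw [← lintegral_poisson_kernel hε]
  refine eLpNorm_integral_smul_le hp (G := fun x t => f (x - t)) (by fun_prop)
    (by unfold Function.uncurry; fun_prop) (fun x t => ?_) (fun t => ?_)
  · rw [enorm_mul, Real.enorm_of_nonneg (poisson_kernel_pos hε t).le]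
  · exact (eLpNorm_comp_measurePreserving hf.aestronglyMeasurable
      (measurePreserving_sub_right volume t)).le

/-- M. Riesz' argument: the pointwise inequality is integrated along the line of height `ε`. The
holomorphic term vanishes, so the imaginary part is controlled by the real part, a convolution with
a kernel of mass `π`. The constant does not depend on `ε`. -/
theorem exists_eLpNorm_conjPoisson_le_of_nonneg {p : ℝ} (hp : 1 < p) (hp2 : p ≤ 2) :
    ∃ C : ℝ≥0∞, C ≠ ⊤ ∧ ∀ ε : ℝ, 0 < ε → ∀ f : ℝ → ℝ, IsBddSupp f → (∀ x, 0 ≤ f x) →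
      eLpNorm (conjPoisson ε f) (ENNReal.ofReal p) volume ≤
        C * eLpNorm f (ENNReal.ofReal p) volume := by
  obtain ⟨A, B, hA, hB, hAB⟩ := exists_abs_im_rpow_le hp hp2
  have hp0 : 0 < p := by linarith
  have hp1 : ENNReal.ofReal p ≠ 0 := by simpa using hp0
  refine ⟨ENNReal.ofReal A ^ (1 / p) * ENNReal.ofReal Real.pi, ?_, fun ε hε f hf hf0 => ?_⟩
  · exact ENNReal.mul_ne_top (ENNReal.rpow_ne_top_of_nonneg (by positivity) ENNReal.ofReal_ne_top)
      ENNReal.ofReal_ne_top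
  -- A null function is treated apart, since its Cauchy transform is zero and does not lie in the
  -- open half plane.
  by_cases hne : f =ᵐ[volume] 0
  · have : conjPoisson ε f = 0 := by
      funext x
      refine integral_eq_zero_of_ae ?_
      filter_upwards [hne] with t ht
      simp [ht]
    rw [this, eLpNorm_zero]; exact zero_le
  set F : ℝ → ℂ := fun x => cauchyTransform f (x + ε * Complex.I) with hF
  have hre : ∀ x, (F x).re = ∫ t, ε / ((x - t) ^ 2 + ε ^ 2) * f t := fun x =>
    cauchyTransform_re hf.integrable_real hf.measurable x hε
  have him : ∀ x, (F x).im = conjPoisson ε f x := fun x =>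
    cauchyTransform_im hf.integrable_real hf.measurable x hε
  have hpos : ∀ x, 0 < (F x).re := fun x => cauchyTransform_re_pos hf hf0 hne (by simpa using hε)
  obtain ⟨hi, h0⟩ := integral_cauchyTransform_cpow_eq_zero hf hf0 hne hε hp
  obtain ⟨K, hK, hbound⟩ := exists_norm_cauchyTransform_le hf hε
  have hFb : ∀ x, ‖F x‖ ≤ K / (1 + |x|) := by
    intro x
    refine (hbound (x + ε * Complex.I) (by simp)).trans ?_
    refine div_le_div_of_nonneg_left hK (by positivity) ?_
    have := Complex.abs_re_le_norm ((x : ℂ) + ε * Complex.I)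
    simp at this; linarith
  have hFc : Continuous F := by
    refine continuous_iff_continuousAt.mpr fun x => ?_
    have h1 : ContinuousAt (cauchyTransform f) (x + ε * Complex.I) :=
      (differentiableAt_cauchyTransform hf.integrable_real hf.measurable
        (by simpa using hε)).continuousAt
    exact ContinuousAt.comp (f := fun x : ℝ => (x : ℂ) + ε * Complex.I) h1 (by fun_prop)
  have hire : Integrable fun x => (F x).re ^ p := by
    refine integrable_rpow_of_norm_le hK hp
      ((Complex.continuous_re.comp hFc).rpow_const fun _ => Or.inr hp0.le).aestronglyMeasurable
      fun x => ?_
    rw [Real.norm_of_nonneg (Real.rpow_nonneg (hpos x).le _)]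
    exact Real.rpow_le_rpow (hpos x).le
      (((le_abs_self _).trans (Complex.abs_re_le_norm _)).trans (hFb x)) hp0.le
  have hiim : Integrable fun x => |(F x).im| ^ p := by
    refine integrable_rpow_of_norm_le hK hp
      ((Complex.continuous_im.comp hFc).abs.rpow_const fun _ => Or.inr hp0.le).aestronglyMeasurable
      fun x => ?_
    rw [Real.norm_of_nonneg (by positivity)]
    exact Real.rpow_le_rpow (abs_nonneg _) ((Complex.abs_im_le_norm _).trans (hFb x)) hp0.le
  have hint : ∫ x, |(F x).im| ^ p ≤ A * ∫ x, (F x).re ^ p := by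
    have h1 : ∫ x, |(F x).im| ^ p ≤ ∫ x, (A * (F x).re ^ p - B * (F x ^ (p : ℂ)).re) :=
      integral_mono hiim ((hire.const_mul A).sub (hi.re.const_mul B))
        fun x => hAB (F x) (hpos x).le
    have h2 : ∫ x, (F x ^ (p : ℂ)).re = 0 := by
      have := integral_re (𝕜 := ℂ) hi
      simp only [RCLike.re_to_complex] at this
      rw [this, h0, Complex.zero_re]
    have h3 : ∫ x, (A * (F x).re ^ p - B * (F x ^ (p : ℂ)).re) =
        A * ∫ x, (F x).re ^ p := by
      have hir : Integrable fun x => (F x ^ (p : ℂ)).re := hi.re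
      rw [integral_sub (hire.const_mul A) (hir.const_mul B), integral_const_mul,
        integral_const_mul, h2]
      ring
    linarith
  have hlint : ∫⁻ x, ‖conjPoisson ε f x‖ₑ ^ p ≤
      ENNReal.ofReal A * ∫⁻ x, ‖∫ t, ε / ((x - t) ^ 2 + ε ^ 2) * f t‖ₑ ^ p := by
    have c1 : ∀ r : ℝ, ‖r‖ₑ ^ p = ENNReal.ofReal (|r| ^ p) := fun r => by
      rw [← ofReal_norm, ENNReal.ofReal_rpow_of_nonneg (norm_nonneg _) hp0.le, Real.norm_eq_abs]
    simp only [← hre, ← him, c1]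
    have c2 : ∀ x, |(F x).re| = (F x).re := fun x => abs_of_pos (hpos x)
    simp only [c2]
    rw [← ofReal_integral_eq_lintegral_ofReal hiim
      (Filter.Eventually.of_forall fun x => by positivity),
      ← ofReal_integral_eq_lintegral_ofReal hire
      (Filter.Eventually.of_forall fun x => Real.rpow_nonneg (hpos x).le _),
      ← ENNReal.ofReal_mul hA]
    exact ENNReal.ofReal_le_ofReal hint
  calc eLpNorm (conjPoisson ε f) (ENNReal.ofReal p) volume
      ≤ ENNReal.ofReal A ^ (1 / p) *
        eLpNorm (fun x => ∫ t, ε / ((x - t) ^ 2 + ε ^ 2) * f t) (ENNReal.ofReal p) volume := by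
        rw [eLpNorm_eq_lintegral_rpow_enorm_toReal hp1 ENNReal.ofReal_ne_top,
          eLpNorm_eq_lintegral_rpow_enorm_toReal hp1 ENNReal.ofReal_ne_top,
          ENNReal.toReal_ofReal hp0.le, ← ENNReal.mul_rpow_of_nonneg _ _ (by positivity)]
        exact ENNReal.rpow_le_rpow hlint (by positivity)
    _ ≤ _ := by
        rw [mul_assoc]
        gcongr
        exact eLpNorm_poisson_le hf.measurable hε hp

theorem IsBddSupp.posPart {X : Type*} [NormedAddCommGroup X] [MeasurableSpace X] {f : X → ℝ}
    (hf : IsBddSupp f) : IsBddSupp fun x => max (f x) 0 := by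
  obtain ⟨B, hB⟩ := hf.bounded
  obtain ⟨R, hR⟩ := hf.support
  refine ⟨hf.measurable.max measurable_const, ⟨B, fun x => ?_⟩, ⟨R, fun x hx => by simp [hR x hx]⟩⟩
  rw [abs_of_nonneg (le_max_right _ _)]
  exact max_le ((le_abs_self _).trans (hB x)) ((abs_nonneg _).trans (hB x))

theorem IsBddSupp.neg {X : Type*} [NormedAddCommGroup X] [MeasurableSpace X] {f : X → ℝ}
    (hf : IsBddSupp f) : IsBddSupp fun x => -f x := by
  obtain ⟨B, hB⟩ := hf.bounded
  obtain ⟨R, hR⟩ := hf.support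
  exact ⟨hf.measurable.neg, ⟨B, fun x => by rw [abs_neg]; exact hB x⟩,
    ⟨R, fun x hx => by simp [hR x hx]⟩⟩

theorem exists_eLpNorm_conjPoisson_le_of_le_two {p : ℝ} (hp : 1 < p) (hp2 : p ≤ 2) :
    ∃ C : ℝ≥0∞, C ≠ ⊤ ∧ ∀ ε : ℝ, 0 < ε → ∀ f : ℝ → ℝ, IsBddSupp f →
      eLpNorm (conjPoisson ε f) (ENNReal.ofReal p) volume ≤
        C * eLpNorm f (ENNReal.ofReal p) volume := by
  obtain ⟨C, hC, h⟩ := exists_eLpNorm_conjPoisson_le_of_nonneg hp hp2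
  refine ⟨C + C, ENNReal.add_ne_top.mpr ⟨hC, hC⟩, fun ε hε f hf => ?_⟩
  have h1 := hf.posPart
  have h2 := hf.neg.posPart
  have hsplit : conjPoisson ε f =
      conjPoisson ε (fun x => max (f x) 0) - conjPoisson ε (fun x => max (-f x) 0) := by
    funext x
    simp only [Pi.sub_apply, conjPoisson]
    rw [← integral_sub (integrable_conjKernel_mul h1 hε x) (integrable_conjKernel_mul h2 hε x)]
    congr 1
    funext t
    rw [← mul_sub, max_zero_sub_eq_self]
  have hle : ∀ s : ℝ → ℝ, (∀ x, |s x| ≤ |f x|) →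
      eLpNorm s (ENNReal.ofReal p) volume ≤ eLpNorm f (ENNReal.ofReal p) volume :=
    fun s hs => eLpNorm_mono hs
  rw [hsplit]
  refine (eLpNorm_sub_le (measurable_conjPoisson h1.measurable hε).aestronglyMeasurable
    (measurable_conjPoisson h2.measurable hε).aestronglyMeasurable
    (by simpa using hp.le)).trans ?_
  rw [add_mul]
  refine add_le_add ((h ε hε _ h1 fun x => le_max_right _ _).trans ?_)
    ((h ε hε _ h2 fun x => le_max_right _ _).trans ?_)
  · gcongr
    refine hle _ fun x => ?_
    rw [abs_of_nonneg (le_max_right _ _)]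
    exact max_le (le_abs_self _) (abs_nonneg _)
  · gcongr
    refine hle _ fun x => ?_
    rw [abs_of_nonneg (le_max_right _ _)]
    exact max_le (neg_le_abs _) (abs_nonneg _)

/-- The kernel is odd, so the operator is its own transpose up to sign. This carries bounds from an
exponent to its conjugate. -/
theorem integral_conjPoisson_mul {f g : ℝ → ℝ} (hf : IsBddSupp f) (hg : IsBddSupp g) {ε : ℝ}
    (hε : 0 < ε) : ∫ x, conjPoisson ε f x * g x = -∫ x, f x * conjPoisson ε g x := by
  have hk := (continuous_conjKernel hε).measurable
  have hi : Integrable (Function.uncurry fun x t : ℝ => conjKernel ε (x - t) * (g x * f t))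
      (volume.prod volume) := by
    refine (hg.integrable_real.mul_prod hf.integrable_real).bdd_mul (c := 1 / ε)
      (f := fun z : ℝ × ℝ => conjKernel ε (z.1 - z.2)) ?_ ?_
    · exact Measurable.aestronglyMeasurable (by fun_prop)
    · exact Filter.Eventually.of_forall fun z => abs_conjKernel_le hε _
  calc ∫ x, conjPoisson ε f x * g x
      = ∫ x, ∫ t, conjKernel ε (x - t) * (g x * f t) := by
        refine integral_congr_ae (Filter.Eventually.of_forall fun x => ?_)
        simp only [conjPoisson]
        rw [← integral_mul_const]
        congr 1; funext t; ring
    _ = ∫ t, ∫ x, conjKernel ε (x - t) * (g x * f t) := integral_integral_swap hi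
    _ = ∫ t, -(f t * conjPoisson ε g t) := by
        refine integral_congr_ae (Filter.Eventually.of_forall fun t => ?_)
        simp only [conjPoisson]
        rw [← integral_const_mul, ← integral_neg]
        congr 1; funext x
        rw [← neg_sub t x, conjKernel_neg]; ring
    _ = _ := integral_neg _

/-- For `p > 2` the conjugate exponent is at most `2`, and the bound follows by transposition. -/
theorem exists_eLpNorm_conjPoisson_le {p : ℝ} (hp : 1 < p) :
    ∃ C : ℝ≥0∞, C ≠ ⊤ ∧ ∀ ε : ℝ, 0 < ε → ∀ f : ℝ → ℝ, IsBddSupp f →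
      eLpNorm (conjPoisson ε f) (ENNReal.ofReal p) volume ≤
        C * eLpNorm f (ENNReal.ofReal p) volume := by
  rcases le_or_gt p 2 with hp2 | hp2
  · exact exists_eLpNorm_conjPoisson_le_of_le_two hp hp2
  have hpq := Real.HolderConjugate.conjExponent hp
  set q := p.conjExponent with hq
  have hq2 : q ≤ 2 := by
    rw [hq, Real.conjExponent, div_le_iff₀ (by linarith)]; linarith
  obtain ⟨C, hC, h⟩ := exists_eLpNorm_conjPoisson_le_of_le_two hpq.symm.lt hq2
  refine ⟨C, hC, fun ε hε f hf => ?_⟩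
  set v := conjPoisson ε f with hv
  have hvm : Measurable v := measurable_conjPoisson hf.measurable hε
  -- Restriction to balls makes the function `p`-integrable beforehand and its dual power an
  -- admissible test function. Fatou removes the restriction at the end.
  set S : ℕ → Set ℝ := fun N => Metric.closedBall 0 N with hS
  have hSm : ∀ N, MeasurableSet (S N) := fun N => measurableSet_closedBall
  have hloc : ∀ N, eLpNorm ((S N).indicator v) (ENNReal.ofReal p) volume ≤
      C * eLpNorm f (ENNReal.ofReal p) volume := by
    intro N
    have hvb : ∀ x, |v x| ≤ 1 / ε * ∫ t, ‖f t‖ := abs_conjPoisson_le hf hε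
    set B := 1 / ε * ∫ t, ‖f t‖ with hB
    have hw : IsBddSupp fun x => dualPow p ((S N).indicator v x) := by
      refine ⟨(continuous_dualPow hp).measurable.comp (hvm.indicator (hSm N)),
        ⟨B ^ (p - 1), fun x => ?_⟩, ⟨N, fun x hx => ?_⟩⟩
      · rw [abs_dualPow hp]
        refine Real.rpow_le_rpow (abs_nonneg _) ?_ (by linarith)
        by_cases hx : x ∈ S N
        · rw [Set.indicator_of_mem hx]; exact hvb x
        · rw [Set.indicator_of_notMem hx, abs_zero]; exact (abs_nonneg _).trans (hvb x)
      · rw [Set.indicator_of_notMem (by simpa [hS] using hx), dualPow_zero]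
    have hmem : MemLp ((S N).indicator v) (ENNReal.ofReal p) volume := by
      rw [memLp_indicator_iff_restrict (hSm N)]
      have : IsFiniteMeasure (volume.restrict (S N)) :=
        ⟨by rw [Measure.restrict_apply_univ]; exact measure_closedBall_lt_top⟩
      exact MemLp.of_bound hvm.aestronglyMeasurable B (Filter.Eventually.of_forall hvb)
    refine eLpNorm_le_of_integral_mul_dualPow_le hpq hmem ?_
    have e1 : ∫ x, (S N).indicator v x * dualPow p ((S N).indicator v x) =
        -∫ x, f x * conjPoisson ε (fun x => dualPow p ((S N).indicator v x)) x := by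
      rw [← integral_conjPoisson_mul hf hw hε]
      refine integral_congr_ae (Filter.Eventually.of_forall fun x => ?_)
      by_cases hx : x ∈ S N
      · simp only [Set.indicator_of_mem hx, hv]
      · simp only [Set.indicator_of_notMem hx, dualPow_zero, mul_zero]
    rw [e1]
    calc ENNReal.ofReal (-∫ x, f x * conjPoisson ε (fun x => dualPow p ((S N).indicator v x)) x)
        ≤ ‖∫ x, f x * conjPoisson ε (fun x => dualPow p ((S N).indicator v x)) x‖ₑ := by
          rw [← ofReal_norm]
          exact ENNReal.ofReal_le_ofReal (neg_le_abs _)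
      _ ≤ eLpNorm f (ENNReal.ofReal p) volume * eLpNorm
            (conjPoisson ε (fun x => dualPow p ((S N).indicator v x))) (ENNReal.ofReal q) volume :=
          abs_integral_mul_le_eLpNorm_mul_eLpNorm hpq hf.measurable.aestronglyMeasurable
            (measurable_conjPoisson hw.measurable hε).aestronglyMeasurable
      _ ≤ eLpNorm f (ENNReal.ofReal p) volume * (C * eLpNorm
            (fun x => dualPow p ((S N).indicator v x)) (ENNReal.ofReal q) volume) := by
          gcongr
          exact h ε hε _ hw
      _ = _ := by ring
  have hlim : ∀ᵐ x : ℝ, Filter.Tendsto (fun N => (S N).indicator v x) Filter.atTop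
      (nhds (v x)) := by
    refine Filter.Eventually.of_forall fun x => ?_
    obtain ⟨N₀, hN₀⟩ := exists_nat_ge ‖x‖
    refine tendsto_const_nhds.congr' ?_
    filter_upwards [Filter.eventually_ge_atTop N₀] with N hN
    rw [Set.indicator_of_mem]
    have : (N₀ : ℝ) ≤ N := by exact_mod_cast hN
    simpa [hS] using hN₀.trans this
  refine (Lp.eLpNorm_lim_le_liminf_eLpNorm
    (fun N => (hvm.indicator (hSm N)).aestronglyMeasurable) v hlim).trans ?_
  exact Filter.liminf_le_of_frequently_le' (Filter.Frequently.of_forall hloc)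

/-! ### The truncated Hilbert kernel -/

/-- A smooth integrable truncation of the kernel `1 / t`. -/
noncomputable def hilbertKernel (a b t : ℝ) : ℝ := conjKernel a t - conjKernel b t

theorem continuous_hilbertKernel {a b : ℝ} (ha : 0 < a) (hb : 0 < b) :
    Continuous (hilbertKernel a b) :=
  (continuous_conjKernel ha).sub (continuous_conjKernel hb)

theorem hilbertKernel_neg (a b t : ℝ) : hilbertKernel a b (-t) = -hilbertKernel a b t := by
  simp only [hilbertKernel, conjKernel_neg]; ring

theorem hilbertKernel_eq {a b : ℝ} (ha : 0 < a) (hb : 0 < b) (t : ℝ) :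
    hilbertKernel a b t = t * (b ^ 2 - a ^ 2) / ((t ^ 2 + a ^ 2) * (t ^ 2 + b ^ 2)) := by
  have h1 : t ^ 2 + a ^ 2 ≠ 0 := by positivity
  have h2 : t ^ 2 + b ^ 2 ≠ 0 := by positivity
  simp only [hilbertKernel, conjKernel]
  field_simp
  ring

theorem abs_hilbertKernel_le {a b : ℝ} (ha : 0 < a) (hab : a < b) (t : ℝ) :
    |hilbertKernel a b t| ≤ |t|⁻¹ := by
  rcases eq_or_ne t 0 with rfl | ht
  -- At `t = 0` both sides are zero, as `0⁻¹ = 0`.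
  · simp [hilbertKernel, conjKernel]
  have hb := ha.trans hab
  have hd : 0 < b ^ 2 - a ^ 2 := by nlinarith
  rw [hilbertKernel_eq ha hb, abs_div, abs_mul, abs_of_pos hd,
    abs_of_pos (by positivity : 0 < (t ^ 2 + a ^ 2) * (t ^ 2 + b ^ 2)), div_le_iff₀ (by positivity),
    inv_mul_eq_div, le_div_iff₀ (abs_pos.mpr ht)]
  have : |t| * (b ^ 2 - a ^ 2) * |t| = t ^ 2 * (b ^ 2 - a ^ 2) := by rw [← sq_abs t]; ring
  rw [this]
  nlinarith [sq_nonneg t, sq_nonneg a, sq_nonneg b, mul_nonneg (sq_nonneg t) (sq_nonneg a),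
    mul_nonneg (sq_nonneg t) (sq_nonneg t), mul_nonneg (sq_nonneg a) (sq_nonneg b)]

theorem integrable_hilbertKernel {a b : ℝ} (ha : 0 < a) (hb : 0 < b) :
    Integrable (hilbertKernel a b) := by
  have hi : Integrable fun t : ℝ => (b ^ 2)⁻¹ * (1 + (t / b) ^ 2)⁻¹ :=
    (integrable_inv_one_add_sq.comp_div hb.ne').const_mul _
  -- The difference of the two kernels decays like `|t|⁻³`. It is written as a bounded factor times
  -- an integrable one.
  have h : hilbertKernel a b =
      fun t => ((b ^ 2 - a ^ 2) * conjKernel a t) * ((b ^ 2)⁻¹ * (1 + (t / b) ^ 2)⁻¹) := by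
    funext t
    rw [hilbertKernel_eq ha hb, conjKernel]
    have h1 : t ^ 2 + a ^ 2 ≠ 0 := by positivity
    have h2 : t ^ 2 + b ^ 2 ≠ 0 := by positivity
    have h3 : (b ^ 2)⁻¹ * (1 + (t / b) ^ 2)⁻¹ = 1 / (t ^ 2 + b ^ 2) := by
      field_simp; ring
    rw [h3]; field_simp
  rw [h]
  refine hi.bdd_mul (c := |b ^ 2 - a ^ 2| * (1 / a))
    ((continuous_conjKernel ha).const_mul _).aestronglyMeasurable
    (Filter.Eventually.of_forall fun t => ?_)
  rw [Real.norm_eq_abs, abs_mul]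
  exact mul_le_mul_of_nonneg_left (abs_conjKernel_le ha t) (abs_nonneg _)

theorem integral_hilbertKernel (a b : ℝ) : ∫ t, hilbertKernel a b t = 0 := by
  have h := integral_neg_eq_self (hilbertKernel a b) volume
  simp only [hilbertKernel_neg, integral_neg] at h
  linarith

theorem tendsto_hilbertKernel (t : ℝ) :
    Filter.Tendsto (fun k : ℕ => hilbertKernel (1 / (k + 2)) (k + 2) t) Filter.atTop
      (nhds t⁻¹) := by
  rcases eq_or_ne t 0 with rfl | ht
  · simp [hilbertKernel, conjKernel]
  have hk : Filter.Tendsto (fun k : ℕ => (k : ℝ) + 2) Filter.atTop Filter.atTop :=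
    Filter.tendsto_atTop_add_const_right _ _ tendsto_natCast_atTop_atTop
  have h1 : Filter.Tendsto (fun k : ℕ => conjKernel (1 / (k + 2)) t) Filter.atTop
      (nhds (t / (t ^ 2 + 0 ^ 2))) := by
    unfold conjKernel
    refine tendsto_const_nhds.div (tendsto_const_nhds.add (Filter.Tendsto.pow ?_ 2)) (by positivity)
    simp only [one_div]
    exact tendsto_inv_atTop_zero.comp hk
  have h2 : Filter.Tendsto (fun k : ℕ => conjKernel (k + 2) t) Filter.atTop (nhds 0) := by
    unfold conjKernel
    refine tendsto_const_nhds.div_atTop ?_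
    exact Filter.tendsto_atTop_add_const_left _ _
      ((Filter.tendsto_pow_atTop two_ne_zero).comp hk)
  have h3 := h1.sub h2
  have h4 : t / (t ^ 2 + 0 ^ 2) - 0 = t⁻¹ := by
    simp only [ne_eq, OfNat.ofNat_ne_zero, not_false_eq_true, zero_pow, add_zero, sub_zero]
    field_simp
  rwa [h4] at h3

/-! ### Directional truncated Hilbert transforms -/

section Directional

variable {X : Type*} [NormedAddCommGroup X] [InnerProductSpace ℝ X] [FiniteDimensional ℝ X]
  [MeasurableSpace X] [BorelSpace X]

theorem IsBddSupp.integrable {f : X → ℝ} (hf : IsBddSupp f) : Integrable f := by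
  obtain ⟨B, hB⟩ := hf.bounded
  obtain ⟨R, hR⟩ := hf.support
  have h : IntegrableOn f (Metric.closedBall (0 : X) R) :=
    Measure.integrableOn_of_bounded (M := B) measure_closedBall_lt_top.ne
      hf.measurable.aestronglyMeasurable (Filter.Eventually.of_forall hB)
  refine (integrableOn_iff_integrable_of_support_subset fun x hx => ?_).mp h
  by_contra hc
  exact hx (hR x (by simpa using hc))

/-- The truncated Hilbert transform in direction `y`. -/
noncomputable def lineHilbert (a b : ℝ) (f : X → ℝ) (y x : X) : ℝ :=
  ∫ t, hilbertKernel a b t * f (x - t • y)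

theorem measurable_lineHilbert {f : X → ℝ} (hf : Measurable f) {a b : ℝ} (ha : 0 < a)
    (hb : 0 < b) : Measurable (Function.uncurry fun x y => lineHilbert a b f y x) := by
  have hk := (continuous_hilbertKernel ha hb).measurable
  have h : StronglyMeasurable (Function.uncurry fun (z : X × X) t =>
      hilbertKernel a b t * f (z.1 - t • z.2)) := by
    refine Measurable.stronglyMeasurable ?_
    unfold Function.uncurry
    exact (hk.comp measurable_snd).mul (hf.comp (by fun_prop))
  exact h.integral_prod_right.measurable

/-- Fubini along the lines parallel to `y` without a change of coordinates: each line `s ↦ x - s •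
y` spends unit time in the slab `0 ≤ ⟨x, y⟩ / ‖y‖² < 1`. Inserting this factor `1` and translating
spreads the integral over lines issuing from the slab. -/
theorem lintegral_eq_lintegral_line {y : X} (hy : y ≠ 0) {Φ : X → ℝ≥0∞} (hΦ : Measurable Φ) :
    ∫⁻ x, Φ x = ∫⁻ x, {x : X | inner ℝ x y / ‖y‖ ^ 2 ∈ Set.Ico (0 : ℝ) 1}.indicator 1 x *
      ∫⁻ s : ℝ, Φ (x + s • y) := by
  set S : Set X := {x : X | inner ℝ x y / ‖y‖ ^ 2 ∈ Set.Ico (0 : ℝ) 1} with hS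
  have hSm : MeasurableSet S := by
    have : Measurable fun x : X => inner ℝ x y / ‖y‖ ^ 2 := by fun_prop
    exact this measurableSet_Ico
  have hind : Measurable (S.indicator (1 : X → ℝ≥0∞)) := measurable_one.indicator hSm
  have hy2 : ‖y‖ ^ 2 ≠ 0 := by positivity
  have hone : ∀ x : X, ∫⁻ s : ℝ, S.indicator (1 : X → ℝ≥0∞) (x - s • y) = 1 := by
    intro x
    set c := inner ℝ x y / ‖y‖ ^ 2 with hc
    have h1 : ∀ s : ℝ, S.indicator (1 : X → ℝ≥0∞) (x - s • y) =
        (Set.Ioc (c - 1) c).indicator 1 s := by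
      intro s
      have h2 : x - s • y ∈ S ↔ s ∈ Set.Ioc (c - 1) c := by
        have : inner ℝ (x - s • y) y / ‖y‖ ^ 2 = c - s := by
          rw [inner_sub_left, real_inner_smul_left, real_inner_self_eq_norm_sq, sub_div,
            mul_div_assoc, div_self hy2, mul_one]
        rw [hS, Set.mem_ofPred_eq, this, Set.mem_Ico, Set.mem_Ioc]
        constructor <;> rintro ⟨h3, h4⟩ <;> constructor <;> linarith
      by_cases h : s ∈ Set.Ioc (c - 1) c
      · rw [Set.indicator_of_mem h, Set.indicator_of_mem (h2.mpr h)]; rfl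
      · rw [Set.indicator_of_notMem h, Set.indicator_of_notMem (fun h' => h (h2.mp h'))]
    simp only [h1]
    rw [lintegral_indicator_one measurableSet_Ioc, Real.volume_Ioc]
    simp
  calc ∫⁻ x, Φ x = ∫⁻ x, ∫⁻ s : ℝ, Φ x * S.indicator 1 (x - s • y) := by
        refine lintegral_congr fun x => ?_
        have : Measurable fun s : ℝ => S.indicator (1 : X → ℝ≥0∞) (x - s • y) :=
          hind.comp (by fun_prop)
        rw [lintegral_const_mul _ this, hone, mul_one]
    _ = ∫⁻ s : ℝ, ∫⁻ x, Φ x * S.indicator 1 (x - s • y) := by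
        refine lintegral_lintegral_swap (Measurable.aemeasurable ?_)
        exact (hΦ.comp measurable_fst).mul (hind.comp (by fun_prop))
    _ = ∫⁻ s : ℝ, ∫⁻ x, Φ (x + s • y) * S.indicator 1 x := by
        refine lintegral_congr fun s => ?_
        rw [← lintegral_add_right_eq_self (fun x => Φ x * S.indicator 1 (x - s • y)) (s • y)]
        simp only [add_sub_cancel_right]
    _ = ∫⁻ x, ∫⁻ s : ℝ, Φ (x + s • y) * S.indicator 1 x := by
        refine lintegral_lintegral_swap (Measurable.aemeasurable ?_)
        exact (hΦ.comp (by fun_prop)).mul (hind.comp measurable_snd)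
    _ = _ := by
        refine lintegral_congr fun x => ?_
        have : Measurable fun s : ℝ => Φ (x + s • y) := hΦ.comp (by fun_prop)
        rw [lintegral_mul_const _ this, mul_comm]

/-- On each line the operator is a difference of two one-dimensional conjugate Poisson integrals,
whence the constant `C + C`. Lines are parametrised by `y` itself, not by a unit vector, so the
constant is the same for every `y`. -/
theorem exists_eLpNorm_lineHilbert_le {p : ℝ} (hp : 1 < p) :
    ∃ C : ℝ≥0∞, C ≠ ⊤ ∧ ∀ a b : ℝ, 0 < a → 0 < b → ∀ f : X → ℝ, IsBddSupp f → ∀ y : X,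
      eLpNorm (lineHilbert a b f y) (ENNReal.ofReal p) volume ≤
        C * eLpNorm f (ENNReal.ofReal p) volume := by
  obtain ⟨C, hC, h⟩ := exists_eLpNorm_conjPoisson_le hp
  refine ⟨C + C, ENNReal.add_ne_top.mpr ⟨hC, hC⟩, fun a b ha hb f hf y => ?_⟩
  have hp0 : 0 < p := by linarith
  have hp1 : ENNReal.ofReal p ≠ 0 := by simpa using hp0
  rcases eq_or_ne y 0 with rfl | hy
  -- For `y = 0` there is no line, but the odd kernel has integral zero.
  · have : lineHilbert a b f 0 = 0 := by
      funext x
      simp only [lineHilbert, smul_zero, sub_zero, integral_mul_const, integral_hilbertKernel,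
        zero_mul, Pi.zero_apply]
    rw [this, eLpNorm_zero]; exact zero_le
  have hpow : ∀ (g : X → ℝ), eLpNorm g (ENNReal.ofReal p) volume =
      (∫⁻ x, ‖g x‖ₑ ^ p) ^ (1 / p) := fun g => by
    rw [eLpNorm_eq_lintegral_rpow_enorm_toReal hp1 ENNReal.ofReal_ne_top,
      ENNReal.toReal_ofReal hp0.le]
  have hpow' : ∀ (g : ℝ → ℝ), (eLpNorm g (ENNReal.ofReal p) volume) ^ p =
      ∫⁻ x, ‖g x‖ₑ ^ p := fun g => by
    rw [eLpNorm_eq_lintegral_rpow_enorm_toReal hp1 ENNReal.ofReal_ne_top,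
      ENNReal.toReal_ofReal hp0.le, ← ENNReal.rpow_mul, one_div_mul_cancel hp0.ne',
      ENNReal.rpow_one]
  have hfm := hf.measurable
  have hHm : Measurable (lineHilbert a b f y) :=
    (measurable_lineHilbert hfm ha hb).comp (measurable_id.prodMk measurable_const)
  have hline : ∀ x : X, ∫⁻ s : ℝ, ‖lineHilbert a b f y (x + s • y)‖ₑ ^ p ≤
      (C + C) ^ p * ∫⁻ s : ℝ, ‖f (x + s • y)‖ₑ ^ p := by
    intro x
    set g : ℝ → ℝ := fun s => f (x + s • y) with hg
    have hgN : IsBddSupp g := by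
      obtain ⟨B, hB⟩ := hf.bounded
      obtain ⟨R, hR⟩ := hf.support
      refine ⟨hfm.comp (by fun_prop), ⟨B, fun s => hB _⟩, ⟨(R + ‖x‖) / ‖y‖, fun s hs => hR _ ?_⟩⟩
      rw [div_lt_iff₀ (norm_pos_iff.mpr hy), ← norm_smul] at hs
      have := norm_sub_le (x + s • y) x
      rw [add_sub_cancel_left] at this
      linarith
    have hH : (fun s : ℝ => lineHilbert a b f y (x + s • y)) =
        conjPoisson a g - conjPoisson b g := by
      funext s
      simp only [Pi.sub_apply, conjPoisson]
      rw [← integral_sub (integrable_conjKernel_mul hgN ha s) (integrable_conjKernel_mul hgN hb s),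
        lineHilbert, ← integral_sub_left_eq_self _ volume s]
      congr 1
      funext t
      rw [← sub_mul, ← hilbertKernel, hg]
      simp only
      congr 2
      rw [sub_smul]; abel
    rw [← hpow' g, ← hpow' (fun s : ℝ => lineHilbert a b f y (x + s • y)),
      ← ENNReal.mul_rpow_of_nonneg _ _ hp0.le, hH]
    refine ENNReal.rpow_le_rpow ?_ hp0.le
    refine (eLpNorm_sub_le (measurable_conjPoisson hgN.measurable ha).aestronglyMeasurable
      (measurable_conjPoisson hgN.measurable hb).aestronglyMeasurable
      (by simpa using hp.le)).trans ?_
    rw [add_mul]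
    exact add_le_add (h a ha g hgN) (h b hb g hgN)
  have key : ∫⁻ x, ‖lineHilbert a b f y x‖ₑ ^ p ≤ (C + C) ^ p * ∫⁻ x, ‖f x‖ₑ ^ p := by
    rw [lintegral_eq_lintegral_line hy (hHm.enorm.pow_const p),
      lintegral_eq_lintegral_line hy (hfm.enorm.pow_const p),
      ← lintegral_const_mul' _ _ (ENNReal.rpow_ne_top_of_nonneg hp0.le
        (ENNReal.add_ne_top.mpr ⟨hC, hC⟩))]
    refine lintegral_mono fun x => ?_
    rw [mul_left_comm]
    gcongr
    exact hline x
  rw [hpow, hpow]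
  refine (ENNReal.rpow_le_rpow key (by positivity : 0 ≤ 1 / p)).trans (le_of_eq ?_)
  rw [ENNReal.mul_rpow_of_nonneg _ _ (by positivity), ← ENNReal.rpow_mul,
    mul_one_div_cancel hp0.ne', ENNReal.rpow_one]

/-! ### Superpositions of directional Hilbert transforms -/

/-- The superposition `∫ K(y) H_y f dy` of directional truncated Hilbert transforms. -/
noncomputable def rotationOp (K : X → ℂ) (a b : ℝ) (f : X → ℝ) (x : X) : ℂ :=
  ∫ z : X × ℝ, (K z.1 * (hilbertKernel a b z.2 : ℂ)) * (f (x - z.2 • z.1) : ℂ)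

theorem integrable_rotationOp_weight {K : X → ℂ} (hK : Integrable K) {a b : ℝ} (ha : 0 < a)
    (hb : 0 < b) : Integrable fun z : X × ℝ => K z.1 * (hilbertKernel a b z.2 : ℂ) :=
  hK.mul_prod (integrable_hilbertKernel ha hb).ofReal

theorem rotationOp_eq {K : X → ℂ} (hK : Integrable K) {a b : ℝ} (ha : 0 < a) (hb : 0 < b)
    {f : X → ℝ} (hf : IsBddSupp f) (x : X) :
    rotationOp K a b f x = ∫ y, K y * (lineHilbert a b f y x : ℂ) := by
  obtain ⟨B, hB⟩ := hf.bounded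
  have hm := hf.measurable
  rw [rotationOp, Measure.volume_eq_prod, integral_prod]
  · refine integral_congr_ae (Filter.Eventually.of_forall fun y => ?_)
    simp only [lineHilbert]
    rw [← integral_complex_ofReal, ← integral_const_mul]
    congr 1; funext t; push_cast; ring
  · refine (integrable_rotationOp_weight hK ha hb).mul_bdd (c := B) ?_ ?_
    · refine Measurable.aestronglyMeasurable ?_
      exact Complex.measurable_ofReal.comp (hm.comp (by fun_prop))
    · exact Filter.Eventually.of_forall fun z => by rw [Complex.norm_real]; exact hB _

/-- Minkowski's integral inequality over the directions. Only the `L¹` norm of `K` enters, because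
the directional bounds are uniform in `y`. -/
theorem exists_eLpNorm_rotationOp_le {p : ℝ} (hp : 1 < p) {K : X → ℂ} (hK : Integrable K)
    (hKm : Measurable K) :
    ∃ C : ℝ≥0∞, C ≠ ⊤ ∧ ∀ a b : ℝ, 0 < a → 0 < b → ∀ f : X → ℝ, IsBddSupp f →
      eLpNorm (rotationOp K a b f) (ENNReal.ofReal p) volume ≤
        C * eLpNorm f (ENNReal.ofReal p) volume := by
  obtain ⟨C, hC, h⟩ := exists_eLpNorm_lineHilbert_le (X := X) hp
  refine ⟨(∫⁻ y, ‖K y‖ₑ) * C, ENNReal.mul_ne_top hK.2.ne hC, fun a b ha hb f hf => ?_⟩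
  have : rotationOp K a b f = fun x => ∫ y, K y * (lineHilbert a b f y x : ℂ) :=
    funext fun x => rotationOp_eq hK ha hb hf x
  rw [this, mul_assoc]
  refine eLpNorm_integral_smul_le hp hKm.enorm (measurable_lineHilbert hf.measurable ha hb)
    (fun x y => ?_) (fun y => h a b ha hb f hf y)
  rw [enorm_mul, ← ofReal_norm, ← ofReal_norm, Complex.norm_real, ofReal_norm, ofReal_norm]

end Directional

/-! ### Fourier multipliers of superpositions of translations -/

section Multiplier

open FourierTransform

variable {X Z : Type*} [NormedAddCommGroup X] [InnerProductSpace ℝ X] [FiniteDimensional ℝ X]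
  [MeasurableSpace X] [BorelSpace X] [MeasurableSpace Z] {ν : Measure Z} [SFinite ν]

/-- The character `r ↦ exp (2 π i r)` with complex values. -/
noncomputable def unitExp (r : ℝ) : ℂ := Circle.coeHom (Real.fourierChar r)

theorem norm_unitExp (r : ℝ) : ‖unitExp r‖ = 1 := Circle.norm_coe _

theorem continuous_unitExp : Continuous unitExp :=
  continuous_induced_dom.comp Real.continuous_fourierChar

theorem unitExp_add (r s : ℝ) : unitExp (r + s) = unitExp r * unitExp s := by
  simp only [unitExp, AddChar.map_add_eq_mul, map_mul]

theorem fourierChar_smul (r : ℝ) (z : ℂ) : Real.fourierChar r • z = unitExp r * z := rfl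

/-- The Fourier transform of the push-forward under `γ` of the complex measure `w ν`. -/
noncomputable def transMult (ν : Measure Z) (w : Z → ℂ) (γ : Z → X) (ξ : X) : ℂ :=
  ∫ z, w z * unitExp (-inner ℝ (γ z) ξ) ∂ν

theorem norm_transMult_le (w : Z → ℂ) (γ : Z → X) (ξ : X) :
    ‖transMult ν w γ ξ‖ ≤ ∫ z, ‖w z‖ ∂ν := by
  refine (norm_integral_le_integral_norm _).trans (le_of_eq ?_)
  simp [norm_unitExp]

theorem integral_translate_eq_fourierInv {w : Z → ℂ} {γ : Z → X} (hw : Integrable w ν)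
    (hγ : Measurable γ) {f : X → ℂ} {g : X → ℂ} (hg : Integrable g)
    (hf : ∀ x, f x = 𝓕⁻ g x) (x : X) :
    ∫ z, w z * f (x - γ z) ∂ν = 𝓕⁻ (fun ξ => transMult ν w γ ξ * g ξ) x := by
  have hi : Integrable (Function.uncurry fun (z : Z) (ξ : X) =>
      (w z * g ξ) * unitExp (inner ℝ ξ (x - γ z))) (ν.prod volume) := by
    refine (hw.mul_prod hg).mul_bdd (c := 1) ?_ (Filter.Eventually.of_forall fun z => (norm_unitExp _).le)
    refine Measurable.aestronglyMeasurable (continuous_unitExp.measurable.comp ?_)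
    fun_prop
  calc ∫ z, w z * f (x - γ z) ∂ν
      = ∫ z, (∫ ξ, (w z * g ξ) * unitExp (inner ℝ ξ (x - γ z))) ∂ν := by
        refine integral_congr_ae (Filter.Eventually.of_forall fun z => ?_)
        simp only [hf, Real.fourierInv_eq]
        rw [← integral_const_mul]
        congr 1; funext ξ
        rw [fourierChar_smul]; ring
    _ = ∫ ξ, ∫ z, (w z * g ξ) * unitExp (inner ℝ ξ (x - γ z)) ∂ν :=
        integral_integral_swap hi
    _ = _ := by
        rw [Real.fourierInv_eq]
        refine integral_congr_ae (Filter.Eventually.of_forall fun ξ => ?_)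
        simp only [transMult]
        rw [fourierChar_smul, ← integral_mul_const, ← integral_const_mul]
        congr 1; funext z
        rw [inner_sub_right, sub_eq_add_neg, unitExp_add, real_inner_comm (γ z) ξ]
        ring

theorem integrable_translate {w : Z → ℂ} {γ : Z → X} (hw : Integrable w ν) (hγ : Measurable γ)
    {f : X → ℂ} (hfm : Measurable f) (hf : Integrable f) :
    Integrable (Function.uncurry fun (x : X) (z : Z) => w z * f (x - γ z)) (volume.prod ν) := by
  have hm : AEStronglyMeasurable (Function.uncurry fun (x : X) (z : Z) => w z * f (x - γ z))
      (volume.prod ν) := by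
    refine (hw.1.comp_snd (μ := (volume : Measure X))).mul ?_
    exact Measurable.aestronglyMeasurable (hfm.comp (by fun_prop))
  rw [integrable_prod_iff' hm]
  refine ⟨Filter.Eventually.of_forall fun z => ?_, ?_⟩
  · exact (hf.comp_sub_right (γ z)).const_mul (w z)
  · have : ∀ z, ∫ x, ‖w z * f (x - γ z)‖ = ‖w z‖ * ∫ x, ‖f x‖ := by
      intro z
      simp only [norm_mul]
      rw [integral_const_mul, integral_sub_right_eq_self (fun x => ‖f x‖)]
    simp only [Function.uncurry, this]
    exact hw.norm.mul_const _

theorem fourierInv_integral_translate {w : Z → ℂ} {γ : Z → X} (hw : Integrable w ν)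
    (hγ : Measurable γ) {f : X → ℂ} (hfm : Measurable f) (hf : Integrable f) (ξ : X) :
    𝓕⁻ (fun x => ∫ z, w z * f (x - γ z) ∂ν) ξ = transMult ν w γ (-ξ) * 𝓕⁻ f ξ := by
  have hi : Integrable (Function.uncurry fun (x : X) (z : Z) =>
      (w z * f (x - γ z)) * unitExp (inner ℝ x ξ)) (volume.prod ν) := by
    refine (integrable_translate hw hγ hfm hf).mul_bdd (c := 1) ?_
      (Filter.Eventually.of_forall fun z => (norm_unitExp _).le)
    exact Measurable.aestronglyMeasurable (continuous_unitExp.measurable.comp (by fun_prop))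
  rw [Real.fourierInv_eq, Real.fourierInv_eq]
  calc ∫ x, Real.fourierChar (inner ℝ x ξ) • ∫ z, w z * f (x - γ z) ∂ν
      = ∫ x, ∫ z, (w z * f (x - γ z)) * unitExp (inner ℝ x ξ) ∂ν := by
        refine integral_congr_ae (Filter.Eventually.of_forall fun x => ?_)
        simp only
        rw [fourierChar_smul, ← integral_const_mul]
        congr 1; funext z; ring
    _ = ∫ z, (∫ x, (w z * f (x - γ z)) * unitExp (inner ℝ x ξ)) ∂ν :=
        integral_integral_swap hi
    _ = _ := by
        rw [transMult, ← integral_mul_const]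
        refine integral_congr_ae (Filter.Eventually.of_forall fun z => ?_)
        simp only
        rw [← integral_add_right_eq_self _ (γ z), ← integral_const_mul]
        congr 1; funext x
        rw [add_sub_cancel_right, inner_add_left, unitExp_add, fourierChar_smul,
          inner_neg_right, neg_neg]
        ring

theorem integral_fourierInv_mul_eq_flip {g u : X → ℂ} (hg : Integrable g) (hu : Integrable u) :
    ∫ x, 𝓕⁻ g x * u x = ∫ ξ, g ξ * 𝓕⁻ u ξ := by
  have hi : Integrable (Function.uncurry fun (x ξ : X) =>
      (u x * g ξ) * unitExp (inner ℝ ξ x)) (volume.prod volume) := by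
    refine (hu.mul_prod hg).mul_bdd (c := 1) ?_ (Filter.Eventually.of_forall fun z => (norm_unitExp _).le)
    exact Measurable.aestronglyMeasurable (continuous_unitExp.measurable.comp (by fun_prop))
  calc ∫ x, 𝓕⁻ g x * u x
      = ∫ x, ∫ ξ, (u x * g ξ) * unitExp (inner ℝ ξ x) := by
        refine integral_congr_ae (Filter.Eventually.of_forall fun x => ?_)
        simp only [Real.fourierInv_eq]
        rw [← integral_mul_const]
        congr 1; funext ξ
        rw [fourierChar_smul]; ring
    _ = ∫ ξ, ∫ x, (u x * g ξ) * unitExp (inner ℝ ξ x) := integral_integral_swap hi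
    _ = _ := by
        refine integral_congr_ae (Filter.Eventually.of_forall fun ξ => ?_)
        simp only [Real.fourierInv_eq]
        rw [← integral_const_mul]
        congr 1; funext x
        rw [fourierChar_smul, real_inner_comm]; ring

theorem continuous_transMult {w : Z → ℂ} {γ : Z → X} (hw : Integrable w ν)
    (hγ : Measurable γ) : Continuous (transMult ν w γ) := by
  refine continuous_of_dominated (bound := fun z => ‖w z‖) (fun ξ => ?_) (fun ξ => ?_) hw.norm ?_
  · exact hw.1.mul (continuous_unitExp.measurable.comp (by fun_prop)).aestronglyMeasurable
  · exact Filter.Eventually.of_forall fun z => by rw [norm_mul, norm_unitExp, mul_one]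
  · refine Filter.Eventually.of_forall fun z => ?_
    have : Continuous fun ξ : X => -inner ℝ (γ z) ξ := by fun_prop
    exact continuous_const.mul (continuous_unitExp.comp this)

/-- Pairing two superpositions of translations multiplies their multipliers. The second is
transposed, hence its argument `-ξ`. Thus one factor can be estimated in `L^p` on `f` and the other
in `L^q` on `ψ`, and the operators need never be composed. -/
theorem integral_translate_mul_translate {Z' : Type*} [MeasurableSpace Z'] {ν' : Measure Z'}
    [SFinite ν'] {w : Z → ℂ} {γ : Z → X} (hw : Integrable w ν) (hγ : Measurable γ)
    {w' : Z' → ℂ} {γ' : Z' → X} (hw' : Integrable w' ν') (hγ' : Measurable γ')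
    {f g ψ : X → ℂ} (hg : Integrable g) (hf : ∀ x, f x = 𝓕⁻ g x)
    (hψm : Measurable ψ) (hψ : Integrable ψ) :
    ∫ x, (∫ z, w z * f (x - γ z) ∂ν) * (∫ z, w' z * ψ (x - γ' z) ∂ν') =
      ∫ ξ, (transMult ν w γ ξ * transMult ν' w' γ' (-ξ)) * (g ξ * 𝓕⁻ ψ ξ) := by
  simp only [integral_translate_eq_fourierInv hw hγ hg hf]
  have h1 : Integrable fun ξ => transMult ν w γ ξ * g ξ :=
    hg.bdd_mul (continuous_transMult hw hγ).aestronglyMeasurable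
      (Filter.Eventually.of_forall fun ξ => norm_transMult_le w γ ξ)
  have h2 : Integrable fun x => ∫ z, w' z * ψ (x - γ' z) ∂ν' :=
    (integrable_translate hw' hγ' hψm hψ).integral_prod_left
  rw [integral_fourierInv_mul_eq_flip h1 h2]
  refine integral_congr_ae (Filter.Eventually.of_forall fun ξ => ?_)
  have h3 := fourierInv_integral_translate hw' hγ' hψm hψ ξ
  simp only [h3]; ring

/-! ### The multiplier of a superposition of directional Hilbert transforms -/

/-- The Fourier multiplier of `rotationOp`, in terms of the Fourier transform `b` of the weight. -/
noncomputable def rotationMult (h : ℝ → ℝ) (b : X → ℝ) (ξ : X) : ℝ := ∫ t : ℝ, h t * b (t • ξ)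

/-- Integrating in the direction first turns the weight into its Fourier transform at `t • ξ`. -/
theorem transMult_rotationOp {K : X → ℂ} (hK : Integrable K) {α β : ℝ} (hα : 0 < α) (hβ : 0 < β)
    {b : X → ℝ} (hb : ∀ ξ, 𝓕 K ξ = b ξ) (ξ : X) :
    transMult (volume : Measure (X × ℝ)) (fun z => K z.1 * (hilbertKernel α β z.2 : ℂ))
      (fun z => z.2 • z.1) ξ = (rotationMult (hilbertKernel α β) b ξ : ℂ) := by
  have hi := integrable_rotationOp_weight hK hα hβ
  have hi2 : Integrable fun z : X × ℝ => (K z.1 * (hilbertKernel α β z.2 : ℂ)) *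
      unitExp (-inner ℝ (z.2 • z.1) ξ) := by
    refine hi.mul_bdd (c := 1) ?_ (Filter.Eventually.of_forall fun z => (norm_unitExp _).le)
    exact Measurable.aestronglyMeasurable (continuous_unitExp.measurable.comp (by fun_prop))
  rw [transMult, rotationMult, Measure.volume_eq_prod, integral_prod_symm _ hi2,
    ← integral_complex_ofReal]
  refine integral_congr_ae (Filter.Eventually.of_forall fun t => ?_)
  simp only
  push_cast
  rw [← hb, Real.fourier_eq, ← integral_const_mul]
  congr 1; funext y
  rw [fourierChar_smul, real_inner_smul_left, real_inner_smul_right]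
  ring

/-- The integrand lives where `r₁ ≤ |t| ‖ξ‖ ≤ r₂`, away from the singularity of `1/t`. The bound
does not depend on `ξ` since `dt/|t|` is invariant under dilations. It dominates all truncations at
once. -/
theorem integrable_inv_mul_of_annulus {b : X → ℝ} (hbc : Continuous b) {B r₁ r₂ : ℝ} (hr₁ : 0 < r₁)
    (hB : ∀ η, |b η| ≤ B) (hb₁ : ∀ η, ‖η‖ < r₁ → b η = 0) (hb₂ : ∀ η, r₂ < ‖η‖ → b η = 0)
    (ξ : X) :
    Integrable (fun t : ℝ => |t|⁻¹ * |b (t • ξ)|) ∧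
      ∫ t : ℝ, |t|⁻¹ * |b (t • ξ)| ≤ 2 * |r₂| * B / r₁ := by
  have hB0 : 0 ≤ B := (abs_nonneg _).trans (hB 0)
  have hm : Measurable fun t : ℝ => |t|⁻¹ * |b (t • ξ)| := by
    have := hbc.measurable
    exact (by fun_prop : Measurable fun t : ℝ => |t|⁻¹).mul
      ((this.comp (by fun_prop : Measurable fun t : ℝ => t • ξ)).norm)
  rcases eq_or_ne ξ 0 with rfl | hξ
  · have h0 : b 0 = 0 := hb₁ 0 (by simpa using hr₁)
    simp only [smul_zero, h0, abs_zero, mul_zero]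
    exact ⟨integrable_zero _ _ _, by rw [integral_zero]; positivity⟩
  have hn : 0 < ‖ξ‖ := norm_pos_iff.mpr hξ
  set D : ℝ → ℝ := (Metric.closedBall (0 : ℝ) (|r₂| / ‖ξ‖)).indicator fun _ => ‖ξ‖ / r₁ * B with hD
  have hDi : Integrable D :=
    (integrable_indicator_iff measurableSet_closedBall).mpr
      (integrableOn_const measure_closedBall_lt_top.ne)
  have hle : ∀ t : ℝ, |t|⁻¹ * |b (t • ξ)| ≤ D t := by
    intro t
    by_cases h2 : r₂ < ‖t • ξ‖
    · rw [hb₂ _ h2, abs_zero, mul_zero]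
      exact Set.indicator_nonneg (fun _ _ => by positivity) _
    have ht : t ∈ Metric.closedBall (0 : ℝ) (|r₂| / ‖ξ‖) := by
      rw [mem_closedBall_zero_iff, le_div_iff₀ hn, ← norm_smul]
      exact (not_lt.mp h2).trans (le_abs_self _)
    rw [hD, Set.indicator_of_mem ht]
    by_cases h1 : ‖t • ξ‖ < r₁
    · rw [hb₁ _ h1, abs_zero, mul_zero]; positivity
    · rw [norm_smul, Real.norm_eq_abs, not_lt] at h1
      have ht0 : 0 < |t| := by
        by_contra hc
        have : |t| = 0 := le_antisymm (not_lt.mp hc) (abs_nonneg _)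
        rw [this, zero_mul] at h1; linarith
      refine mul_le_mul ?_ (hB _) (abs_nonneg _) (by positivity)
      rw [inv_le_comm₀ ht0 (by positivity), inv_div, div_le_iff₀ hn]
      exact h1
  have hint : Integrable fun t : ℝ => |t|⁻¹ * |b (t • ξ)| :=
    hDi.mono' hm.aestronglyMeasurable (Filter.Eventually.of_forall fun t => by
      rw [Real.norm_of_nonneg (by positivity)]; exact hle t)
  refine ⟨hint, (integral_mono hint hDi hle).trans (le_of_eq ?_)⟩
  rw [hD, integral_indicator measurableSet_closedBall, setIntegral_const, smul_eq_mul, Measure.real,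
    Real.volume_closedBall, ENNReal.toReal_ofReal (by positivity)]
  field_simp

theorem abs_rotationMult_le {b : X → ℝ} (hbc : Continuous b) {B r₁ r₂ : ℝ} (hr₁ : 0 < r₁)
    (hB : ∀ η, |b η| ≤ B) (hb₁ : ∀ η, ‖η‖ < r₁ → b η = 0) (hb₂ : ∀ η, r₂ < ‖η‖ → b η = 0)
    {α β : ℝ} (hα : 0 < α) (hαβ : α < β) (ξ : X) :
    |rotationMult (hilbertKernel α β) b ξ| ≤ 2 * |r₂| * B / r₁ := by
  obtain ⟨hi, hle⟩ := integrable_inv_mul_of_annulus hbc hr₁ hB hb₁ hb₂ ξ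
  rw [rotationMult, ← Real.norm_eq_abs]
  refine le_trans (norm_integral_le_of_norm_le hi (Filter.Eventually.of_forall fun t => ?_)) hle
  rw [norm_mul]
  exact mul_le_mul_of_nonneg_right (abs_hilbertKernel_le hα hαβ t) (norm_nonneg _)

theorem tendsto_rotationMult {b : X → ℝ} (hbc : Continuous b) {B r₁ r₂ : ℝ} (hr₁ : 0 < r₁)
    (hB : ∀ η, |b η| ≤ B) (hb₁ : ∀ η, ‖η‖ < r₁ → b η = 0) (hb₂ : ∀ η, r₂ < ‖η‖ → b η = 0)
    (ξ : X) :
    Filter.Tendsto (fun k : ℕ => rotationMult (hilbertKernel (1 / (k + 2)) (k + 2)) b ξ)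
      Filter.atTop (nhds (∫ t : ℝ, t⁻¹ * b (t • ξ))) := by
  have hk : ∀ k : ℕ, (0 : ℝ) < 1 / (k + 2) ∧ (1 : ℝ) / (k + 2) < k + 2 := by
    intro k
    have : (0 : ℝ) ≤ k := Nat.cast_nonneg k
    refine ⟨by positivity, ?_⟩
    rw [div_lt_iff₀ (by positivity)]; nlinarith
  obtain ⟨hi, -⟩ := integrable_inv_mul_of_annulus hbc hr₁ hB hb₁ hb₂ ξ
  refine tendsto_integral_of_dominated_convergence _ (fun k => ?_) hi (fun k => ?_) ?_
  · refine Continuous.aestronglyMeasurable ?_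
    exact (continuous_hilbertKernel (hk k).1 ((hk k).1.trans (hk k).2)).mul
      (hbc.comp (by fun_prop))
  · refine Filter.Eventually.of_forall fun t => ?_
    rw [norm_mul]
    exact mul_le_mul_of_nonneg_right (abs_hilbertKernel_le (hk k).1 (hk k).2 t) (norm_nonneg _)
  · exact Filter.Eventually.of_forall fun t => (tendsto_hilbertKernel t).mul_const _

end Multiplier

/-! ### `L^p` bounds for smooth homogeneous Fourier multipliers -/

section HomogeneousMultiplier

open FourierTransform

/-! ### Multipliers built from smooth profiles on an annulus. -/

section Annular

variable {X : Type*} [NormedAddCommGroup X] [InnerProductSpace ℝ X] [FiniteDimensional ℝ X]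
  [MeasurableSpace X] [BorelSpace X]

/-- Smooth functions supported in the annulus `1 ≤ ‖η‖ ≤ 2`. -/
structure IsAnnular (b : X → ℝ) : Prop where
  contDiff : ContDiff ℝ ∞ b
  eq_zero_of_lt : ∀ η, ‖η‖ < 1 → b η = 0
  eq_zero_of_gt : ∀ η, 2 < ‖η‖ → b η = 0

theorem IsAnnular.hasCompactSupport {b : X → ℝ} (hb : IsAnnular b) : HasCompactSupport b :=
  HasCompactSupport.intro (isCompact_closedBall 0 2) fun η hη =>
    hb.eq_zero_of_gt η (by simpa using hη)

theorem IsAnnular.exists_bound {b : X → ℝ} (hb : IsAnnular b) : ∃ B, ∀ η, |b η| ≤ B :=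
  hb.hasCompactSupport.exists_bound_of_continuous hb.contDiff.continuous

/-- The complexification of a real test function, as a Schwartz function. -/
noncomputable def toSchwartzComplex {f : X → ℝ} (hf : ContDiff ℝ ∞ f)
    (hc : HasCompactSupport f) : SchwartzMap X ℂ :=
  HasCompactSupport.toSchwartzMap (f := fun x => (f x : ℂ))
    (hc.comp_left (g := fun r : ℝ => (r : ℂ)) Complex.ofReal_zero)
    (Complex.ofRealCLM.contDiff.comp hf)

theorem integrable_fourier_of_test {f : X → ℝ} (hf : ContDiff ℝ ∞ f)
    (hc : HasCompactSupport f) : Integrable (𝓕 fun x => (f x : ℂ)) :=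
  (𝓕 (toSchwartzComplex hf hc)).integrable

theorem fourierInv_fourier_of_test {f : X → ℝ} (hf : ContDiff ℝ ∞ f)
    (hc : HasCompactSupport f) (x : X) : (f x : ℂ) = 𝓕⁻ (𝓕 fun x => (f x : ℂ)) x := by
  have h : 𝓕⁻ (𝓕 (toSchwartzComplex hf hc) : SchwartzMap X ℂ) = toSchwartzComplex hf hc :=
    FourierTransform.fourierInv_fourier_eq _
  have h2 := congrArg (fun g : SchwartzMap X ℂ => g x) h
  rw [SchwartzMap.fourierInv_coe] at h2
  exact h2.symm

/-- The inverse Fourier transform of a test function is Schwartz, so the directional weight is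
integrable. -/
theorem IsAnnular.exists_kernel {b : X → ℝ} (hb : IsAnnular b) :
    ∃ K : X → ℂ, Integrable K ∧ Measurable K ∧ ∀ ξ, 𝓕 K ξ = b ξ := by
  set S := toSchwartzComplex hb.contDiff hb.hasCompactSupport with hS
  set T : SchwartzMap X ℂ := 𝓕⁻ S with hT
  refine ⟨T, T.integrable, T.continuous.measurable, fun ξ => ?_⟩
  have h : (𝓕 T : SchwartzMap X ℂ) = S := FourierTransform.fourier_fourierInv_eq S
  have h2 := congrArg (fun g : SchwartzMap X ℂ => g ξ) h
  exact h2

theorem IsBddSupp.integrable_fourier_mul {f ψ : X → ℝ} (hf : ContDiff ℝ ∞ f)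
    (hc : HasCompactSupport f) (hψ : IsBddSupp ψ) :
    Integrable fun ξ => 𝓕 (fun x => (f x : ℂ)) ξ * 𝓕⁻ (fun x => (ψ x : ℂ)) ξ := by
  have hψi : Integrable fun x => (ψ x : ℂ) := hψ.integrable.ofReal
  refine (integrable_fourier_of_test hf hc).mul_bdd (c := ∫ x, ‖(ψ x : ℂ)‖) ?_ ?_
  · refine Continuous.aestronglyMeasurable ?_
    have : 𝓕⁻ (fun x => (ψ x : ℂ)) = fun ξ => 𝓕 (fun x => (ψ x : ℂ)) (-ξ) :=
      funext fun ξ => Real.fourierInv_eq_fourier_neg _ ξ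
    rw [this]
    exact (VectorFourier.fourierIntegral_continuous Real.continuous_fourierChar
      (L := innerₗ X) continuous_inner hψi).comp continuous_neg
  · refine Filter.Eventually.of_forall fun ξ => ?_
    rw [Real.fourierInv_eq]
    refine (norm_integral_le_integral_norm _).trans (le_of_eq ?_)
    simp only [Circle.norm_smul]

theorem one_div_add_two_pos (k : ℕ) : (0 : ℝ) < 1 / (k + 2) ∧ (1 : ℝ) / (k + 2) < k + 2 := by
  have : (0 : ℝ) ≤ k := Nat.cast_nonneg k
  refine ⟨by positivity, ?_⟩
  rw [div_lt_iff₀ (by positivity)]; nlinarith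

/-- Hölder after moving to physical space: the operator with profile `b` acts on `f` in `L^p`, the
one with profile `a` on `ψ` in `L^q`. The constant does not see the truncation parameters. -/
theorem exists_enorm_integral_rotationMult_le {p q : ℝ} (hpq : p.HolderConjugate q) {a b : X → ℝ}
    (ha : IsAnnular a) (hb : IsAnnular b) :
    ∃ C : ℝ≥0∞, C ≠ ⊤ ∧ ∀ α β : ℝ, 0 < α → 0 < β → ∀ f ψ : X → ℝ, ContDiff ℝ ∞ f →
      HasCompactSupport f → IsBddSupp f → IsBddSupp ψ →
      ‖∫ ξ, ((rotationMult (hilbertKernel α β) b ξ * rotationMult (hilbertKernel α β) a (-ξ) : ℝ) : ℂ)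
        * (𝓕 (fun x => (f x : ℂ)) ξ * 𝓕⁻ (fun x => (ψ x : ℂ)) ξ)‖ₑ ≤
        C * (eLpNorm f (ENNReal.ofReal p) volume * eLpNorm ψ (ENNReal.ofReal q) volume) := by
  obtain ⟨K, hKi, hKm, hK⟩ := hb.exists_kernel
  obtain ⟨K', hKi', hKm', hK'⟩ := ha.exists_kernel
  obtain ⟨C, hC, hCb⟩ := exists_eLpNorm_rotationOp_le hpq.lt hKi hKm
  obtain ⟨C', hC', hCb'⟩ := exists_eLpNorm_rotationOp_le hpq.symm.lt hKi' hKm'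
  refine ⟨C * C', ENNReal.mul_ne_top hC hC', fun α β hα hβ f ψ hf hc hfb hψ => ?_⟩
  have hγ : Measurable fun z : X × ℝ => z.2 • z.1 := by fun_prop
  have key := integral_translate_mul_translate (integrable_rotationOp_weight hKi hα hβ) hγ
    (integrable_rotationOp_weight hKi' hα hβ) hγ
    (integrable_fourier_of_test hf hc) (fourierInv_fourier_of_test hf hc)
    (ψ := fun x => (ψ x : ℂ)) (Complex.measurable_ofReal.comp hψ.measurable) hψ.integrable.ofReal
  simp only [transMult_rotationOp hKi hα hβ hK, transMult_rotationOp hKi' hα hβ hK'] at key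
  push_cast
  have hmeas : ∀ {K : X → ℂ} {g : X → ℝ}, Integrable K → Measurable K → IsBddSupp g →
      AEStronglyMeasurable (rotationOp K α β g) volume := by
    intro K g hKi hKm hg
    have h1 := (continuous_hilbertKernel hα hβ).measurable
    have h2 := hg.measurable
    have : StronglyMeasurable (Function.uncurry fun (x : X) (z : X × ℝ) =>
        (K z.1 * (hilbertKernel α β z.2 : ℂ)) * (g (x - z.2 • z.1) : ℂ)) := by
      refine Measurable.stronglyMeasurable ?_
      exact ((hKm.comp (by fun_prop)).mul (Complex.measurable_ofReal.comp
        (h1.comp (by fun_prop)))).mul (Complex.measurable_ofReal.comp (h2.comp (by fun_prop)))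
    exact this.integral_prod_right.aestronglyMeasurable
  rw [← key]
  refine (abs_integral_mul_le_eLpNorm_mul_eLpNorm hpq (hmeas hKi hKm hfb)
    (hmeas hKi' hKm' hψ)).trans ?_
  calc _ ≤ C * eLpNorm f (ENNReal.ofReal p) volume * (C' * eLpNorm ψ (ENNReal.ofReal q) volume) :=
        mul_le_mul' (hCb α β hα hβ f hfb) (hCb' α β hα hβ ψ hψ)
    _ = _ := by ring

theorem IsAnnular.continuous_rotationMult {b : X → ℝ} (hb : IsAnnular b) {α β : ℝ} (hα : 0 < α)
    (hβ : 0 < β) : Continuous (rotationMult (hilbertKernel α β) b) := by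
  obtain ⟨B, hB⟩ := hb.exists_bound
  refine continuous_of_dominated (bound := fun t => ‖hilbertKernel α β t‖ * B) (fun ξ => ?_)
    (fun ξ => ?_) ((integrable_hilbertKernel hα hβ).norm.mul_const _) ?_
  · exact ((continuous_hilbertKernel hα hβ).mul
      (hb.contDiff.continuous.comp (by fun_prop))).aestronglyMeasurable
  · refine Filter.Eventually.of_forall fun t => ?_
    rw [norm_mul]
    exact mul_le_mul_of_nonneg_left (hB _) (norm_nonneg _)
  · exact Filter.Eventually.of_forall fun t =>
      continuous_const.mul (hb.contDiff.continuous.comp (by fun_prop))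

theorem isBddSupp_of_continuous {f : X → ℝ} (hf : Continuous f) (hc : HasCompactSupport f) :
    IsBddSupp f := by
  refine ⟨hf.measurable, hc.exists_bound_of_continuous hf, ?_⟩
  obtain ⟨R, hR⟩ := hc.isCompact.isBounded.subset_closedBall 0
  refine ⟨R, fun x hx => image_eq_zero_of_notMem_tsupport fun h => ?_⟩
  have := hR h
  rw [mem_closedBall_zero_iff] at this
  linarith

/-- Removal of the truncation by dominated convergence on the Fourier side, where the truncated
multipliers are uniformly bounded and converge pointwise. -/
theorem exists_enorm_integral_sum_rotationMult_le {p q : ℝ} (hpq : p.HolderConjugate q)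
    {ι : Type*} [Fintype ι] {a b : ι → X → ℝ} (ha : ∀ i, IsAnnular (a i))
    (hb : ∀ i, IsAnnular (b i)) :
    ∃ C : ℝ≥0∞, C ≠ ⊤ ∧ ∀ f ψ : X → ℝ, ContDiff ℝ ∞ f → HasCompactSupport f → IsBddSupp ψ →
      ‖∫ ξ, ((∑ i, rotationMult (fun t => t⁻¹) (b i) ξ * rotationMult (fun t => t⁻¹) (a i) (-ξ) : ℝ)
        : ℂ) * (𝓕 (fun x => (f x : ℂ)) ξ * 𝓕⁻ (fun x => (ψ x : ℂ)) ξ)‖ₑ ≤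
        C * (eLpNorm f (ENNReal.ofReal p) volume * eLpNorm ψ (ENNReal.ofReal q) volume) := by
  choose C hC hCb using fun i => exists_enorm_integral_rotationMult_le hpq (ha i) (hb i)
  choose A hA using fun i => (ha i).exists_bound
  choose B hB using fun i => (hb i).exists_bound
  refine ⟨∑ i, C i, ENNReal.sum_ne_top.mpr fun i _ => hC i, fun f ψ hf hc hψ => ?_⟩
  set G : X → ℂ := fun ξ => 𝓕 (fun x => (f x : ℂ)) ξ * 𝓕⁻ (fun x => (ψ x : ℂ)) ξ with hG
  have hGi : Integrable G := hψ.integrable_fourier_mul hf hc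
  set h : ℕ → ℝ → ℝ := fun k => hilbertKernel (1 / (k + 2)) (k + 2) with hh
  set m : ℕ → ι → X → ℝ := fun k i ξ =>
    rotationMult (h k) (b i) ξ * rotationMult (h k) (a i) (-ξ) with hm
  have hmb : ∀ k i ξ, |m k i ξ| ≤ (2 * |2| * B i / 1) * (2 * |2| * A i / 1) := by
    intro k i ξ
    obtain ⟨h1, h2⟩ := one_div_add_two_pos k
    have e1 := abs_rotationMult_le (hb i).contDiff.continuous one_pos (hB i)
      (hb i).eq_zero_of_lt (hb i).eq_zero_of_gt h1 h2 ξ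
    have e2 := abs_rotationMult_le (ha i).contDiff.continuous one_pos (hA i)
      (ha i).eq_zero_of_lt (ha i).eq_zero_of_gt h1 h2 (-ξ)
    rw [hm]; simp only [abs_mul]
    exact mul_le_mul e1 e2 (abs_nonneg _) ((abs_nonneg _).trans e1)
  have hmc : ∀ k i, Continuous (m k i) := by
    intro k i
    obtain ⟨h1, h2⟩ := one_div_add_two_pos k
    exact ((hb i).continuous_rotationMult h1 (h1.trans h2)).mul
      (((ha i).continuous_rotationMult h1 (h1.trans h2)).comp continuous_neg)
  have hmi : ∀ k i, Integrable fun ξ => (m k i ξ : ℂ) * G ξ := fun k i =>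
    hGi.bdd_mul (c := (2 * |2| * B i / 1) * (2 * |2| * A i / 1))
      (Complex.continuous_ofReal.comp (hmc k i)).aestronglyMeasurable
      (Filter.Eventually.of_forall fun ξ => by rw [Complex.norm_real]; exact hmb k i ξ)
  have hk : ∀ k, ‖∫ ξ, ((∑ i, m k i ξ : ℝ) : ℂ) * G ξ‖ₑ ≤ (∑ i, C i) *
      (eLpNorm f (ENNReal.ofReal p) volume * eLpNorm ψ (ENNReal.ofReal q) volume) := by
    intro k
    obtain ⟨h1, h2⟩ := one_div_add_two_pos k
    have : ∫ ξ, ((∑ i, m k i ξ : ℝ) : ℂ) * G ξ = ∑ i, ∫ ξ, (m k i ξ : ℂ) * G ξ := by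
      rw [← integral_finsetSum _ fun i _ => hmi k i]
      congr 1; funext ξ
      push_cast
      rw [Finset.sum_mul]
    rw [this, Finset.sum_mul]
    refine (enorm_sum_le _ _).trans (Finset.sum_le_sum fun i _ => ?_)
    exact hCb i _ _ h1 (h1.trans h2) f ψ hf hc (isBddSupp_of_continuous hf.continuous hc) hψ
  have hlim : Filter.Tendsto (fun k => ∫ ξ, ((∑ i, m k i ξ : ℝ) : ℂ) * G ξ) Filter.atTop
      (nhds (∫ ξ, ((∑ i, rotationMult (fun t => t⁻¹) (b i) ξ *
        rotationMult (fun t => t⁻¹) (a i) (-ξ) : ℝ) : ℂ) * G ξ)) := by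
    refine tendsto_integral_of_dominated_convergence
      (fun ξ => (∑ i, (2 * |2| * B i / 1) * (2 * |2| * A i / 1)) * ‖G ξ‖) (fun k => ?_)
      (hGi.norm.const_mul _) (fun k => ?_) ?_
    · refine (Continuous.aestronglyMeasurable ?_).mul hGi.1
      exact Complex.continuous_ofReal.comp (continuous_finsetSum _ fun i _ => hmc k i)
    · refine Filter.Eventually.of_forall fun ξ => ?_
      rw [norm_mul, Complex.norm_real]
      refine mul_le_mul_of_nonneg_right ?_ (norm_nonneg _)
      exact (norm_sum_le _ _).trans (Finset.sum_le_sum fun i _ => hmb k i ξ)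
    · refine Filter.Eventually.of_forall fun ξ => ?_
      refine Filter.Tendsto.mul_const _ ?_
      refine (Complex.continuous_ofReal.tendsto _).comp ?_
      refine tendsto_finsetSum _ fun i _ => ?_
      exact (tendsto_rotationMult (hb i).contDiff.continuous one_pos (hB i)
        (hb i).eq_zero_of_lt (hb i).eq_zero_of_gt ξ).mul
        (tendsto_rotationMult (ha i).contDiff.continuous one_pos (hA i)
        (ha i).eq_zero_of_lt (ha i).eq_zero_of_gt (-ξ))
  exact le_of_tendsto ((continuous_enorm.tendsto _).comp hlim) (Filter.Eventually.of_forall hk)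

end Annular

/-- A bump function on the line centred at `2`. -/
noncomputable def bumpTwo : ContDiffBump (2 : ℝ) := ⟨1 / 2, 1, by norm_num, by norm_num⟩

/-- A radial smooth cut-off function supported in an annulus. -/
noncomputable def annulusCutoff {X : Type*} [Norm X] (η : X) : ℝ := bumpTwo (‖η‖ ^ 2)

theorem annulusCutoff_eq_zero {X : Type*} [NormedAddCommGroup X] {η : X}
    (h : ‖η‖ < 1 ∨ 2 < ‖η‖) : annulusCutoff η = 0 := by
  refine bumpTwo.zero_of_le_dist ?_
  rw [Real.dist_eq]
  change 1 ≤ _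
  rcases h with h | h
  · rw [abs_sub_comm]
    exact le_trans (by nlinarith [norm_nonneg η]) (le_abs_self _)
  · exact le_trans (by nlinarith) (le_abs_self _)

theorem isAnnular_mul_annulusCutoff {X : Type*} [NormedAddCommGroup X] [InnerProductSpace ℝ X]
    {N : X → ℝ} (hN : ∀ η, η ≠ 0 → ContDiffAt ℝ ∞ N η) :
    IsAnnular fun η => N η * annulusCutoff η := by
  refine ⟨?_, fun η hη => by rw [annulusCutoff_eq_zero (Or.inl hη), mul_zero],
    fun η hη => by rw [annulusCutoff_eq_zero (Or.inr hη), mul_zero]⟩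
  have hcut : ContDiff ℝ ∞ (annulusCutoff : X → ℝ) :=
    bumpTwo.contDiff.comp (contDiff_norm_sq ℝ)
  refine contDiff_iff_contDiffAt.mpr fun η => ?_
  rcases eq_or_ne η 0 with rfl | hη
  · refine (contDiffAt_const (c := (0 : ℝ))).congr_of_eventuallyEq ?_
    filter_upwards [Metric.ball_mem_nhds (0 : X) one_pos] with η hη
    rw [annulusCutoff_eq_zero (Or.inl (by simpa using hη)), mul_zero]
  · exact (hN η hη).mul hcut.contDiffAt

/-- The normalising constant `∫ χ(t e) dt`. -/
noncomputable def cutoffMass : ℝ := ∫ s : ℝ, bumpTwo (s ^ 2)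

theorem cutoffMass_pos : 0 < cutoffMass := by
  have hc : Continuous fun s : ℝ => bumpTwo (s ^ 2) := bumpTwo.continuous.comp (by fun_prop)
  refine hc.integral_pos_of_hasCompactSupport_nonneg_nonzero ?_ (fun s => bumpTwo.nonneg)
    (x := Real.sqrt 2) ?_
  · refine HasCompactSupport.intro (isCompact_closedBall (0 : ℝ) 2) fun s hs => ?_
    have := annulusCutoff_eq_zero (η := s) (Or.inr (by simpa using hs))
    rwa [annulusCutoff, Real.norm_eq_abs, sq_abs] at this
  · rw [Real.sq_sqrt (by norm_num)]
    rw [bumpTwo.one_of_mem_closedBall (Metric.mem_closedBall_self bumpTwo.rIn_pos.le)]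
    exact one_ne_zero

theorem integral_annulusCutoff_smul {X : Type*} [NormedAddCommGroup X] [NormedSpace ℝ X] {ξ : X}
    : ∫ t : ℝ, annulusCutoff (t • ξ) = ‖ξ‖⁻¹ * cutoffMass := by
  have h : ∀ t : ℝ, annulusCutoff (t • ξ) = bumpTwo ((t * ‖ξ‖) ^ 2) := by
    intro t
    rw [annulusCutoff, norm_smul, mul_pow, mul_pow, Real.norm_eq_abs, sq_abs]
  simp only [h]
  rw [Measure.integral_comp_mul_right (fun s : ℝ => bumpTwo (s ^ 2)) ‖ξ‖, cutoffMass, smul_eq_mul,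
    abs_of_nonneg (by positivity)]

/-- The factor `t` from the homogeneity of `N` cancels `1/t`. What remains is the integral of the
radial cut-off along a line, a multiple of `‖ξ‖⁻¹`. -/
theorem rotationMult_cutoff {X : Type*} [NormedAddCommGroup X] [InnerProductSpace ℝ X] {N : X → ℝ}
    (hN : ∀ (t : ℝ) (ξ : X), t ≠ 0 → N (t • ξ) = t * N ξ) (ξ : X) :
    rotationMult (fun t => t⁻¹) (fun η => N η * annulusCutoff η) ξ =
      N ξ * (‖ξ‖⁻¹ * cutoffMass) := by
  rw [rotationMult, ← integral_annulusCutoff_smul, ← integral_const_mul]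
  congr 1; funext t
  rcases eq_or_ne t 0 with rfl | ht
  · rw [zero_smul, annulusCutoff_eq_zero (Or.inl (by simp))]; ring
  · rw [hN t ξ ht]; field_simp

/-- Smooth multipliers that are even and homogeneous of degree zero are bounded on `L^p`. -/
theorem exists_enorm_integral_homogeneous_le {n : ℕ} (hn : n ≠ 0) {p q : ℝ}
    (hpq : p.HolderConjugate q) {M : E n → ℝ} (hM : ∀ ξ, ξ ≠ 0 → ContDiffAt ℝ ∞ M ξ)
    (hM0 : ∀ (t : ℝ) (ξ : E n), t ≠ 0 → M (t • ξ) = M ξ) :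
    ∃ C : ℝ≥0∞, C ≠ ⊤ ∧ ∀ f ψ : E n → ℝ, ContDiff ℝ ∞ f → HasCompactSupport f → IsBddSupp ψ →
      ‖∫ ξ, (M ξ : ℂ) * (𝓕 (fun x => (f x : ℂ)) ξ * 𝓕⁻ (fun x => (ψ x : ℂ)) ξ)‖ₑ ≤
        C * (eLpNorm f (ENNReal.ofReal p) volume * eLpNorm ψ (ENNReal.ofReal q) volume) := by
  have hcoord : ∀ (l : Fin n) (ξ : E n), ContDiffAt ℝ ∞ (fun η : E n => η l) ξ := fun l ξ =>
    (EuclideanSpace.proj (𝕜 := ℝ) l).contDiff.contDiffAt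
  -- The `l`-th product is `-c² ξ_l² M(ξ)/‖ξ‖²`, with the sign due to the argument `-ξ`. Summation
  -- over `l` gives `-c² M`.
  obtain ⟨C, hC, h⟩ := exists_enorm_integral_sum_rotationMult_le hpq
    (a := fun (l : Fin n) (η : E n) => η l * annulusCutoff η)
    (b := fun (l : Fin n) (η : E n) => (η l * M η) * annulusCutoff η)
    (fun l => isAnnular_mul_annulusCutoff fun η _ => hcoord l η)
    (fun l => isAnnular_mul_annulusCutoff fun η hη => (hcoord l η).mul (hM η hη))
  set c := cutoffMass with hc
  have hc0 : 0 < c := cutoffMass_pos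
  have hsum : ∀ ξ : E n, ξ ≠ 0 → (∑ l, rotationMult (fun t => t⁻¹)
      (fun η : E n => (η l * M η) * annulusCutoff η) ξ *
      rotationMult (fun t => t⁻¹) (fun η : E n => η l * annulusCutoff η) (-ξ) : ℝ) =
      -c ^ 2 * M ξ := by
    intro ξ hξ
    have hn : ‖ξ‖ ≠ 0 := norm_ne_zero_iff.mpr hξ
    have h1 : ∀ l : Fin n, rotationMult (fun t => t⁻¹)
        (fun η : E n => (η l * M η) * annulusCutoff η) ξ *
        rotationMult (fun t => t⁻¹) (fun η : E n => η l * annulusCutoff η) (-ξ) =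
        (-c ^ 2 * M ξ * (‖ξ‖ ^ 2)⁻¹) * (ξ l) ^ 2 := by
      intro l
      rw [rotationMult_cutoff (N := fun η : E n => η l * M η),
        rotationMult_cutoff (N := fun η : E n => η l), norm_neg]
      · rw [← hc]
        simp only [PiLp.neg_apply]
        field_simp
      · intro t ξ _; simp
      · intro t ξ ht
        rw [hM0 t ξ ht]; simp [mul_assoc]
    rw [Finset.sum_congr rfl fun l _ => h1 l, ← Finset.mul_sum]
    have h2 : ∑ l, ξ l ^ 2 = ‖ξ‖ ^ 2 := by
      rw [EuclideanSpace.norm_sq_eq]; simp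
    rw [h2]; field_simp
  refine ⟨ENNReal.ofReal (c ^ 2)⁻¹ * C, ENNReal.mul_ne_top ENNReal.ofReal_ne_top hC,
    fun f ψ hf hfc hψ => ?_⟩
  have h3 := h f ψ hf hfc hψ
  have : Nontrivial (E n) := by
    have : Nonempty (Fin n) := ⟨⟨0, Nat.pos_of_ne_zero hn⟩⟩
    infer_instance
  have hae : ∀ᵐ ξ : E n, ξ ≠ 0 := by
    rw [ae_iff]; simp
  have h4 : ∫ ξ, ((∑ l, rotationMult (fun t => t⁻¹)
      (fun η : E n => (η l * M η) * annulusCutoff η) ξ *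
      rotationMult (fun t => t⁻¹) (fun η : E n => η l * annulusCutoff η) (-ξ) : ℝ) : ℂ) *
      (𝓕 (fun x => (f x : ℂ)) ξ * 𝓕⁻ (fun x => (ψ x : ℂ)) ξ) =
      ((-c ^ 2 : ℝ) : ℂ) *
      ∫ ξ, (M ξ : ℂ) * (𝓕 (fun x => (f x : ℂ)) ξ * 𝓕⁻ (fun x => (ψ x : ℂ)) ξ) := by
    rw [← integral_const_mul]
    refine integral_congr_ae ?_
    filter_upwards [hae] with ξ hξ
    rw [hsum ξ hξ]; push_cast; ring
  rw [h4, enorm_mul] at h3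
  have h5 : ‖((-c ^ 2 : ℝ) : ℂ)‖ₑ = ENNReal.ofReal (c ^ 2) := by
    rw [← ofReal_norm, Complex.norm_real, norm_neg, Real.norm_of_nonneg (by positivity)]
  rw [h5] at h3
  calc _ = ENNReal.ofReal (c ^ 2)⁻¹ * (ENNReal.ofReal (c ^ 2) *
        ‖∫ ξ, (M ξ : ℂ) * (𝓕 (fun x => (f x : ℂ)) ξ * 𝓕⁻ (fun x => (ψ x : ℂ)) ξ)‖ₑ) := by
        rw [← mul_assoc, ← ENNReal.ofReal_mul (by positivity), inv_mul_cancel₀ (by positivity),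
          ENNReal.ofReal_one, one_mul]
    _ ≤ _ := by rw [mul_assoc]; gcongr

end HomogeneousMultiplier

/-! ### The Korn type inequality for elliptic operators -/

section LeftInverse

variable {n : ℕ} {V W : Type*} [NormedAddCommGroup V] [NormedSpace ℝ V]
  [NormedAddCommGroup W] [NormedSpace ℝ W]

theorem contDiff_symbol (A : Fin n → V →L[ℝ] W) : ContDiff ℝ ∞ (symbol A) := by
  unfold symbol
  refine ContDiff.sum fun α _ => ?_
  exact (EuclideanSpace.proj (𝕜 := ℝ) α).contDiff.smul contDiff_const

theorem symbol_smul (A : Fin n → V →L[ℝ] W) (t : ℝ) (ξ : E n) :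
    symbol A (t • ξ) = t • symbol A ξ := by
  simp only [symbol, Finset.smul_sum, PiLp.smul_apply, smul_eq_mul, mul_smul]

/-- Taking adjoints of operators between real Hilbert spaces is linear. -/
noncomputable def adjointCLM (F G : Type*) [NormedAddCommGroup F] [InnerProductSpace ℝ F]
    [CompleteSpace F] [NormedAddCommGroup G] [InnerProductSpace ℝ G] [CompleteSpace G] :
    (F →L[ℝ] G) →L[ℝ] (G →L[ℝ] F) :=
  LinearMap.mkContinuous
    { toFun := fun B => ContinuousLinearMap.adjoint B
      map_add' := fun B B' => map_add _ B B'
      map_smul' := fun r B => by simp } 1 fun B => by simp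

theorem ringInverse_smul {R : Type*} [Ring R] [Algebra ℝ R] {G : R} (hG : IsUnit G) {c : ℝ}
    (hc : c ≠ 0) : Ring.inverse (c • G) = c⁻¹ • Ring.inverse G := by
  have h1 : IsUnit (c • G) := by
    rw [Algebra.smul_def]
    exact (((isUnit_iff_ne_zero.mpr hc).map (algebraMap ℝ R))).mul hG
  have h2 : G = c⁻¹ • (c • G) := by rw [smul_smul, inv_mul_cancel₀ hc, one_smul]
  calc Ring.inverse (c • G) = Ring.inverse (c • G) * (G * Ring.inverse G) := by
        rw [Ring.mul_inverse_cancel _ hG, mul_one]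
    _ = Ring.inverse (c • G) * ((c⁻¹ • (c • G)) * Ring.inverse G) := by rw [← h2]
    _ = c⁻¹ • Ring.inverse G := by
        rw [smul_mul_assoc, mul_smul_comm, ← mul_assoc, Ring.inverse_mul_cancel _ h1, one_mul]

/-- The symbol of an elliptic operator has a smooth left inverse of homogeneity `-1`. -/
theorem exists_leftInverse_symbol [FiniteDimensional ℝ V] [FiniteDimensional ℝ W]
    {A : Fin n → V →L[ℝ] W} (hA : IsRElliptic A) :
    ∃ L : E n → W →L[ℝ] V, (∀ ξ, ξ ≠ 0 → ContDiffAt ℝ ∞ L ξ) ∧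
      (∀ (t : ℝ) (ξ : E n), t ≠ 0 → ξ ≠ 0 → L (t • ξ) = t⁻¹ • L ξ) ∧
      ∀ ξ, ξ ≠ 0 → ∀ v, L ξ (symbol A ξ v) = v := by
  let eV := toEuclidean (E := V)
  let eW := toEuclidean (E := W)
  let FV := EuclideanSpace ℝ (Fin (Module.finrank ℝ V))
  let FW := EuclideanSpace ℝ (Fin (Module.finrank ℝ W))
  let B : E n → FV →L[ℝ] FW := fun ξ =>
    (eW : W →L[ℝ] FW).comp ((symbol A ξ).comp (eV.symm : FV →L[ℝ] V))
  let Bt : E n → FW →L[ℝ] FV := fun ξ => adjointCLM FV FW (B ξ)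
  let G : E n → FV →L[ℝ] FV := fun ξ => (Bt ξ).comp (B ξ)
  have hBsmooth : ContDiff ℝ ∞ B :=
    contDiff_const.clm_comp ((contDiff_symbol A).clm_comp contDiff_const)
  have hBtsmooth : ContDiff ℝ ∞ Bt := (adjointCLM FV FW).contDiff.comp hBsmooth
  have hGsmooth : ContDiff ℝ ∞ G := hBtsmooth.clm_comp hBsmooth
  have hBhom : ∀ (t : ℝ) (ξ : E n), B (t • ξ) = t • B ξ := by
    intro t ξ
    ext v : 1
    simp [B, symbol_smul]
  have hBthom : ∀ (t : ℝ) (ξ : E n), Bt (t • ξ) = t • Bt ξ := fun t ξ => by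
    simp only [Bt, hBhom, map_smul]
  have hGhom : ∀ (t : ℝ) (ξ : E n), G (t • ξ) = (t * t) • G ξ := fun t ξ => by
    simp only [G, hBhom, hBthom, ContinuousLinearMap.comp_smul, ContinuousLinearMap.smul_comp,
      smul_smul]
  have hGu : ∀ ξ, ξ ≠ 0 → IsUnit (G ξ) := by
    intro ξ hξ
    have hinj : Function.Injective (G ξ) := by
      rw [injective_iff_map_eq_zero]
      intro x hx
      -- With `G = B* B`, a kernel vector of `G` is one of `B`, which ellipticity excludes.
      have h1 : inner ℝ (G ξ x) x = ‖B ξ x‖ ^ 2 := by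
        change inner ℝ (ContinuousLinearMap.adjoint (B ξ) (B ξ x)) x = _
        rw [ContinuousLinearMap.adjoint_inner_left, real_inner_self_eq_norm_sq]
      rw [hx, inner_zero_left] at h1
      have h2 : B ξ x = 0 := by
        rw [← norm_eq_zero]; exact pow_eq_zero_iff two_ne_zero |>.mp h1.symm
      have h3 : symbol A ξ (eV.symm x) = symbol A ξ 0 := by
        rw [map_zero]; exact (map_eq_zero_iff eW eW.injective).mp h2
      exact (map_eq_zero_iff eV.symm eV.symm.injective).mp (hA ξ hξ h3)
    rw [ContinuousLinearMap.isUnit_iff_bijective]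
    exact ⟨hinj, (LinearMap.injective_iff_surjective (f := (G ξ : FV →ₗ[ℝ] FV))).mp hinj⟩
  let L : E n → W →L[ℝ] V := fun ξ =>
    (eV.symm : FV →L[ℝ] V).comp (((Ring.inverse (G ξ)).comp (Bt ξ)).comp (eW : W →L[ℝ] FW))
  refine ⟨L, fun ξ hξ => ?_, fun t ξ ht hξ => ?_, fun ξ hξ v => ?_⟩
  · have h1 : ContDiffAt ℝ ∞ (fun ξ => Ring.inverse (G ξ)) ξ := by
      obtain ⟨u, hu⟩ := hGu ξ hξ
      have h2 := contDiffAt_ringInverse ℝ (n := ∞) u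
      rw [hu] at h2
      exact h2.comp ξ hGsmooth.contDiffAt
    exact contDiffAt_const.clm_comp ((h1.clm_comp hBtsmooth.contDiffAt).clm_comp contDiffAt_const)
  · simp only [L, hGhom, hBthom, ringInverse_smul (hGu ξ hξ) (mul_ne_zero ht ht),
      ContinuousLinearMap.comp_smul, ContinuousLinearMap.smul_comp, smul_smul]
    congr 1
    field_simp
  · have h1 : Ring.inverse (G ξ) (G ξ (eV v)) = eV v := by
      have := congrArg (fun T : FV →L[ℝ] FV => T (eV v)) (Ring.inverse_mul_cancel _ (hGu ξ hξ))
      exact this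
    have h2 : Bt ξ (eW (symbol A ξ v)) = G ξ (eV v) := by
      simp [G, B]
    change eV.symm (Ring.inverse (G ξ) (Bt ξ (eW (symbol A ξ v)))) = v
    rw [h2, h1, ContinuousLinearEquiv.symm_apply_apply]

end LeftInverse

/-! ### The `L^p` estimate of the gradient by `𝔸φ` for test functions. -/

section Korn

open FourierTransform

variable {n : ℕ} {V W : Type*} [NormedAddCommGroup V] [NormedSpace ℝ V]
  [NormedAddCommGroup W] [NormedSpace ℝ W]

theorem fourier_fderiv_ofReal {g : E n → ℝ} (hg : ContDiff ℝ ∞ g) (hc : HasCompactSupport g)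
    (e ξ : E n) : 𝓕 (fun x => ((fderiv ℝ g x e : ℝ) : ℂ)) ξ =
      (2 * Real.pi * Complex.I) * (inner ℝ e ξ : ℝ) * 𝓕 (fun x => (g x : ℂ)) ξ := by
  set f : E n → ℂ := fun x => (g x : ℂ) with hf
  have hfs : ContDiff ℝ ∞ f := Complex.ofRealCLM.contDiff.comp hg
  have hfc : HasCompactSupport f := hc.comp_left (g := fun r : ℝ => (r : ℂ)) Complex.ofReal_zero
  have hfi : Integrable f := hfs.continuous.integrable_of_hasCompactSupport hfc
  have hdi : Integrable (fderiv ℝ f) :=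
    (hfs.continuous_fderiv (by simp)).integrable_of_hasCompactSupport (hfc.fderiv ℝ)
  have h := Real.fourier_fderiv hfi (hfs.differentiable (by simp)) hdi
  have h1 : ∀ x, fderiv ℝ f x e = ((fderiv ℝ g x e : ℝ) : ℂ) := by
    intro x
    have h2 : HasFDerivAt f (Complex.ofRealCLM.comp (fderiv ℝ g x)) x :=
      Complex.ofRealCLM.hasFDerivAt.comp x ((hg.differentiable (by simp)) x).hasFDerivAt
    rw [h2.fderiv]; rfl
  have h3 : 𝓕 (fderiv ℝ f) ξ e = 𝓕 (fun x => ((fderiv ℝ g x e : ℝ) : ℂ)) ξ := by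
    rw [Real.fourier_continuousLinearMap_apply hdi]
    simp only [h1]
  rw [← h3, h, VectorFourier.fourierSMulRight_apply]
  have h4 : (-innerSL ℝ (E := E n)) ξ e = -inner ℝ e ξ := by
    rw [real_inner_comm]; rfl
  rw [h4, Complex.real_smul, smul_eq_mul]
  push_cast
  ring

/-- The Fourier transform at `ξ` of the components of a vector valued test function. -/
noncomputable def fourierComponent {φ : E n → V} (hφ : Continuous φ) (hc : HasCompactSupport φ)
    (ξ : E n) : (V →L[ℝ] ℝ) →ₗ[ℝ] ℂ where
  toFun ℓ := 𝓕 (fun x => (ℓ (φ x) : ℂ)) ξ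
  map_add' ℓ ℓ' := by
    have hi : ∀ ℓ : V →L[ℝ] ℝ, Integrable fun x =>
        Real.fourierChar (-inner ℝ x ξ) • ((ℓ (φ x) : ℝ) : ℂ) := by
      intro ℓ
      rw [Real.fourierIntegral_convergent_iff]
      exact ((ℓ.continuous.comp hφ).integrable_of_hasCompactSupport
        (hc.comp_left (g := ℓ) (map_zero ℓ))).ofReal
    simp only [Real.fourier_eq]
    rw [← integral_add (hi ℓ) (hi ℓ')]
    congr 1; funext x
    simp [smul_add]
  map_smul' r ℓ := by
    simp only [Real.fourier_eq]
    rw [RingHom.id_apply, ← integral_smul]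
    congr 1; funext x
    rw [smul_comm]; simp

/-- On the Fourier side `𝔸` multiplies by `2πi 𝔸[ξ]`. Treating the transform as a linear map in the
functional `ℓ` lets the symbol act by composition, without complexifying `V` and `W`. -/
theorem fourier_applyGrad_component {φ : E n → V} (hφ : ContDiff ℝ ∞ φ) (hc : HasCompactSupport φ)
    (A : Fin n → V →L[ℝ] W) (κ : W →L[ℝ] ℝ) (ξ : E n) :
    𝓕 (fun x => (κ (applyGrad A (fderiv ℝ φ x)) : ℂ)) ξ =
      (2 * Real.pi * Complex.I) * fourierComponent hφ.continuous hc ξ (κ.comp (symbol A ξ)) := by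
  have hg : ∀ α, ContDiff ℝ ∞ fun x => (κ.comp (A α)) (φ x) := fun α =>
    (κ.comp (A α)).contDiff.comp hφ
  have hgc : ∀ α, HasCompactSupport fun x => (κ.comp (A α)) (φ x) := fun α =>
    hc.comp_left (g := κ.comp (A α)) (map_zero (κ.comp (A α)))
  have hd : ∀ α x e, fderiv ℝ (fun x => (κ.comp (A α)) (φ x)) x e = κ (A α (fderiv ℝ φ x e)) := by
    intro α x e
    have h2 : HasFDerivAt (fun x => (κ.comp (A α)) (φ x)) ((κ.comp (A α)).comp (fderiv ℝ φ x)) x :=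
      (κ.comp (A α)).hasFDerivAt.comp x ((hφ.differentiable (by simp)) x).hasFDerivAt
    rw [h2.fderiv]; rfl
  have hi : ∀ α, Integrable fun x => Real.fourierChar (-inner ℝ x ξ) •
      ((κ (A α (fderiv ℝ φ x (EuclideanSpace.single α 1))) : ℝ) : ℂ) := by
    intro α
    rw [Real.fourierIntegral_convergent_iff]
    have h1 : (fun x => κ (A α (fderiv ℝ φ x (EuclideanSpace.single α 1)))) = fun x =>
        fderiv ℝ (fun x => (κ.comp (A α)) (φ x)) x (EuclideanSpace.single α 1) :=
      funext fun x => (hd α x _).symm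
    have h2 : Integrable fun x => κ (A α (fderiv ℝ φ x (EuclideanSpace.single α 1))) := by
      rw [h1]
      refine Continuous.integrable_of_hasCompactSupport ?_ ((hgc α).fderiv_apply ℝ _)
      exact ((hg α).continuous_fderiv (by simp)).clm_apply continuous_const
    exact h2.ofReal
  have e1 : 𝓕 (fun x => (κ (applyGrad A (fderiv ℝ φ x)) : ℂ)) ξ =
      ∑ α, 𝓕 (fun x => ((fderiv ℝ (fun x => (κ.comp (A α)) (φ x)) x
        (EuclideanSpace.single α 1) : ℝ) : ℂ)) ξ := by
    simp only [Real.fourier_eq, hd]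
    rw [← integral_finsetSum _ fun α _ => hi α]
    congr 1; funext x
    rw [← Finset.smul_sum, applyGrad, map_sum]
    push_cast; rfl
  rw [e1, symbol, ContinuousLinearMap.comp_finsetSum, map_sum, Finset.mul_sum]
  refine Finset.sum_congr rfl fun α _ => ?_
  rw [fourier_fderiv_ofReal (hg α) (hgc α), ContinuousLinearMap.comp_smul, map_smul]
  have : inner ℝ (EuclideanSpace.single α (1 : ℝ)) ξ = ξ α := by
    simp [EuclideanSpace.inner_single_left]
  rw [this, Complex.real_smul, mul_assoc]
  rfl

/-- By homogeneity the multiplier is bounded by its maximum on the unit sphere, and the origin is a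
null set. -/
theorem integrable_homogeneous_mul {M : E n → ℝ} (hM : ∀ ξ, ξ ≠ 0 → ContDiffAt ℝ ∞ M ξ)
    (hM0 : ∀ (t : ℝ) (ξ : E n), t ≠ 0 → M (t • ξ) = M ξ) (hn : n ≠ 0) {G : E n → ℂ}
    (hG : Integrable G) : Integrable fun ξ => (M ξ : ℂ) * G ξ := by
  have : Nontrivial (E n) := by
    have : Nonempty (Fin n) := ⟨⟨0, Nat.pos_of_ne_zero hn⟩⟩
    infer_instance
  have hae : ∀ᵐ ξ : E n, ξ ∈ ({0}ᶜ : Set (E n)) := by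
    rw [ae_iff]; simp
  have hcont : ContinuousOn M {0}ᶜ := fun ξ hξ => (hM ξ hξ).continuousAt.continuousWithinAt
  have hmeas : AEStronglyMeasurable M volume := by
    have := hcont.aestronglyMeasurable (μ := (volume : Measure (E n)))
      (measurableSet_singleton (0 : E n)).compl
    rwa [Measure.restrict_eq_self_of_ae_mem hae] at this
  obtain ⟨B, hB⟩ := (isCompact_sphere (0 : E n) 1).exists_bound_of_continuousOn
    (hcont.mono fun ξ hξ => by
      rw [Set.mem_compl_singleton_iff]
      exact Metric.ne_of_mem_sphere hξ one_ne_zero)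
  refine hG.bdd_mul (c := B) (Complex.continuous_ofReal.comp_aestronglyMeasurable hmeas) ?_
  filter_upwards [hae] with ξ hξ
  have hξ0 : ‖ξ‖ ≠ 0 := norm_ne_zero_iff.mpr hξ
  rw [Complex.norm_real, ← hM0 ‖ξ‖⁻¹ ξ (inv_ne_zero hξ0)]
  exact hB _ (by simp [norm_smul, hξ0])

/-- Each gradient component is a sum of homogeneous multipliers applied to the components of `𝔸φ`.
The multiplier bounds are bilinear, so the norm is recovered by testing with the dual power. -/
theorem exists_eLpNorm_fderiv_component_le [FiniteDimensional ℝ V] [FiniteDimensional ℝ W]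
    (hn : n ≠ 0) {A : Fin n → V →L[ℝ] W} (hA : IsRElliptic A) {p : ℝ} (hp : 1 < p)
    (ℓ : V →L[ℝ] ℝ) (e : E n) :
    ∃ C : ℝ≥0∞, C ≠ ⊤ ∧ ∀ φ : E n → V, ContDiff ℝ ∞ φ → HasCompactSupport φ →
      eLpNorm (fun x => ℓ (fderiv ℝ φ x e)) (ENNReal.ofReal p) volume ≤
        C * eLpNorm (fun x => applyGrad A (fderiv ℝ φ x)) (ENNReal.ofReal p) volume := by
  have hpq := Real.HolderConjugate.conjExponent hp
  set q := p.conjExponent with hq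
  obtain ⟨L, hLs, hLh, hLi⟩ := exists_leftInverse_symbol hA
  let w := Module.finBasis ℝ W
  let κ : Fin (Module.finrank ℝ W) → W →L[ℝ] ℝ := fun b => (w.coord b).toContinuousLinearMap
  -- Degree `1` from the derivative against degree `-1` from the left inverse: `M b` is homogeneous
  -- of degree zero, also for negative dilations.
  let M : Fin (Module.finrank ℝ W) → E n → ℝ := fun b ξ =>
    if ξ = 0 then 0 else inner ℝ e ξ * ℓ (L ξ (w b))
  have hM : ∀ b ξ, ξ ≠ 0 → ContDiffAt ℝ ∞ (M b) ξ := by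
    intro b ξ hξ
    have h1 : ContDiffAt ℝ ∞ (fun ξ => inner ℝ e ξ * ℓ (L ξ (w b))) ξ := by
      refine ContDiffAt.mul (contDiffAt_const.inner ℝ contDiffAt_id) ?_
      exact ℓ.contDiff.contDiffAt.comp ξ ((hLs ξ hξ).clm_apply contDiffAt_const)
    refine h1.congr_of_eventuallyEq ?_
    filter_upwards [isOpen_compl_singleton.mem_nhds hξ] with η hη
    exact if_neg hη
  have hM0 : ∀ b (t : ℝ) (ξ : E n), t ≠ 0 → M b (t • ξ) = M b ξ := by
    intro b t ξ ht
    by_cases hξ : ξ = 0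
    · simp [M, hξ]
    · have : t • ξ ≠ 0 := smul_ne_zero ht hξ
      simp only [M, if_neg hξ, if_neg this, hLh t ξ ht hξ, inner_smul_right,
        smul_apply, map_smul, smul_eq_mul]
      field_simp
  choose C hC hCb using fun b => exists_enorm_integral_homogeneous_le hn hpq (hM b) (hM0 b)
  refine ⟨∑ b, C b * ENNReal.ofReal ‖κ b‖, ENNReal.sum_ne_top.mpr fun b _ =>
    ENNReal.mul_ne_top (hC b) ENNReal.ofReal_ne_top, fun φ hφ hc => ?_⟩
  have hgs : ContDiff ℝ ∞ fun x => ℓ (φ x) := ℓ.contDiff.comp hφ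
  have hgc : HasCompactSupport fun x => ℓ (φ x) := hc.comp_left (g := ℓ) (map_zero ℓ)
  have hd : ∀ x, fderiv ℝ (fun x => ℓ (φ x)) x e = ℓ (fderiv ℝ φ x e) := by
    intro x
    have h2 : HasFDerivAt (fun x => ℓ (φ x)) (ℓ.comp (fderiv ℝ φ x)) x :=
      ℓ.hasFDerivAt.comp x ((hφ.differentiable (by simp)) x).hasFDerivAt
    rw [h2.fderiv]; rfl
  set F : E n → ℝ := fun x => ℓ (fderiv ℝ φ x e) with hF
  have hdφ : ContDiff ℝ ∞ (fderiv ℝ φ) := hφ.fderiv_right (by simp)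
  have hFs : ContDiff ℝ ∞ F := ℓ.contDiff.comp (hdφ.clm_apply contDiff_const)
  have hFc : HasCompactSupport F :=
    (hc.fderiv_apply ℝ e).comp_left (g := ℓ) (map_zero ℓ)
  set f : Fin (Module.finrank ℝ W) → E n → ℝ := fun b x => κ b (applyGrad A (fderiv ℝ φ x)) with hf
  have hAs : ContDiff ℝ ∞ fun x => applyGrad A (fderiv ℝ φ x) := by
    unfold applyGrad
    exact ContDiff.sum fun α _ => (A α).contDiff.comp (hdφ.clm_apply contDiff_const)
  have hfs : ∀ b, ContDiff ℝ ∞ (f b) := fun b => (κ b).contDiff.comp hAs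
  have hfc : ∀ b, HasCompactSupport (f b) := by
    intro b
    have : applyGrad A (0 : E n →L[ℝ] V) = 0 := by simp [applyGrad]
    exact ((hc.fderiv ℝ).comp_left (g := applyGrad A) this).comp_left (g := κ b) (map_zero (κ b))
  have hfour : ∀ ξ, ξ ≠ 0 → 𝓕 (fun x => (F x : ℂ)) ξ =
      ∑ b, (M b ξ : ℂ) * 𝓕 (fun x => (f b x : ℂ)) ξ := by
    intro ξ hξ
    have h1 : 𝓕 (fun x => (F x : ℂ)) ξ = (2 * Real.pi * Complex.I) * (inner ℝ e ξ : ℝ) *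
        fourierComponent hφ.continuous hc ξ ℓ := by
      rw [hF]
      simp only [← hd]
      exact fourier_fderiv_ofReal hgs hgc e ξ
    -- This is `ℓ = ℓ ∘ L(ξ) ∘ 𝔸[ξ]`, expanded in the basis of `W`.
    have h2 : ℓ = ∑ b, (ℓ (L ξ (w b))) • (κ b).comp (symbol A ξ) := by
      ext v
      conv_lhs => rw [← hLi ξ hξ v, ← w.sum_repr (symbol A ξ v)]
      simp only [map_sum, map_smul, sum_apply, smul_apply,
        ContinuousLinearMap.comp_apply, smul_eq_mul, κ, LinearMap.coe_toContinuousLinearMap',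
        Module.Basis.coord_apply]
      exact Finset.sum_congr rfl fun b _ => mul_comm _ _
    rw [h1]
    conv_lhs => rw [h2]
    rw [map_sum, Finset.mul_sum]
    refine Finset.sum_congr rfl fun b _ => ?_
    rw [hf]
    simp only
    rw [fourier_applyGrad_component hφ hc A (κ b) ξ, map_smul, Complex.real_smul]
    simp only [M, if_neg hξ]
    push_cast
    ring
  have hp0 : 0 < p := by linarith
  set ψ : E n → ℝ := fun x => dualPow p (F x) with hψ
  have hψc : Continuous ψ := (continuous_dualPow hp).comp hFs.continuous
  have hψb : IsBddSupp ψ := isBddSupp_of_continuous hψc (hFc.comp_left (g := dualPow p) (dualPow_zero p))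
  have hFL : MemLp F (ENNReal.ofReal p) volume := hFs.continuous.memLp_of_hasCompactSupport hFc
  refine (eLpNorm_le_of_integral_mul_dualPow_le hpq hFL
    (C := ∑ b, C b * eLpNorm (f b) (ENNReal.ofReal p) volume) ?_).trans ?_
  · have hae : ∀ᵐ ξ : E n, ξ ≠ 0 := by
      have : Nontrivial (E n) := by
        have : Nonempty (Fin n) := ⟨⟨0, Nat.pos_of_ne_zero hn⟩⟩
        infer_instance
      rw [ae_iff]; simp
    have h1 : ((∫ x, F x * ψ x : ℝ) : ℂ) = ∑ b, ∫ ξ, (M b ξ : ℂ) *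
        (𝓕 (fun x => (f b x : ℂ)) ξ * 𝓕⁻ (fun x => (ψ x : ℂ)) ξ) := by
      rw [← integral_complex_ofReal, ← integral_finsetSum]
      · have h2 : (fun x => ((F x * ψ x : ℝ) : ℂ)) = fun x =>
            𝓕⁻ (𝓕 fun x => (F x : ℂ)) x * (ψ x : ℂ) := by
          funext x
          rw [← fourierInv_fourier_of_test hFs hFc x, Complex.ofReal_mul]
        rw [h2]
        refine (integral_fourierInv_mul_eq_flip (integrable_fourier_of_test hFs hFc)
          (u := fun x => (ψ x : ℂ)) hψb.integrable.ofReal).trans ?_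
        refine integral_congr_ae ?_
        filter_upwards [hae] with ξ hξ
        rw [hfour ξ hξ, Finset.sum_mul]
        exact Finset.sum_congr rfl fun b _ => mul_assoc _ _ _
      · exact fun b _ => integrable_homogeneous_mul (hM b) (hM0 b) hn
          (hψb.integrable_fourier_mul (hfs b) (hfc b))
    calc ENNReal.ofReal (∫ x, F x * ψ x) ≤ ‖((∫ x, F x * ψ x : ℝ) : ℂ)‖ₑ := by
          rw [← ofReal_norm, Complex.norm_real]
          exact ENNReal.ofReal_le_ofReal (le_abs_self _)
      _ ≤ ∑ b, C b * (eLpNorm (f b) (ENNReal.ofReal p) volume *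
            eLpNorm ψ (ENNReal.ofReal q) volume) := by
          rw [h1]
          refine (enorm_sum_le _ _).trans (Finset.sum_le_sum fun b _ => ?_)
          exact hCb b (f b) ψ (hfs b) (hfc b) hψb
      _ = _ := by
          rw [Finset.sum_mul]
          exact Finset.sum_congr rfl fun b _ => (mul_assoc _ _ _).symm
  · rw [Finset.sum_mul]
    refine Finset.sum_le_sum fun b _ => ?_
    rw [mul_assoc]
    gcongr
    exact eLpNorm_le_mul_eLpNorm_of_ae_le_mul
      (Filter.Eventually.of_forall fun x => (κ b).le_opNorm _) _

theorem exists_eLpNorm_fderiv_le [FiniteDimensional ℝ V] [FiniteDimensional ℝ W]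
    {A : Fin n → V →L[ℝ] W} (hA : IsRElliptic A) {p : ℝ} (hp : 1 < p) :
    ∃ C : ℝ≥0∞, C ≠ ⊤ ∧ ∀ φ : E n → V, ContDiff ℝ ∞ φ → HasCompactSupport φ →
      eLpNorm (fderiv ℝ φ) (ENNReal.ofReal p) volume ≤
        C * eLpNorm (fun x => applyGrad A (fderiv ℝ φ x)) (ENNReal.ofReal p) volume := by
  rcases eq_or_ne n 0 with rfl | hn
  -- On a zero-dimensional space all gradients vanish.
  · refine ⟨0, ENNReal.zero_ne_top, fun φ _ _ => ?_⟩
    have h0 : ∀ x, fderiv ℝ φ x = 0 := by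
      intro x
      ext v
      rw [Subsingleton.elim v 0, map_zero, map_zero]
    refine (eLpNorm_mono_real (g := fun _ => (0 : ℝ)) fun x => ?_).trans ?_
    · rw [h0 x, norm_zero]
    · rw [eLpNorm_zero']; exact zero_le
  let v := Module.finBasis ℝ V
  let ℓ : Fin (Module.finrank ℝ V) → V →L[ℝ] ℝ := fun a => (v.coord a).toContinuousLinearMap
  choose C hC hCb using fun (z : Fin n × Fin (Module.finrank ℝ V)) =>
    exists_eLpNorm_fderiv_component_le hn hA hp (ℓ z.2) (EuclideanSpace.single z.1 1)
  let T : Fin n × Fin (Module.finrank ℝ V) → E n →L[ℝ] V := fun z =>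
    (EuclideanSpace.proj (𝕜 := ℝ) z.1).smulRight (v z.2)
  refine ⟨∑ z, ENNReal.ofReal ‖T z‖ * C z, ENNReal.sum_ne_top.mpr fun z _ =>
    ENNReal.mul_ne_top ENNReal.ofReal_ne_top (hC z), fun φ hφ hc => ?_⟩
  have hdφ : ContDiff ℝ ∞ (fderiv ℝ φ) := hφ.fderiv_right (by simp)
  have hdec : ∀ x, fderiv ℝ φ x = ∑ z,
      (ℓ z.2 (fderiv ℝ φ x (EuclideanSpace.single z.1 1))) • T z := by
    intro x
    ext y
    have h1 : y = ∑ j, y j • EuclideanSpace.single j (1 : ℝ) := by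
      have := (EuclideanSpace.basisFun (Fin n) ℝ).sum_repr y
      simpa using this.symm
    conv_lhs => rw [h1]
    rw [map_sum, sum_apply, Fintype.sum_prod_type]
    refine Finset.sum_congr rfl fun j _ => ?_
    rw [map_smul]
    conv_lhs => rw [← v.sum_repr (fderiv ℝ φ x (EuclideanSpace.single j 1)), Finset.smul_sum]
    refine Finset.sum_congr rfl fun a _ => ?_
    simp only [T, ℓ, smul_apply, ContinuousLinearMap.smulRight_apply,
      LinearMap.coe_toContinuousLinearMap', Module.Basis.coord_apply]
    exact smul_comm _ _ _
  have hcomp : ∀ z : Fin n × Fin (Module.finrank ℝ V), Continuous fun x =>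
      ℓ z.2 (fderiv ℝ φ x (EuclideanSpace.single z.1 1)) := fun z =>
    (ℓ z.2).continuous.comp (hdφ.clm_apply contDiff_const).continuous
  have hbound : ∀ x, ‖fderiv ℝ φ x‖ ≤ ∑ z,
      ‖T z‖ * ‖ℓ z.2 (fderiv ℝ φ x (EuclideanSpace.single z.1 1))‖ := by
    intro x
    conv_lhs => rw [hdec x]
    refine (norm_sum_le _ _).trans (le_of_eq (Finset.sum_congr rfl fun z _ => ?_))
    rw [norm_smul, mul_comm]
  have hsum : (fun x => ∑ z, ‖T z‖ * ‖ℓ z.2 (fderiv ℝ φ x (EuclideanSpace.single z.1 1))‖) =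
      ∑ z, fun x => ‖T z‖ * ‖ℓ z.2 (fderiv ℝ φ x (EuclideanSpace.single z.1 1))‖ := by
    funext x; rw [Finset.sum_apply]
  refine (eLpNorm_mono_real hbound).trans ?_
  rw [hsum]
  refine (eLpNorm_sum_le (fun z _ => ((hcomp z).norm.const_mul _).aestronglyMeasurable)
    (by simpa using hp.le)).trans ?_
  rw [Finset.sum_mul]
  refine Finset.sum_le_sum fun z _ => ?_
  refine (eLpNorm_le_mul_eLpNorm_of_ae_le_mul (c := ‖T z‖)
    (Filter.Eventually.of_forall fun x => ?_) _).trans ((mul_le_mul_right (hCb z φ hφ hc) _).trans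
      (le_of_eq (mul_assoc _ _ _).symm))
  rw [norm_mul, norm_norm, norm_norm]

end Korn

/-! ### Weak gradients -/

section WeakGradient

variable {n : ℕ} {V : Type*} [NormedAddCommGroup V] [NormedSpace ℝ V] {Ω : Set (E n)}

theorem eLpNorm_smul_add_smul_sub_le {α F : Type*} [MeasurableSpace α] {μ : Measure α}
    [NormedAddCommGroup F] [NormedSpace ℝ F] {f f' h h' : α → F} {p : ℝ≥0∞} (hp : 1 ≤ p)
    (hf : AEStronglyMeasurable f μ) (hf' : AEStronglyMeasurable f' μ)
    (hh : AEStronglyMeasurable h μ) (hh' : AEStronglyMeasurable h' μ) (a b : ℝ) :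
    eLpNorm (fun x => (a • f x + b • f' x) - (a • h x + b • h' x)) p μ ≤
      ‖a‖ₑ * eLpNorm (fun x => f x - h x) p μ + ‖b‖ₑ * eLpNorm (fun x => f' x - h' x) p μ := by
  have h1 : (fun x => (a • f x + b • f' x) - (a • h x + b • h' x)) =
      (a • fun x => f x - h x) + (b • fun x => f' x - h' x) := by
    funext x
    simp only [Pi.add_apply, Pi.smul_apply, smul_sub]
    abel
  rw [h1]
  refine (eLpNorm_add_le ((hf.sub hh).const_smul a) ((hf'.sub hh').const_smul b) hp).trans ?_
  rw [eLpNorm_const_smul, eLpNorm_const_smul]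
  rfl

theorem integrableOn_smul_of_tsupport_subset {F : Type*} [NormedAddCommGroup F] [NormedSpace ℝ F]
    {f : E n → F} (hf : LocallyIntegrableOn f Ω) (hΩ : IsOpen Ω) {k : E n → ℝ} (hk : Continuous k)
    (hc : HasCompactSupport k) (hs : tsupport k ⊆ Ω) :
    IntegrableOn (fun x => k x • f x) Ω := by
  have h1 : IntegrableOn f (tsupport k) := hf.integrableOn_compact_subset hs hc
  have h2 : IntegrableOn (fun x => k x • f x) (tsupport k) :=
    h1.continuousOn_smul hk.continuousOn hc
  exact h2.of_forall_sdiff_eq_zero hΩ.measurableSet fun x hx => by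
    rw [image_eq_zero_of_notMem_tsupport hx.2, zero_smul]

theorem IsTest.fderiv_apply {φ : E n → V} (hφ : IsTest Ω φ) (e : E n) :
    IsTest Ω fun x => fderiv ℝ φ x e where
  contDiff := (hφ.contDiff.fderiv_right (by simp)).clm_apply contDiff_const
  hasCompactSupport := hφ.hasCompactSupport.fderiv_apply (𝕜 := ℝ) e
  tsupport_subset := (tsupport_fderiv_apply_subset ℝ e).trans hφ.tsupport_subset

theorem IsTest.smul_add_smul {φ ψ : E n → V} (hφ : IsTest Ω φ) (hψ : IsTest Ω ψ) (a b : ℝ) :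
    IsTest Ω fun x => a • φ x + b • ψ x where
  contDiff := (contDiff_const.smul hφ.contDiff).add (contDiff_const.smul hψ.contDiff)
  hasCompactSupport := (hφ.hasCompactSupport.smul_left (f := fun _ => a)).add
    (hψ.hasCompactSupport.smul_left (f := fun _ => b))
  tsupport_subset := by
    refine (tsupport_add _ _).trans (Set.union_subset ?_ ?_)
    · exact (tsupport_smul_subset_right (fun _ => a) φ).trans hφ.tsupport_subset
    · exact (tsupport_smul_subset_right (fun _ => b) ψ).trans hψ.tsupport_subset

theorem IsTest.integrableOn_smul {F : Type*} [NormedAddCommGroup F] [NormedSpace ℝ F]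
    {f : E n → F} (hf : LocallyIntegrableOn f Ω) (hΩ : IsOpen Ω) {φ : E n → ℝ} (hφ : IsTest Ω φ) :
    IntegrableOn (fun x => φ x • f x) Ω :=
  integrableOn_smul_of_tsupport_subset hf hΩ hφ.contDiff.continuous hφ.hasCompactSupport
    hφ.tsupport_subset

theorem _root_.MeasureTheory.LocallyIntegrableOn.clm_apply_const {D : E n → E n →L[ℝ] V}
    (hD : LocallyIntegrableOn D Ω) (e : E n) : LocallyIntegrableOn (fun x => D x e) Ω := by
  intro x hx
  obtain ⟨s, hs, hi⟩ := hD x hx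
  exact ⟨s, hs, (ContinuousLinearMap.apply ℝ V e).integrable_comp hi⟩

theorem IsWeakGrad.smul_add_smul (hΩ : IsOpen Ω) {u v : E n → V} {D F : E n → E n →L[ℝ] V}
    (hu : IsWeakGrad Ω u D) (hv : IsWeakGrad Ω v F) (a b : ℝ) :
    IsWeakGrad Ω (fun x => a • u x + b • v x) (fun x => a • D x + b • F x) where
  locallyIntegrableOn := (hu.1.smul a).add (hv.1.smul b)
  locallyIntegrableOn_grad := (hu.2.smul a).add (hv.2.smul b)
  integral_eq φ hφ e := by
    have key : ∀ {k : E n → ℝ} (hk : IsTest Ω k) {f h : E n → V}, LocallyIntegrableOn f Ω →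
        LocallyIntegrableOn h Ω → ∫ x in Ω, k x • (a • f x + b • h x) =
          a • (∫ x in Ω, k x • f x) + b • ∫ x in Ω, k x • h x := by
      intro k hk f h hf hh
      have h1 : IntegrableOn (fun x => a • k x • f x) Ω := (hk.integrableOn_smul hf hΩ).smul a
      have h2 : IntegrableOn (fun x => b • k x • h x) Ω := (hk.integrableOn_smul hh hΩ).smul b
      rw [← integral_smul, ← integral_smul, ← integral_add h1 h2]
      refine integral_congr_ae (Filter.Eventually.of_forall fun x => ?_)
      simp only [smul_add]
      rw [smul_comm (k x) a, smul_comm (k x) b]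
    rw [key (hφ.fderiv_apply e) hu.1 hv.1, hu.3 φ hφ e, hv.3 φ hφ e]
    have := key hφ (hu.2.clm_apply_const e) (hv.2.clm_apply_const e)
    simp only [add_apply, smul_apply]
    rw [this]
    simp only [smul_neg]
    abel

/-- The fundamental lemma of the calculus of variations for the operator-valued difference. It makes
the chosen `weakGrad` independent of the choice up to null sets. -/
theorem IsWeakGrad.ae_eq [CompleteSpace V] (hΩ : IsOpen Ω) {u : E n → V}
    {D F : E n → E n →L[ℝ] V}
    (hD : IsWeakGrad Ω u D) (hF : IsWeakGrad Ω u F) : D =ᵐ[volume.restrict Ω] F := by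
  have h1 : LocallyIntegrableOn (fun x => D x - F x) Ω := hD.2.sub hF.2
  have h2 := hΩ.ae_eq_zero_of_integral_contDiff_smul_eq_zero (μ := volume) h1
    fun k hk hc hs => by
      have ht : IsTest Ω k := ⟨hk, hc, hs⟩
      have hi := ht.integrableOn_smul h1 hΩ
      have h3 : ∫ x in Ω, k x • (D x - F x) = ∫ x, k x • (D x - F x) :=
        setIntegral_eq_integral_of_forall_compl_eq_zero fun x hx => by
          rw [image_eq_zero_of_notMem_tsupport fun h => hx (hs h), zero_smul]
      rw [← h3]
      ext e
      rw [ContinuousLinearMap.integral_apply hi, zero_apply]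
      have h4 := (hD.3 k ht e).symm.trans (hF.3 k ht e)
      rw [neg_inj] at h4
      simp only [smul_apply, sub_apply, smul_sub]
      rw [integral_sub (ht.integrableOn_smul (hD.2.clm_apply_const e) hΩ)
        (ht.integrableOn_smul (hF.2.clm_apply_const e) hΩ), h4, sub_self]
  rw [Filter.EventuallyEq, ae_restrict_iff' hΩ.measurableSet]
  filter_upwards [h2] with x hx hxΩ
  exact sub_eq_zero.mp (hx hxΩ)

theorem IsWeakGrad.weakGrad_ae_eq [CompleteSpace V] (hΩ : IsOpen Ω) {u : E n → V}
    {D : E n → E n →L[ℝ] V} (hD : IsWeakGrad Ω u D) : weakGrad Ω u =ᵐ[volume.restrict Ω] D :=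
  (weakGrad_spec ⟨D, hD⟩).ae_eq hΩ hD

theorem tendsto_setIntegral_smul {F : Type*} [NormedAddCommGroup F] [NormedSpace ℝ F]
    {f : ℕ → E n → F} {f' : E n → F} (hf : ∀ k, IntegrableOn (f k) Ω)
    (hf' : IntegrableOn f' Ω)
    (h : Filter.Tendsto (fun k => eLpNorm (fun x => f k x - f' x) 1 (volume.restrict Ω))
      Filter.atTop (nhds 0)) {φ : E n → ℝ} (hφ : Continuous φ) (hc : HasCompactSupport φ) :
    Filter.Tendsto (fun k => ∫ x in Ω, φ x • f k x) Filter.atTop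
      (nhds (∫ x in Ω, φ x • f' x)) := by
  obtain ⟨B, hB⟩ := hφ.bounded_above_of_compact_support hc
  have hint : ∀ {w : E n → F}, IntegrableOn w Ω → IntegrableOn (fun x => φ x • w x) Ω :=
    fun {w} hw => hw.bdd_smul B hφ.aestronglyMeasurable (Filter.Eventually.of_forall hB)
  refine tendsto_integral_of_L1' _ (hint hf').1 (Filter.Eventually.of_forall fun k => hint (hf k)) ?_
  have h0 := ENNReal.Tendsto.const_mul h (Or.inr (ENNReal.ofReal_ne_top (r := B)))
  rw [mul_zero] at h0
  refine tendsto_of_tendsto_of_tendsto_of_le_of_le tendsto_const_nhds h0 (fun _ => zero_le)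
    fun k => ?_
  refine eLpNorm_le_mul_eLpNorm_of_ae_le_mul (Filter.Eventually.of_forall fun x => ?_) 1
  simp only [Pi.sub_apply]
  rw [← smul_sub, norm_smul]
  exact mul_le_mul_of_nonneg_right (hB x) (norm_nonneg _)

theorem isWeakGrad_of_tendsto {u : ℕ → E n → V} {u' : E n → V}
    {D : ℕ → E n → E n →L[ℝ] V} {D' : E n → E n →L[ℝ] V}
    (hD : ∀ k, IsWeakGrad Ω (u k) (D k)) (hu : ∀ k, IntegrableOn (u k) Ω)
    (hDi : ∀ k, IntegrableOn (D k) Ω) (hu' : IntegrableOn u' Ω) (hD' : IntegrableOn D' Ω)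
    (h : Filter.Tendsto (fun k => eLpNorm (fun x => u k x - u' x) 1 (volume.restrict Ω))
      Filter.atTop (nhds 0))
    (h' : Filter.Tendsto (fun k => eLpNorm (fun x => D k x - D' x) 1 (volume.restrict Ω))
      Filter.atTop (nhds 0)) : IsWeakGrad Ω u' D' where
  locallyIntegrableOn := hu'.locallyIntegrableOn
  locallyIntegrableOn_grad := hD'.locallyIntegrableOn
  integral_eq φ hφ e := by
    have h1 := tendsto_setIntegral_smul hu hu' h (hφ.fderiv_apply e).contDiff.continuous
      (hφ.fderiv_apply e).hasCompactSupport
    have h2 : Filter.Tendsto (fun k => eLpNorm (fun x => D k x e - D' x e) 1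
        (volume.restrict Ω)) Filter.atTop (nhds 0) := by
      have h0 := ENNReal.Tendsto.const_mul h' (Or.inr (ENNReal.ofReal_ne_top (r := ‖e‖)))
      rw [mul_zero] at h0
      refine tendsto_of_tendsto_of_tendsto_of_le_of_le tendsto_const_nhds h0 (fun _ => zero_le)
        fun k => ?_
      refine eLpNorm_le_mul_eLpNorm_of_ae_le_mul (Filter.Eventually.of_forall fun x => ?_) 1
      rw [← sub_apply, mul_comm]
      exact ContinuousLinearMap.le_opNorm _ _
    have h3 := tendsto_setIntegral_smul
      (fun k => (ContinuousLinearMap.apply ℝ V e).integrable_comp (hDi k))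
      ((ContinuousLinearMap.apply ℝ V e).integrable_comp hD') h2 hφ.contDiff.continuous
      hφ.hasCompactSupport
    refine tendsto_nhds_unique h1 ?_
    simp only [fun k => (hD k).3 φ hφ e]
    exact h3.neg

end WeakGradient

/-! ### Sobolev functions with zero boundary values -/

section SobolevZero

variable {n : ℕ} {V W : Type*} [NormedAddCommGroup V] [NormedSpace ℝ V]
  [NormedAddCommGroup W] [NormedSpace ℝ W] {Ω : Set (E n)} {p : ℝ≥0∞}

theorem IsTest.aestronglyMeasurable {φ : E n → V} (hφ : IsTest Ω φ) {μ : Measure (E n)} :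
    AEStronglyMeasurable φ μ :=
  hφ.contDiff.continuous.aestronglyMeasurable

theorem IsTest.aestronglyMeasurable_fderiv {φ : E n → V} (hφ : IsTest Ω φ) {μ : Measure (E n)} :
    AEStronglyMeasurable (fderiv ℝ φ) μ :=
  (hφ.contDiff.fderiv_right (m := ∞) (by simp)).continuous.aestronglyMeasurable

theorem MemW1.smul_add_smul [CompleteSpace V] (hΩ : IsOpen Ω) {u v : E n → V}
    (hu : MemW1 Ω p u) (hv : MemW1 Ω p v) (a b : ℝ) :
    MemW1 Ω p (fun x => a • u x + b • v x) ∧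
      weakGrad Ω (fun x => a • u x + b • v x) =ᵐ[volume.restrict Ω]
        fun x => a • weakGrad Ω u x + b • weakGrad Ω v x := by
  have h1 := (weakGrad_spec hu.1).smul_add_smul hΩ (weakGrad_spec hv.1) a b
  have h2 := h1.weakGrad_ae_eq hΩ
  exact ⟨⟨⟨_, h1⟩, (hu.2.const_smul a).add (hv.2.const_smul b),
    ((hu.3.const_smul a).add (hv.3.const_smul b)).ae_eq h2.symm⟩, h2⟩

theorem MemW10.smul_add_smul [CompleteSpace V] (hΩ : IsOpen Ω) (hp : 1 ≤ p) {u v : E n → V}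
    (hu : MemW10 Ω p u) (hv : MemW10 Ω p v) (a b : ℝ) :
    MemW10 Ω p (fun x => a • u x + b • v x) := by
  obtain ⟨h1, h2⟩ := hu.1.smul_add_smul hΩ hv.1 a b
  refine ⟨h1, fun ε hε => ?_⟩
  obtain ⟨δ, hδ, hδε⟩ := ENNReal.exists_nnreal_pos_mul_lt (a := ‖a‖ₑ + ‖b‖ₑ)
    (ENNReal.add_ne_top.mpr ⟨enorm_ne_top, enorm_ne_top⟩) hε.ne'
  obtain ⟨φ, hφ, hφ1, hφ2⟩ := hu.2 δ (by exact_mod_cast hδ)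
  obtain ⟨ψ, hψ, hψ1, hψ2⟩ := hv.2 δ (by exact_mod_cast hδ)
  have hb : ∀ {s t : ℝ≥0∞}, s < δ → t < δ → ‖a‖ₑ * s + ‖b‖ₑ * t < ε := by
    intro s t hs ht
    refine lt_of_le_of_lt ?_ hδε
    rw [mul_add, mul_comm _ ‖a‖ₑ, mul_comm _ ‖b‖ₑ]
    gcongr
  refine ⟨_, hφ.smul_add_smul hψ a b, (eLpNorm_smul_add_smul_sub_le hp hu.1.2.1 hv.1.2.1
    hφ.aestronglyMeasurable hψ.aestronglyMeasurable a b).trans_lt (hb hφ1 hψ1), ?_⟩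
  have h3 : (fun x => weakGrad Ω (fun x => a • u x + b • v x) x -
      fderiv ℝ (fun x => a • φ x + b • ψ x) x) =ᵐ[volume.restrict Ω]
      fun x => (a • weakGrad Ω u x + b • weakGrad Ω v x) -
        (a • fderiv ℝ φ x + b • fderiv ℝ ψ x) := by
    filter_upwards [h2] with x hx
    have d1 : DifferentiableAt ℝ φ x := hφ.contDiff.differentiable (by simp) x
    have d2 : DifferentiableAt ℝ ψ x := hψ.contDiff.differentiable (by simp) x
    rw [hx, fderiv_fun_add (d1.fun_const_smul a) (d2.fun_const_smul b), fderiv_fun_const_smul d1,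
      fderiv_fun_const_smul d2]
  rw [eLpNorm_congr_ae h3]
  exact (eLpNorm_smul_add_smul_sub_le hp hu.1.3.1 hv.1.3.1 hφ.aestronglyMeasurable_fderiv
    hψ.aestronglyMeasurable_fderiv a b).trans_lt (hb hφ2 hψ2)

theorem tendsto_eLpNorm_one {α F : Type*} [MeasurableSpace α] {μ : Measure α} [IsFiniteMeasure μ]
    [NormedAddCommGroup F] {f : ℕ → α → F} (hp : 1 ≤ p)
    (hf : ∀ k, AEStronglyMeasurable (f k) μ)
    (h : Filter.Tendsto (fun k => eLpNorm (f k) p μ) Filter.atTop (nhds 0)) :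
    Filter.Tendsto (fun k => eLpNorm (f k) 1 μ) Filter.atTop (nhds 0) := by
  have hT : μ Set.univ ^ (1 / (1 : ℝ≥0∞).toReal - 1 / p.toReal) ≠ ⊤ := by
    refine ENNReal.rpow_ne_top_of_nonneg ?_ (measure_ne_top μ _)
    rcases eq_or_ne p ⊤ with hp' | hp'
    · simp [hp']
    · have : 1 ≤ p.toReal := by
        simpa using (ENNReal.toReal_le_toReal ENNReal.one_ne_top hp').mpr hp
      simp only [ENNReal.toReal_one, div_one, one_div, sub_nonneg]
      exact inv_le_one_of_one_le₀ this
  have h0 := ENNReal.Tendsto.mul_const h (Or.inr hT)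
  rw [zero_mul] at h0
  exact tendsto_of_tendsto_of_tendsto_of_le_of_le tendsto_const_nhds h0 (fun _ => zero_le)
    fun k => eLpNorm_le_eLpNorm_mul_rpow_measure_univ hp (hf k)

theorem eLpNorm_sub_le_add_sub {α F : Type*} [MeasurableSpace α] {μ : Measure α}
    [NormedAddCommGroup F] {f g h : α → F} (hp : 1 ≤ p) (hf : AEStronglyMeasurable f μ)
    (hg : AEStronglyMeasurable g μ) (hh : AEStronglyMeasurable h μ) :
    eLpNorm (fun x => f x - h x) p μ ≤
      eLpNorm (fun x => g x - f x) p μ + eLpNorm (fun x => g x - h x) p μ := by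
  have h1 : (fun x => f x - h x) = (fun x => g x - h x) - fun x => g x - f x := by
    funext x; simp
  rw [h1, add_comm]
  exact eLpNorm_sub_le (hg.sub hh) (hg.sub hf) hp

/-- On a bounded set `L^p` convergence implies `L¹` convergence, under which the weak gradient
identity passes to the limit. Test functions close to `v k` are then close to the limit. -/
theorem memW10_of_tendsto [CompleteSpace V] (hΩ : IsOpen Ω) (hΩb : Bornology.IsBounded Ω)
    (hp : 1 ≤ p) {v : ℕ → E n → V} {v' : E n → V} {F : E n → E n →L[ℝ] V}
    (hv : ∀ k, MemW10 Ω p (v k)) (hv' : MemLp v' p (volume.restrict Ω))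
    (hF : MemLp F p (volume.restrict Ω))
    (h : Filter.Tendsto (fun k => eLpNorm (fun x => v k x - v' x) p (volume.restrict Ω))
      Filter.atTop (nhds 0))
    (h' : Filter.Tendsto (fun k => eLpNorm (fun x => weakGrad Ω (v k) x - F x) p
      (volume.restrict Ω)) Filter.atTop (nhds 0)) :
    MemW10 Ω p v' ∧ weakGrad Ω v' =ᵐ[volume.restrict Ω] F := by
  have : IsFiniteMeasure (volume.restrict Ω : Measure (E n)) :=
    ⟨by rw [Measure.restrict_apply_univ]; exact hΩb.measure_lt_top⟩
  have hw : IsWeakGrad Ω v' F := isWeakGrad_of_tendsto (fun k => weakGrad_spec (hv k).1.1)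
    (fun k => (hv k).1.2.integrable hp) (fun k => (hv k).1.3.integrable hp) (hv'.integrable hp)
    (hF.integrable hp) (tendsto_eLpNorm_one hp (fun k => (hv k).1.2.1.sub hv'.1) h)
    (tendsto_eLpNorm_one hp (fun k => (hv k).1.3.1.sub hF.1) h')
  have hae := hw.weakGrad_ae_eq hΩ
  refine ⟨⟨⟨⟨_, hw⟩, hv', hF.ae_eq hae.symm⟩, fun ε hε => ?_⟩, hae⟩
  have hε2 : 0 < ε / 2 := ENNReal.half_pos hε.ne'
  obtain ⟨k, hk1, hk2⟩ := ((h.eventually_lt_const hε2).and (h'.eventually_lt_const hε2)).exists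
  obtain ⟨φ, hφ, hφ1, hφ2⟩ := (hv k).2 _ hε2
  refine ⟨φ, hφ, (eLpNorm_sub_le_add_sub hp hv'.1 (hv k).1.2.1
    hφ.aestronglyMeasurable).trans_lt ?_, ?_⟩
  · exact (ENNReal.add_lt_add hk1 hφ1).trans_eq (ENNReal.add_halves ε)
  · rw [eLpNorm_congr_ae (g := fun x => F x - fderiv ℝ φ x)
      (hae.mono fun x hx => by simp only [hx])]
    exact (eLpNorm_sub_le_add_sub hp hF.1 (hv k).1.3.1
      hφ.aestronglyMeasurable_fderiv).trans_lt
        ((ENNReal.add_lt_add hk2 hφ2).trans_eq (ENNReal.add_halves ε))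

/-- `applyGrad A` as a continuous linear map. -/
noncomputable def applyGradL (A : Fin n → V →L[ℝ] W) : (E n →L[ℝ] V) →L[ℝ] W :=
  ∑ α, (A α).comp (ContinuousLinearMap.apply ℝ V (EuclideanSpace.single α 1))

theorem applyGradL_apply (A : Fin n → V →L[ℝ] W) (D : E n →L[ℝ] V) :
    applyGradL A D = applyGrad A D := by
  rw [applyGradL, applyGrad, sum_apply]
  rfl

/-- Density principle: an estimate for approximants carries over, with an error `(1 + C K) ε`. It
transfers both Korn's and Poincaré's inequality from test functions to `W₀^{1,p}`. -/
theorem eLpNorm_restrict_le_of_approx {F G : Type*} [NormedAddCommGroup F] [NormedSpace ℝ F]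
    [NormedAddCommGroup G] [NormedSpace ℝ G] {μ : Measure (E n)} {f : E n → F} {g : E n → G}
    (hp : 1 ≤ p) (hf : AEStronglyMeasurable f μ) (hg : AEStronglyMeasurable g μ) {C K : ℝ≥0∞}
    (hC : C ≠ ⊤) (hK : K ≠ ⊤)
    (h : ∀ ε : ℝ≥0∞, 0 < ε → ∃ f' : E n → F, ∃ g' : E n → G, AEStronglyMeasurable f' μ ∧
      AEStronglyMeasurable g' μ ∧ eLpNorm (fun x => f x - f' x) p μ ≤ ε ∧
      eLpNorm (fun x => g x - g' x) p μ ≤ K * ε ∧ eLpNorm f' p μ ≤ C * eLpNorm g' p μ) :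
    eLpNorm f p μ ≤ C * eLpNorm g p μ := by
  have key : ∀ ε : ℝ≥0∞, 0 < ε → eLpNorm f p μ ≤ C * eLpNorm g p μ + (1 + C * K) * ε := by
    intro ε hε
    obtain ⟨f', g', hf', hg', h1, h2, h3⟩ := h ε hε
    have e1 : f = (fun x => f x - f' x) + f' := by funext x; simp
    have e2 : g' = g - (fun x => g x - g' x) := by funext x; simp
    have i1 : eLpNorm f p μ ≤ ε + eLpNorm f' p μ := by
      conv_lhs => rw [e1]
      exact (eLpNorm_add_le (hf.sub hf') hf' hp).trans (add_le_add_left h1 _)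
    have i2 : eLpNorm g' p μ ≤ eLpNorm g p μ + K * ε := by
      conv_lhs => rw [e2]
      exact (eLpNorm_sub_le hg (hg.sub hg') hp).trans (add_le_add_right h2 _)
    calc eLpNorm f p μ ≤ ε + C * (eLpNorm g p μ + K * ε) :=
          i1.trans (by gcongr; exact h3.trans (by gcongr))
      _ = C * eLpNorm g p μ + (1 + C * K) * ε := by ring
  have hT : 1 + C * K ≠ ⊤ := ENNReal.add_ne_top.mpr ⟨ENNReal.one_ne_top, ENNReal.mul_ne_top hC hK⟩
  refine ENNReal.le_of_forall_pos_le_add fun ε hε _ => ?_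
  obtain ⟨δ, hδ, hδε⟩ := ENNReal.exists_nnreal_pos_mul_lt (a := 1 + C * K) (b := ε) hT
    (by exact_mod_cast hε.ne')
  refine (key δ (by exact_mod_cast hδ)).trans ?_
  rw [mul_comm (1 + C * K)]
  gcongr

theorem eLpNorm_restrict_eq_of_tsupport {F : Type*} [NormedAddCommGroup F] {f : E n → F}
    (h : tsupport f ⊆ Ω) (p : ℝ≥0∞) :
    eLpNorm f p (volume.restrict Ω) = eLpNorm f p volume :=
  eLpNorm_restrict_eq_of_support_subset ((subset_tsupport f).trans h)

theorem exists_eLpNorm_weakGrad_le [FiniteDimensional ℝ V] [FiniteDimensional ℝ W]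
    {A : Fin n → V →L[ℝ] W} (hA : IsRElliptic A) {p : ℝ} (hp : 1 < p) (Ω : Set (E n)) :
    ∃ C : ℝ≥0∞, C ≠ ⊤ ∧ ∀ v : E n → V, MemW10 Ω (ENNReal.ofReal p) v →
      eLpNorm (weakGrad Ω v) (ENNReal.ofReal p) (volume.restrict Ω) ≤
        C * eLpNorm (fun x => applyGrad A (weakGrad Ω v x)) (ENNReal.ofReal p)
          (volume.restrict Ω) := by
  obtain ⟨C, hC, hCb⟩ := exists_eLpNorm_fderiv_le hA hp
  refine ⟨C, hC, fun v hv => ?_⟩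
  have hp1 : 1 ≤ ENNReal.ofReal p := by simpa using hp.le
  simp only [← applyGradL_apply]
  have hm : ∀ {D : E n → E n →L[ℝ] V}, AEStronglyMeasurable D (volume.restrict Ω) →
      AEStronglyMeasurable (fun x => applyGradL A (D x)) (volume.restrict Ω) :=
    fun hD => (applyGradL A).continuous.comp_aestronglyMeasurable hD
  refine eLpNorm_restrict_le_of_approx (K := ENNReal.ofReal ‖applyGradL A‖) hp1 hv.1.3.1
    (hm hv.1.3.1) hC ENNReal.ofReal_ne_top fun ε hε => ?_
  obtain ⟨φ, hφ, h1, h2⟩ := hv.2 ε hε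
  refine ⟨fderiv ℝ φ, fun x => applyGradL A (fderiv ℝ φ x), hφ.aestronglyMeasurable_fderiv,
    hm hφ.aestronglyMeasurable_fderiv, h2.le, ?_, ?_⟩
  · refine (eLpNorm_le_mul_eLpNorm_of_ae_le_mul (c := ‖applyGradL A‖)
      (g := fun x => weakGrad Ω v x - fderiv ℝ φ x)
      (Filter.Eventually.of_forall fun x => ?_) _).trans (mul_le_mul_right h2.le _)
    rw [← map_sub]
    exact (applyGradL A).le_opNorm _
  · have hs : tsupport (fderiv ℝ φ) ⊆ Ω := (tsupport_fderiv_subset ℝ).trans hφ.tsupport_subset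
    have hs' : tsupport (fun x => applyGradL A (fderiv ℝ φ x)) ⊆ Ω :=
      (tsupport_comp_subset (map_zero (applyGradL A)) _).trans hs
    rw [eLpNorm_restrict_eq_of_tsupport hs, eLpNorm_restrict_eq_of_tsupport hs']
    simp only [applyGradL_apply]
    exact hCb φ hφ.contDiff hφ.hasCompactSupport

end SobolevZero

/-! ### Poincaré's inequality -/

section Poincare

variable {n : ℕ} {V : Type*} [NormedAddCommGroup V] [NormedSpace ℝ V] {Ω : Set (E n)}

/-- If `R` exceeds the distance of any two points of `Ω`, then `x + R e` has left `Ω`, so `φ(x) =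
-∫₀ᴿ ∂_e φ(x + s e) ds`. Minkowski's inequality gives the constant `R`. -/
theorem exists_eLpNorm_le_eLpNorm_fderiv [CompleteSpace V] (hn : n ≠ 0)
    (hΩb : Bornology.IsBounded Ω) {p : ℝ} (hp : 1 < p) :
    ∃ C : ℝ≥0∞, C ≠ ⊤ ∧ ∀ φ : E n → V, IsTest Ω φ →
      eLpNorm φ (ENNReal.ofReal p) volume ≤
        C * eLpNorm (fderiv ℝ φ) (ENNReal.ofReal p) volume := by
  obtain ⟨R, hR0, hR⟩ : ∃ R : ℝ, 0 < R ∧ ∀ x ∈ Ω, ∀ y ∈ Ω, dist x y < R := by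
    obtain ⟨B, hB⟩ := Metric.isBounded_iff.mp hΩb
    exact ⟨|B| + 1, by positivity, fun x hx y hy =>
      (hB hx hy).trans_lt ((le_abs_self B).trans_lt (lt_add_one _))⟩
  let e : E n := EuclideanSpace.single ⟨0, Nat.pos_of_ne_zero hn⟩ 1
  have he : ‖e‖ = 1 := by simp [e]
  refine ⟨∫⁻ _ : ℝ, 1 ∂(volume.restrict (Set.Ioc 0 R)), by simp, fun φ hφ => ?_⟩
  have hc1 : Continuous (fderiv ℝ φ) := (hφ.contDiff.fderiv_right (m := ∞) (by simp)).continuous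
  have hjc : Continuous fun z : E n × ℝ => fderiv ℝ φ (z.1 + z.2 • e) := by fun_prop
  have hcore := eLpNorm_integral_smul_le (μ := (volume : Measure (E n)))
    (ν := volume.restrict (Set.Ioc 0 R)) hp
    (k := fun x s => fderiv ℝ φ (x + s • e) e) (κ := fun _ => 1)
    (G := fun x s => ‖fderiv ℝ φ (x + s • e)‖) measurable_const
    hjc.norm.measurable (fun x s => by
      rw [one_mul, enorm_norm, ← ofReal_norm, ← ofReal_norm]
      refine ENNReal.ofReal_le_ofReal ?_
      simpa [he] using (fderiv ℝ φ (x + s • e)).le_opNorm e)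
    (D := eLpNorm (fderiv ℝ φ) (ENNReal.ofReal p) volume) fun s => by
      rw [eLpNorm_norm (f := fun x => fderiv ℝ φ (x + s • e))]
      exact (eLpNorm_comp_measurePreserving (g := fderiv ℝ φ) hc1.aestronglyMeasurable
        (measurePreserving_add_right volume (s • e))).le
  refine le_trans (eLpNorm_mono_ae (Filter.Eventually.of_forall fun x => ?_)) hcore
  by_cases hx : x ∈ Ω
  · have hx' : x + R • e ∉ Ω := fun h => by
      have := hR _ h x hx
      rw [dist_eq_norm, add_sub_cancel_left, norm_smul, he, mul_one, Real.norm_eq_abs,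
        abs_of_pos hR0] at this
      exact lt_irrefl _ this
    have h0 : φ (x + R • e) = 0 :=
      image_eq_zero_of_notMem_tsupport fun h => hx' (hφ.tsupport_subset h)
    have hd : ∀ s ∈ Set.uIcc (0 : ℝ) R,
        HasDerivAt (fun s : ℝ => φ (x + s • e)) (fderiv ℝ φ (x + s • e) e) s := by
      intro s _
      have h1 : HasDerivAt (fun s : ℝ => x + s • e) e s := by
        simpa using ((hasDerivAt_id s).smul_const e).const_add x
      exact ((hφ.contDiff.differentiable (by simp) _).hasFDerivAt).comp_hasDerivAt s h1
    have hi : IntervalIntegrable (fun s : ℝ => fderiv ℝ φ (x + s • e) e) volume 0 R :=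
      Continuous.intervalIntegrable (by fun_prop) _ _
    have h2 := intervalIntegral.integral_eq_sub_of_hasDerivAt hd hi
    rw [intervalIntegral.integral_of_le hR0.le, h0, zero_smul, add_zero, zero_sub] at h2
    rw [h2, norm_neg]
  · rw [image_eq_zero_of_notMem_tsupport fun h => hx (hφ.tsupport_subset h), norm_zero]
    exact norm_nonneg _

theorem exists_eLpNorm_le_eLpNorm_weakGrad [CompleteSpace V] (hn : n ≠ 0)
    (hΩb : Bornology.IsBounded Ω) {p : ℝ} (hp : 1 < p) :
    ∃ C : ℝ≥0∞, C ≠ ⊤ ∧ ∀ v : E n → V, MemW10 Ω (ENNReal.ofReal p) v →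
      eLpNorm v (ENNReal.ofReal p) (volume.restrict Ω) ≤
        C * eLpNorm (weakGrad Ω v) (ENNReal.ofReal p) (volume.restrict Ω) := by
  obtain ⟨C, hC, hCb⟩ := exists_eLpNorm_le_eLpNorm_fderiv (V := V) hn hΩb hp
  refine ⟨C, hC, fun v hv => ?_⟩
  have hp1 : 1 ≤ ENNReal.ofReal p := by simpa using hp.le
  refine eLpNorm_restrict_le_of_approx (f := v) (g := weakGrad Ω v) (K := 1) hp1 hv.1.2.1 hv.1.3.1 hC
    ENNReal.one_ne_top ?_
  intro ε hε
  obtain ⟨φ, hφ, h1, h2⟩ := hv.2 ε hε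
  have h3 := hCb φ hφ
  have hs : tsupport (fderiv ℝ φ) ⊆ Ω := (tsupport_fderiv_subset ℝ).trans hφ.tsupport_subset
  rw [← eLpNorm_restrict_eq_of_tsupport hφ.tsupport_subset,
    ← eLpNorm_restrict_eq_of_tsupport hs] at h3
  rw [one_mul]
  exact ⟨φ, fderiv ℝ φ, hφ.aestronglyMeasurable, hφ.aestronglyMeasurable_fderiv, h1.le,
    h2.le, h3⟩

end Poincare

/-! ### Uniform convexity of the `p`-th power of a Hilbert norm -/

section UniformConvexity

variable {H : Type*} [NormedAddCommGroup H] [InnerProductSpace ℝ H]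

theorem norm_half_smul_add_rpow_le {p : ℝ} (hp : 1 < p) (x y : H) :
    ‖(1 / 2 : ℝ) • (x + y)‖ ^ p ≤ 1 / 2 * ‖x‖ ^ p + 1 / 2 * ‖y‖ ^ p := by
  have h1 : ‖(1 / 2 : ℝ) • (x + y)‖ ≤ 1 / 2 * ‖x‖ + 1 / 2 * ‖y‖ := by
    rw [norm_smul, ← mul_add, Real.norm_of_nonneg (by norm_num)]
    exact mul_le_mul_of_nonneg_left (norm_add_le _ _) (by norm_num)
  refine (Real.rpow_le_rpow (norm_nonneg _) h1 (by linarith)).trans ?_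
  have := (convexOn_rpow hp.le).2 (Set.mem_Ici.mpr (norm_nonneg x))
    (Set.mem_Ici.mpr (norm_nonneg y)) (by norm_num : (0 : ℝ) ≤ 1 / 2)
    (by norm_num : (0 : ℝ) ≤ 1 / 2) (by norm_num)
  simpa only [smul_eq_mul] using this

theorem norm_half_smul_add_rpow_lt {p : ℝ} (hp : 1 < p) {x y : H} (hxy : x ≠ y) :
    ‖(1 / 2 : ℝ) • (x + y)‖ ^ p < 1 / 2 * ‖x‖ ^ p + 1 / 2 * ‖y‖ ^ p := by
  rcases eq_or_ne ‖x‖ ‖y‖ with hn | hn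
  · have h1 : ‖(1 / 2 : ℝ) • x + (1 / 2 : ℝ) • y‖ < ‖x‖ :=
      norm_combo_lt_of_ne le_rfl hn.ge hxy (by norm_num) (by norm_num) (by norm_num)
    rw [smul_add]
    calc _ < ‖x‖ ^ p := Real.rpow_lt_rpow (norm_nonneg _) h1 (by linarith)
      _ = _ := by rw [← hn]; ring
  · have h1 : ‖(1 / 2 : ℝ) • (x + y)‖ ≤ 1 / 2 * ‖x‖ + 1 / 2 * ‖y‖ := by
      rw [norm_smul, ← mul_add, Real.norm_of_nonneg (by norm_num)]
      exact mul_le_mul_of_nonneg_left (norm_add_le _ _) (by norm_num)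
    refine (Real.rpow_le_rpow (norm_nonneg _) h1 (by linarith)).trans_lt ?_
    have := (strictConvexOn_rpow hp).2 (Set.mem_Ici.mpr (norm_nonneg x))
      (Set.mem_Ici.mpr (norm_nonneg y)) hn (by norm_num : (0 : ℝ) < 1 / 2)
      (by norm_num : (0 : ℝ) < 1 / 2) (by norm_num)
    simpa only [smul_eq_mul] using this

/-- Quantitative strict convexity by compactness: among normalised pairs that are not `η`-close, the
midpoint defect has a positive minimum. Both sides are homogeneous of degree `p`, so normalised
pairs suffice. -/
theorem exists_norm_sub_rpow_le [FiniteDimensional ℝ H] {p : ℝ} (hp : 1 < p) {η : ℝ}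
    (hη : 0 < η) : ∃ K : ℝ, 0 ≤ K ∧ ∀ x y : H, ‖x - y‖ ^ p ≤ η * (‖x‖ ^ p + ‖y‖ ^ p) +
      K * (1 / 2 * ‖x‖ ^ p + 1 / 2 * ‖y‖ ^ p - ‖(1 / 2 : ℝ) • (x + y)‖ ^ p) := by
  have hp0 : 0 < p := by linarith
  let d : H × H → ℝ := fun z =>
    1 / 2 * ‖z.1‖ ^ p + 1 / 2 * ‖z.2‖ ^ p - ‖(1 / 2 : ℝ) • (z.1 + z.2)‖ ^ p
  have hcp : ∀ {f : H × H → H}, Continuous f → Continuous fun z => ‖f z‖ ^ p := fun hf =>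
    hf.norm.rpow_const fun _ => Or.inr hp0.le
  have hdc : Continuous d := (((hcp continuous_fst).const_mul _).add
    ((hcp continuous_snd).const_mul _)).sub
      (hcp ((continuous_fst.add continuous_snd).const_smul (1 / 2 : ℝ)))
  let S : Set (H × H) := {z | ‖z.1‖ ^ p + ‖z.2‖ ^ p = 1 ∧ η ≤ ‖z.1 - z.2‖ ^ p}
  have hle : ∀ {a b : ℝ}, 0 ≤ a → 0 ≤ b → a ^ p + b ^ p = 1 → a ≤ 1 := by
    intro a b ha hb h
    by_contra! h1
    have := Real.one_lt_rpow h1 hp0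
    have := Real.rpow_nonneg hb p
    linarith
  have hnorm : ∀ {x y : H}, ‖x‖ ^ p + ‖y‖ ^ p = 1 → ‖x‖ ≤ 1 ∧ ‖y‖ ≤ 1 := fun {x y} h =>
    ⟨hle (norm_nonneg _) (norm_nonneg _) h,
      hle (norm_nonneg _) (norm_nonneg _) ((add_comm _ _).trans h)⟩
  have hSc : IsCompact S := by
    refine (isCompact_closedBall (0 : H × H) 1).of_isClosed_subset ?_ fun z hz => ?_
    · exact (isClosed_eq ((hcp continuous_fst).add (hcp continuous_snd)) continuous_const).inter
        (isClosed_le continuous_const (hcp (continuous_fst.sub continuous_snd)))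
    · rw [mem_closedBall_zero_iff, Prod.norm_def]
      exact max_le (hnorm hz.1).1 (hnorm hz.1).2
  obtain ⟨m, hm, hmS⟩ : ∃ m : ℝ, 0 < m ∧ ∀ z ∈ S, m ≤ d z := by
    rcases S.eq_empty_or_nonempty with h0 | h0
    · exact ⟨1, one_pos, by simp [h0]⟩
    · obtain ⟨z, hz, hmin⟩ := hSc.exists_isMinOn h0 hdc.continuousOn
      refine ⟨d z, sub_pos.mpr (norm_half_smul_add_rpow_lt hp fun h => ?_), fun w hw => hmin hw⟩
      have := hz.2
      rw [h, sub_self, norm_zero, Real.zero_rpow hp0.ne'] at this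
      linarith
  have hd0 : ∀ x y : H, 0 ≤ d (x, y) := fun x y =>
    sub_nonneg.mpr (norm_half_smul_add_rpow_le hp x y)
  have hunit : ∀ x y : H, ‖x‖ ^ p + ‖y‖ ^ p = 1 → ‖x - y‖ ^ p ≤ η + 2 ^ p / m * d (x, y) := by
    intro x y h
    by_cases hS : η ≤ ‖x - y‖ ^ p
    · have h1 : ‖x - y‖ ^ p ≤ 2 ^ p := Real.rpow_le_rpow (norm_nonneg _)
        ((norm_sub_le _ _).trans (by linarith [(hnorm h).1, (hnorm h).2])) hp0.le
      have h2 : 1 ≤ d (x, y) / m := (one_le_div hm).mpr (hmS (x, y) ⟨h, hS⟩)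
      have h3 : (2 : ℝ) ^ p * 1 ≤ 2 ^ p * (d (x, y) / m) := by gcongr
      rw [div_mul_eq_mul_div, mul_div_assoc]
      linarith
    · have : 0 ≤ 2 ^ p / m * d (x, y) := mul_nonneg (by positivity) (hd0 x y)
      linarith
  refine ⟨2 ^ p / m, by positivity, fun x y => ?_⟩
  rcases eq_or_lt_of_le (add_nonneg (Real.rpow_nonneg (norm_nonneg x) p)
    (Real.rpow_nonneg (norm_nonneg y) p)) with h0 | h0
  · have hx : ‖x‖ ^ p = 0 := by
      linarith [Real.rpow_nonneg (norm_nonneg x) p, Real.rpow_nonneg (norm_nonneg y) p]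
    have hy : ‖y‖ ^ p = 0 := by linarith
    rw [Real.rpow_eq_zero (norm_nonneg _) hp0.ne', norm_eq_zero] at hx hy
    simp [hx, hy, Real.zero_rpow hp0.ne']
  · set s := (‖x‖ ^ p + ‖y‖ ^ p) ^ (1 / p) with hs
    have hs0 : 0 < s := Real.rpow_pos_of_pos h0 _
    have hsp : s ^ p = ‖x‖ ^ p + ‖y‖ ^ p := by
      rw [hs, ← Real.rpow_mul h0.le, one_div_mul_cancel hp0.ne', Real.rpow_one]
    have hsc : ∀ z : H, ‖s⁻¹ • z‖ ^ p = ‖z‖ ^ p / s ^ p := by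
      intro z
      rw [norm_smul, norm_inv, Real.norm_of_nonneg hs0.le,
        Real.mul_rpow (by positivity) (norm_nonneg _), Real.inv_rpow hs0.le, inv_mul_eq_div]
    have hsp0 : 0 < s ^ p := by positivity
    have := hunit (s⁻¹ • x) (s⁻¹ • y) (by rw [hsc, hsc, ← add_div, ← hsp, div_self hsp0.ne'])
    simp only [d] at this
    rw [← smul_sub, ← smul_add, smul_comm (1 / 2 : ℝ), hsc, hsc, hsc, hsc, div_le_iff₀ hsp0] at this
    refine this.trans (le_of_eq ?_)
    rw [← hsp]
    field_simp

end UniformConvexity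

/-! ### Minimising sequences on decreasing midpoint convex sets -/

section Minimising

open Filter

/-- The infima over `S k` increase and are bounded, hence converge. For `k, l ≥ N` the midpoint lies
in `S N`, so its energy is at least the `N`-th infimum, while near-minimisers lie little above the
limit. -/
theorem exists_seq_midpoint_defect_le {X : Type*} {S : ℕ → Set X} (hS : Antitone S)
    (hne : ∀ k, (S k).Nonempty) (mid : X → X → X)
    (hmid : ∀ k, ∀ x ∈ S k, ∀ y ∈ S k, mid x y ∈ S k) {I : X → ℝ} (h0 : ∀ x ∈ S 0, 0 ≤ I x) {M : ℝ}
    (hM : ∀ x ∈ S 0, I x ≤ M) :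
    ∃ w : ℕ → X, (∀ k, w k ∈ S k) ∧ ∀ ε > 0, ∃ N, ∀ k ≥ N, ∀ l ≥ N,
      1 / 2 * I (w k) + 1 / 2 * I (w l) - I (mid (w k) (w l)) ≤ ε := by
  let m : ℕ → ℝ := fun k => sInf (I '' S k)
  have hb : ∀ k, BddBelow (I '' S k) := fun k =>
    ⟨0, by rintro _ ⟨x, hx, rfl⟩; exact h0 x (hS (Nat.zero_le k) hx)⟩
  have hmle : ∀ k, ∀ x ∈ S k, m k ≤ I x := fun k x hx => csInf_le (hb k) ⟨x, hx, rfl⟩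
  have hmono : Monotone m := fun k l hkl =>
    csInf_le_csInf (hb k) ((hne l).image I) (Set.image_mono (hS hkl))
  have hbdd : BddAbove (Set.range m) := ⟨M, by
    rintro _ ⟨k, rfl⟩
    obtain ⟨x, hx⟩ := hne k
    exact (hmle k x hx).trans (hM x (hS (Nat.zero_le k) hx))⟩
  have hex : ∀ k : ℕ, ∃ w ∈ S k, I w < m k + 1 / ((k : ℝ) + 1) := fun k => by
    obtain ⟨_, ⟨w, hw, rfl⟩, hlt⟩ := exists_lt_of_csInf_lt ((hne k).image I)
      (lt_add_of_pos_right (m k) (by positivity : 0 < 1 / ((k : ℝ) + 1)))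
    exact ⟨w, hw, hlt⟩
  choose w hw hwI using hex
  refine ⟨w, hw, fun ε hε => ?_⟩
  have ht := tendsto_atTop_ciSup hmono hbdd
  obtain ⟨N, hN⟩ := eventually_atTop.mp ((ht.eventually_const_lt
    (sub_lt_self (⨆ i, m i) (half_pos hε))).and
    (tendsto_one_div_add_atTop_nhds_zero_nat (𝕜 := ℝ) |>.eventually_lt_const (half_pos hε)))
  refine ⟨N, fun k hk l hl => ?_⟩
  have h1 := hmle N _ (hmid N _ (hS hk (hw k)) _ (hS hl (hw l)))
  linarith [hwI k, hwI l, (hN k hk).2, (hN l hl).2, (hN N le_rfl).1, le_ciSup hbdd k,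
    le_ciSup hbdd l]

theorem exists_tendsto_eLpNorm_of_cauchy {α F : Type*} [MeasurableSpace α] {μ : Measure α}
    [NormedAddCommGroup F] [CompleteSpace F] {p : ℝ≥0∞} (hp : 1 ≤ p) {f : ℕ → α → F}
    (hf : ∀ k, MemLp (f k) p μ)
    (h : ∀ ε : ℝ≥0∞, 0 < ε → ∃ N, ∀ k ≥ N, ∀ l ≥ N, eLpNorm (fun x => f k x - f l x) p μ ≤ ε) :
    ∃ f' : α → F, MemLp f' p μ ∧
      Tendsto (fun k => eLpNorm (fun x => f k x - f' x) p μ) atTop (nhds 0) := by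
  have : Fact (1 ≤ p) := ⟨hp⟩
  have hc : CauchySeq fun k => (hf k).toLp := by
    refine EMetric.cauchySeq_iff.mpr fun ε hε => ?_
    obtain ⟨δ, hδ, hδε⟩ := exists_between hε
    obtain ⟨N, hN⟩ := h δ hδ
    refine ⟨N, fun k hk l hl => ?_⟩
    rw [Lp.edist_toLp_toLp]
    exact (hN k hk l hl).trans_lt hδε
  obtain ⟨L, hL⟩ := cauchySeq_tendsto_of_complete hc
  refine ⟨L, Lp.memLp L, ?_⟩
  have h1 := tendsto_iff_edist_tendsto_0.mp hL
  refine h1.congr fun k => ?_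
  conv_lhs => rw [← Lp.toLp_coeFn L (Lp.memLp L)]
  rw [Lp.edist_toLp_toLp]
  rfl

theorem eLpNorm_eq_ofReal_integral_rpow {α F : Type*} [MeasurableSpace α] {μ : Measure α}
    [NormedAddCommGroup F] {p : ℝ} (hp : 1 < p) {f : α → F} (hf : MemLp f (ENNReal.ofReal p) μ) :
    eLpNorm f (ENNReal.ofReal p) μ = ENNReal.ofReal ((∫ x, ‖f x‖ ^ p ∂μ) ^ (1 / p)) := by
  have hp0 : 0 < p := by linarith
  rw [hf.eLpNorm_eq_integral_rpow_norm (by simpa using hp0) ENNReal.ofReal_ne_top,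
    ENNReal.toReal_ofReal hp0.le, one_div]

theorem integrable_norm_rpow_of_memLp {α F : Type*} [MeasurableSpace α] {μ : Measure α}
    [NormedAddCommGroup F] {p : ℝ} (hp : 1 < p) {f : α → F} (hf : MemLp f (ENNReal.ofReal p) μ) :
    Integrable (fun x => ‖f x‖ ^ p) μ := by
  have hp0 : 0 < p := by linarith
  have := hf.integrable_norm_rpow (by simpa using hp0) ENNReal.ofReal_ne_top
  rwa [ENNReal.toReal_ofReal hp0.le] at this

theorem integral_defect_eq {α : Type*} [MeasurableSpace α] {μ : Measure α} {f g h : α → ℝ}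
    (hf : Integrable f μ) (hg : Integrable g μ) (hh : Integrable h μ) (c K : ℝ) :
    ∫ z, (c * (f z + g z) + K * (1 / 2 * f z + 1 / 2 * g z - h z)) ∂μ =
      c * ((∫ z, f z ∂μ) + ∫ z, g z ∂μ) +
        K * (1 / 2 * (∫ z, f z ∂μ) + 1 / 2 * (∫ z, g z ∂μ) - ∫ z, h z ∂μ) := by
  have h1 : Integrable (fun z => c * (f z + g z)) μ := (hf.add hg).const_mul c
  have h2 : Integrable (fun z => 1 / 2 * f z) μ := hf.const_mul _
  have h3 : Integrable (fun z => 1 / 2 * g z) μ := hg.const_mul _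
  have h4 : Integrable (fun z => 1 / 2 * f z + 1 / 2 * g z) μ := h2.add h3
  have h5 : Integrable (fun z => K * (1 / 2 * f z + 1 / 2 * g z - h z)) μ :=
    (h4.sub hh).const_mul K
  rw [integral_add h1 h5, integral_const_mul, integral_const_mul, integral_add hf hg,
    integral_sub h4 hh, integral_add h2 h3, integral_const_mul, integral_const_mul]

/-- Strong convergence without weak compactness: near-minimisers of the `p`-energy have small
midpoint defect, which bounds the distance between them after integration. -/
theorem exists_seq_eLpNorm_sub_le {X α W : Type*} [MeasurableSpace α] {μ : Measure α}
    [NormedAddCommGroup W] [NormedSpace ℝ W] [FiniteDimensional ℝ W] {p : ℝ} (hp : 1 < p)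
    {S : ℕ → Set X} (hS : Antitone S) (hne : ∀ k, (S k).Nonempty) (mid : X → X → X)
    (hmid : ∀ k, ∀ x ∈ S k, ∀ y ∈ S k, mid x y ∈ S k) {a : X → α → W}
    (ha : ∀ x ∈ S 0, MemLp (a x) (ENNReal.ofReal p) μ)
    (hamid : ∀ x ∈ S 0, ∀ y ∈ S 0, a (mid x y) =ᵐ[μ] fun z => (1 / 2 : ℝ) • (a x z + a y z))
    {M : ℝ} (hM : ∀ x ∈ S 0, ∫ z, ‖a x z‖ ^ p ∂μ ≤ M) :
    ∃ w : ℕ → X, (∀ k, w k ∈ S k) ∧ ∀ ε : ℝ≥0∞, 0 < ε → ∃ N, ∀ k ≥ N, ∀ l ≥ N,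
      eLpNorm (fun z => a (w k) z - a (w l) z) (ENNReal.ofReal p) μ ≤ ε := by
  have hp0 : 0 < p := by linarith
  -- The norm of `W` need not be strictly convex, so the energy uses an equivalent Euclidean norm.
  let T : W ≃L[ℝ] EuclideanSpace ℝ (Fin (Module.finrank ℝ W)) := toEuclidean
  let b : X → α → EuclideanSpace ℝ (Fin (Module.finrank ℝ W)) := fun x z => T (a x z)
  have hb : ∀ x ∈ S 0, MemLp (b x) (ENNReal.ofReal p) μ := fun x hx =>
    (T : W →L[ℝ] EuclideanSpace ℝ (Fin (Module.finrank ℝ W))).comp_memLp' (ha x hx)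
  let B : ℝ := ‖(T : W →L[ℝ] EuclideanSpace ℝ (Fin (Module.finrank ℝ W)))‖ ^ p
  have hB : 0 ≤ B := by positivity
  have hbM : ∀ x ∈ S 0, ∫ z, ‖b x z‖ ^ p ∂μ ≤ B * M := by
    intro x hx
    calc _ ≤ ∫ z, B * ‖a x z‖ ^ p ∂μ := by
          refine integral_mono (integrable_norm_rpow_of_memLp hp (hb x hx))
            ((integrable_norm_rpow_of_memLp hp (ha x hx)).const_mul B) fun z => ?_
          simp only [B]
          rw [← Real.mul_rpow (norm_nonneg _) (norm_nonneg _)]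
          exact Real.rpow_le_rpow (norm_nonneg _)
            ((T : W →L[ℝ] EuclideanSpace ℝ (Fin (Module.finrank ℝ W))).le_opNorm _) hp0.le
      _ ≤ B * M := by
          rw [integral_const_mul]
          exact mul_le_mul_of_nonneg_left (hM x hx) hB
  obtain ⟨w, hw, hdef⟩ := exists_seq_midpoint_defect_le hS hne mid hmid
    (I := fun x => ∫ z, ‖b x z‖ ^ p ∂μ)
    (fun x _ => integral_nonneg fun z => Real.rpow_nonneg (norm_nonneg _) _) hbM
  have hw0 : ∀ k, w k ∈ S 0 := fun k => hS (Nat.zero_le k) (hw k)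
  have hint : ∀ ε > 0, ∃ N, ∀ k ≥ N, ∀ l ≥ N, ∫ z, ‖b (w k) z - b (w l) z‖ ^ p ∂μ ≤ ε := by
    intro ε hε
    have hM0 : 0 ≤ B * M := (integral_nonneg fun z =>
      Real.rpow_nonneg (norm_nonneg _) _).trans (hbM _ (hw0 0))
    -- The two energies add up to at most `2 B M`, so this `η` contributes at most `ε / 2`. The
    -- defect contributes the other half.
    obtain ⟨K, hK, hKb⟩ := exists_norm_sub_rpow_le
      (H := EuclideanSpace ℝ (Fin (Module.finrank ℝ W))) hp
      (η := ε / (4 * (B * M + 1))) (by positivity)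
    obtain ⟨N, hN⟩ := hdef (ε / (2 * (K + 1))) (by positivity)
    refine ⟨N, fun k hk l hl => ?_⟩
    have hI := fun j => integrable_norm_rpow_of_memLp hp (hb _ (hw0 j))
    have hm : w k ∈ S 0 ∧ w l ∈ S 0 := ⟨hw0 k, hw0 l⟩
    have hmI := integrable_norm_rpow_of_memLp hp (hb _ (hmid 0 _ hm.1 _ hm.2))
    have hmid' : ∀ᵐ z ∂μ, (1 / 2 : ℝ) • (b (w k) z + b (w l) z) = b (mid (w k) (w l)) z := by
      filter_upwards [hamid _ hm.1 _ hm.2] with z hz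
      simp only [b]
      rw [hz, map_smul, map_add]
    have h1 : ∫ z, ‖b (w k) z - b (w l) z‖ ^ p ∂μ ≤
        ∫ z, (ε / (4 * (B * M + 1)) * (‖b (w k) z‖ ^ p + ‖b (w l) z‖ ^ p) +
          K * (1 / 2 * ‖b (w k) z‖ ^ p + 1 / 2 * ‖b (w l) z‖ ^ p -
            ‖b (mid (w k) (w l)) z‖ ^ p)) ∂μ := by
      refine integral_mono_ae
        (integrable_norm_rpow_of_memLp hp ((hb _ (hw0 k)).sub (hb _ (hw0 l)))) ?_ ?_
      · exact (((hI k).add (hI l)).const_mul _).add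
          (((((hI k).const_mul _).add ((hI l).const_mul _)).sub hmI).const_mul _)
      · filter_upwards [hmid'] with z hz
        rw [← hz]
        exact hKb _ _
    rw [integral_defect_eq (hI k) (hI l) hmI] at h1
    refine h1.trans ?_
    have h2 : ε / (4 * (B * M + 1)) *
        ((∫ z, ‖b (w k) z‖ ^ p ∂μ) + ∫ z, ‖b (w l) z‖ ^ p ∂μ) ≤ ε / 2 := by
      calc _ ≤ ε / (4 * (B * M + 1)) * (2 * (B * M + 1)) := by
            refine mul_le_mul_of_nonneg_left ?_ (by positivity)
            linarith [hbM _ (hw0 k), hbM _ (hw0 l)]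
        _ = ε / 2 := by field_simp; norm_num
    have h3 : K * (1 / 2 * (∫ z, ‖b (w k) z‖ ^ p ∂μ) + 1 / 2 * (∫ z, ‖b (w l) z‖ ^ p ∂μ) -
        ∫ z, ‖b (mid (w k) (w l)) z‖ ^ p ∂μ) ≤ ε / 2 := by
      calc _ ≤ K * (ε / (2 * (K + 1))) := mul_le_mul_of_nonneg_left (hN k hk l hl) hK
        _ ≤ (K + 1) * (ε / (2 * (K + 1))) := by
            refine mul_le_mul_of_nonneg_right (by linarith) (by positivity)
        _ = ε / 2 := by field_simp
    linarith
  refine ⟨w, hw, fun ε hε => ?_⟩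
  let B' : ℝ := ‖(T.symm : EuclideanSpace ℝ (Fin (Module.finrank ℝ W)) →L[ℝ] W)‖
  obtain ⟨δ, hδ, hδε⟩ := ENNReal.exists_nnreal_pos_mul_lt (a := ENNReal.ofReal B') (b := ε)
    ENNReal.ofReal_ne_top hε.ne'
  have hδ' : (0 : ℝ) < δ := hδ
  obtain ⟨N, hN⟩ := hint ((δ : ℝ) ^ p) (by positivity)
  refine ⟨N, fun k hk l hl => ?_⟩
  have h1 : eLpNorm (fun z => b (w k) z - b (w l) z) (ENNReal.ofReal p) μ ≤ δ := by
    have h2 : MemLp (fun z => b (w k) z - b (w l) z) (ENNReal.ofReal p) μ :=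
      (hb _ (hw0 k)).sub (hb _ (hw0 l))
    rw [eLpNorm_eq_ofReal_integral_rpow hp h2, ← ENNReal.ofReal_coe_nnreal]
    refine ENNReal.ofReal_le_ofReal ?_
    calc _ ≤ (((δ : ℝ) ^ p) ^ (1 / p)) := Real.rpow_le_rpow
            (integral_nonneg fun z => Real.rpow_nonneg (norm_nonneg _) _) (hN k hk l hl)
            (by positivity)
      _ = δ := by rw [← Real.rpow_mul hδ'.le, mul_one_div_cancel hp0.ne', Real.rpow_one]
  refine (eLpNorm_le_mul_eLpNorm_of_ae_le_mul (c := B')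
    (g := fun z => b (w k) z - b (w l) z) (Filter.Eventually.of_forall fun z => ?_) _).trans
      ((mul_le_mul_right h1 _).trans ((mul_comm _ _).trans_le hδε.le))
  have h2 : a (w k) z - a (w l) z = T.symm (b (w k) z - b (w l) z) := by
    simp [b]
  rw [h2]
  exact (T.symm : EuclideanSpace ℝ (Fin (Module.finrank ℝ W)) →L[ℝ] W).le_opNorm _

end Minimising

/-! ### Integrands of `p`-growth -/

section Growth

variable {W : Type*} [NormedAddCommGroup W] [NormedSpace ℝ W] [FiniteDimensional ℝ W]
  {α : Type*} [MeasurableSpace α] {μ : Measure α} [IsFiniteMeasure μ] {p : ℝ} {g : W → ℝ}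
  {c θ C : ℝ}

theorem _root_.ConvexOn.continuous_of_univ (hg : ConvexOn ℝ Set.univ g) : Continuous g :=
  continuousOn_univ.mp (hg.continuousOn isOpen_univ)

theorem integrable_comp_of_growth (hp : 1 < p) (hg : ConvexOn ℝ Set.univ g) (hc : 0 < c)
    (hθ : 0 < θ) (hgrowth : ∀ z : W, c * ‖z‖ ^ p - θ ≤ g z ∧ g z ≤ C * (1 + ‖z‖ ^ p)) {a : α → W}
    (ha : MemLp a (ENNReal.ofReal p) μ) : Integrable (fun x => g (a x)) μ := by
  have hi := integrable_norm_rpow_of_memLp hp ha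
  have h1 : Integrable (fun x => C * (1 + ‖a x‖ ^ p) + 2 * θ) μ :=
    (((integrable_const 1).add hi).const_mul C).add (integrable_const (2 * θ))
  refine h1.mono' (hg.continuous_of_univ.comp_aestronglyMeasurable ha.1)
    (Filter.Eventually.of_forall fun x => ?_)
  have h2 := hgrowth (a x)
  have h3 : 0 ≤ c * ‖a x‖ ^ p := by positivity
  rw [Real.norm_eq_abs, abs_le]
  constructor <;> linarith [h2.1, h2.2]

theorem integral_norm_rpow_le_of_growth (hp : 1 < p) (hg : ConvexOn ℝ Set.univ g) (hc : 0 < c)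
    (hθ : 0 < θ) (hgrowth : ∀ z : W, c * ‖z‖ ^ p - θ ≤ g z ∧ g z ≤ C * (1 + ‖z‖ ^ p)) {a : α → W}
    (ha : MemLp a (ENNReal.ofReal p) μ) {t : ℝ} (ht : ∫ x, g (a x) ∂μ ≤ t) :
    ∫ x, ‖a x‖ ^ p ∂μ ≤ (t + θ * μ.real Set.univ) / c := by
  have hi := integrable_norm_rpow_of_memLp hp ha
  have h1 : ∫ x, c * ‖a x‖ ^ p ∂μ ≤ ∫ x, (g (a x) + θ) ∂μ :=
    integral_mono (hi.const_mul c)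
      ((integrable_comp_of_growth hp hg hc hθ hgrowth ha).add (integrable_const θ))
      fun x => by linarith [(hgrowth (a x)).1]
  rw [integral_const_mul, integral_add (integrable_comp_of_growth hp hg hc hθ hgrowth ha)
    (integrable_const θ), integral_const, smul_eq_mul, mul_comm (μ.real _)] at h1
  rw [le_div_iff₀ hc, mul_comm]
  linarith

/-- Fatou along an almost everywhere convergent subsequence: a finite convex `g` is continuous, and
adding `θ` makes the integrand nonnegative at finite cost. -/
theorem integral_comp_le_of_tendsto (hp : 1 < p) (hg : ConvexOn ℝ Set.univ g) (hc : 0 < c)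
    (hθ : 0 < θ) (hgrowth : ∀ z : W, c * ‖z‖ ^ p - θ ≤ g z ∧ g z ≤ C * (1 + ‖z‖ ^ p))
    {a : ℕ → α → W} {a' : α → W} (ha : ∀ k, MemLp (a k) (ENNReal.ofReal p) μ)
    (ha' : MemLp a' (ENNReal.ofReal p) μ)
    (h : Filter.Tendsto (fun k => eLpNorm (fun x => a k x - a' x) (ENNReal.ofReal p) μ)
      Filter.atTop (nhds 0)) {t : ℝ} (ht : ∀ k, ∫ x, g (a k x) ∂μ ≤ t) :
    ∫ x, g (a' x) ∂μ ≤ t := by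
  have hp0 : ENNReal.ofReal p ≠ 0 := by simpa using (by linarith : 0 < p)
  obtain ⟨ns, _, hns⟩ := (tendstoInMeasure_of_tendsto_eLpNorm hp0 (fun k => (ha k).1) ha'.1
    h).exists_seq_tendsto_ae
  have hpos : ∀ z, 0 ≤ g z + θ := fun z => by
    have : 0 ≤ c * ‖z‖ ^ p := by positivity
    linarith [(hgrowth z).1]
  have hi : ∀ {b : α → W}, MemLp b (ENNReal.ofReal p) μ → Integrable (fun x => g (b x) + θ) μ :=
    fun hb => (integrable_comp_of_growth hp hg hc hθ hgrowth hb).add (integrable_const θ)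
  have hint : ∀ {b : α → W}, MemLp b (ENNReal.ofReal p) μ →
      ∫ x, (g (b x) + θ) ∂μ = (∫ x, g (b x) ∂μ) + θ * μ.real Set.univ := fun hb => by
    rw [integral_add (integrable_comp_of_growth hp hg hc hθ hgrowth hb) (integrable_const θ),
      integral_const, smul_eq_mul, mul_comm (μ.real _)]
  have hl : ∀ {b : α → W}, MemLp b (ENNReal.ofReal p) μ →
      ∫⁻ x, ENNReal.ofReal (g (b x) + θ) ∂μ =
        ENNReal.ofReal ((∫ x, g (b x) ∂μ) + θ * μ.real Set.univ) := fun hb => by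
    rw [← hint hb, ofReal_integral_eq_lintegral_ofReal (hi hb)
      (Filter.Eventually.of_forall fun x => hpos _)]
  have hT : 0 ≤ t + θ * μ.real Set.univ := by
    refine le_trans ?_ (add_le_add_left (ht 0) _)
    rw [← hint (ha 0)]
    exact integral_nonneg fun x => hpos _
  have hle : ENNReal.ofReal ((∫ x, g (a' x) ∂μ) + θ * μ.real Set.univ) ≤
      ENNReal.ofReal (t + θ * μ.real Set.univ) := by
    rw [← hl ha']
    calc _ = ∫⁻ x, Filter.liminf (fun k => ENNReal.ofReal (g (a (ns k) x) + θ)) Filter.atTop ∂μ := by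
          refine lintegral_congr_ae ?_
          filter_upwards [hns] with x hx
          refine (Filter.Tendsto.liminf_eq ?_).symm
          exact ENNReal.tendsto_ofReal
            (((hg.continuous_of_univ.tendsto _).comp hx).add_const θ)
      _ ≤ Filter.liminf (fun k => ∫⁻ x, ENNReal.ofReal (g (a (ns k) x) + θ) ∂μ) Filter.atTop :=
          lintegral_liminf_le' fun k => (hi (ha _)).aestronglyMeasurable.aemeasurable.ennreal_ofReal
      _ ≤ _ := by
          refine Filter.liminf_le_of_le (by isBoundedDefault) fun b hb => ?_
          obtain ⟨k, hk⟩ := hb.exists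
          refine hk.trans ?_
          rw [hl (ha _)]
          exact ENNReal.ofReal_le_ofReal (add_le_add_left (ht _) _)
  rw [ENNReal.ofReal_le_ofReal_iff hT] at hle
  linarith

end Growth

/-! ### Bounds for the operator `𝔸` on `L^p` gradients. -/

section ApplyGrad

open Filter

variable {n : ℕ} {V W : Type*} [NormedAddCommGroup V] [NormedSpace ℝ V]
  [NormedAddCommGroup W] [NormedSpace ℝ W]

theorem memLp_applyGradL (A : Fin n → V →L[ℝ] W) {D : E n → E n →L[ℝ] V} {μ : Measure (E n)}
    {p : ℝ≥0∞} (hD : MemLp D p μ) : MemLp (fun x => applyGradL A (D x)) p μ :=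
  (applyGradL A).comp_memLp' hD

theorem eLpNorm_applyGradL_le (A : Fin n → V →L[ℝ] W) (D : E n → E n →L[ℝ] V) (μ : Measure (E n))
    (p : ℝ≥0∞) :
    eLpNorm (fun x => applyGradL A (D x)) p μ ≤ ENNReal.ofReal ‖applyGradL A‖ * eLpNorm D p μ :=
  eLpNorm_le_mul_eLpNorm_of_ae_le_mul
    (Eventually.of_forall fun x => (applyGradL A).le_opNorm (D x)) p

end ApplyGrad

/-! ### Lower semicontinuity -/

section LowerSemicontinuity

open Filter

variable {n : ℕ} {V W : Type*} [NormedAddCommGroup V] [NormedSpace ℝ V] [FiniteDimensional ℝ V]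
  [NormedAddCommGroup W] [NormedSpace ℝ W] [FiniteDimensional ℝ W] {Ω : Set (E n)} {p : ℝ}
  {g : W → ℝ} {c θ C : ℝ}

/-- Closedness of sublevel sets in `L¹`, with `f` in the role of `𝔸u₀`. Convexity of `g` makes the
sets `S k` midpoint convex, and coercivity bounds the energies on them. The Korn and Poincaré
inequalities upgrade convergence of `𝔸w_k` to convergence in `W^{1,p}`. -/
theorem memW10_and_integral_le_of_approx (hn : n ≠ 0) {A : Fin n → V →L[ℝ] W}
    (hA : IsRElliptic A) (hΩ : IsOpen Ω) (hΩb : Bornology.IsBounded Ω) (hp : 1 < p)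
    (hg : ConvexOn ℝ Set.univ g) (hc : 0 < c) (hθ : 0 < θ)
    (hgrowth : ∀ z : W, c * ‖z‖ ^ p - θ ≤ g z ∧ g z ≤ C * (1 + ‖z‖ ^ p)) {f : E n → W}
    (hf : MemLp f (ENNReal.ofReal p) (volume.restrict Ω)) {v : E n → V}
    (hv : AEStronglyMeasurable v (volume.restrict Ω)) {t : ℝ}
    (h : ∀ δ : ℝ≥0∞, 0 < δ → ∃ w : E n → V, MemW10 Ω (ENNReal.ofReal p) w ∧
      ∫ x in Ω, g (applyGradL A (weakGrad Ω w x) + f x) ≤ t ∧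
      eLpNorm (fun x => w x - v x) 1 (volume.restrict Ω) ≤ δ) :
    MemW10 Ω (ENNReal.ofReal p) v ∧
      ∫ x in Ω, g (applyGradL A (weakGrad Ω v x) + f x) ≤ t := by
  have : IsFiniteMeasure (volume.restrict Ω : Measure (E n)) :=
    ⟨by rw [Measure.restrict_apply_univ]; exact hΩb.measure_lt_top⟩
  have : CompleteSpace V := FiniteDimensional.complete ℝ V
  have hp1 : 1 ≤ ENNReal.ofReal p := by simpa using hp.le
  set μ : Measure (E n) := volume.restrict Ω with hμ
  let P := ENNReal.ofReal p
  let a : (E n → V) → E n → W := fun w x => applyGradL A (weakGrad Ω w x) + f x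
  have ha : ∀ {w}, MemW10 Ω P w → MemLp (a w) P μ := fun hw => (memLp_applyGradL A hw.1.3).add hf
  let S : ℕ → Set (E n → V) := fun k => {w | MemW10 Ω P w ∧ ∫ x, g (a w x) ∂μ ≤ t ∧
    eLpNorm (fun x => w x - v x) 1 μ ≤ ((k : ℝ≥0∞) + 1)⁻¹}
  let mid : (E n → V) → (E n → V) → E n → V := fun w w' x => (1 / 2 : ℝ) • w x + (1 / 2 : ℝ) • w' x
  have hamid : ∀ w w', MemW10 Ω P w → MemW10 Ω P w' →
      a (mid w w') =ᵐ[μ] fun x => (1 / 2 : ℝ) • (a w x + a w' x) := by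
    intro w w' hw hw'
    filter_upwards [(hw.1.smul_add_smul hΩ hw'.1 (1 / 2) (1 / 2)).2] with x hx
    simp only [a, mid]
    rw [hx, map_add, map_smul, map_smul]
    module
  have hS : Antitone S := fun k l hkl w hw => ⟨hw.1, hw.2.1, hw.2.2.trans
    (ENNReal.inv_le_inv.mpr (by gcongr))⟩
  have hne : ∀ k, (S k).Nonempty := fun k =>
    h _ (ENNReal.inv_pos.mpr (ENNReal.add_ne_top.mpr ⟨ENNReal.natCast_ne_top k,
      ENNReal.one_ne_top⟩))
  have hmid : ∀ k, ∀ w ∈ S k, ∀ w' ∈ S k, mid w w' ∈ S k := by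
    rintro k w ⟨hw, hwt, hwd⟩ w' ⟨hw', hwt', hwd'⟩
    have hm : MemW10 Ω P (mid w w') := hw.smul_add_smul hΩ hp1 hw' (1 / 2) (1 / 2)
    refine ⟨hm, ?_, ?_⟩
    · have i1 := integrable_comp_of_growth hp hg hc hθ hgrowth (ha hw)
      have i2 := integrable_comp_of_growth hp hg hc hθ hgrowth (ha hw')
      have i3 := integrable_comp_of_growth hp hg hc hθ hgrowth (ha hm)
      calc ∫ x, g (a (mid w w') x) ∂μ
          ≤ ∫ x, (1 / 2 * g (a w x) + 1 / 2 * g (a w' x)) ∂μ := by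
            refine integral_mono_ae i3 ((i1.const_mul _).add (i2.const_mul _)) ?_
            filter_upwards [hamid w w' hw hw'] with x hx
            rw [hx, smul_add]
            exact hg.2 (Set.mem_univ _) (Set.mem_univ _) (by norm_num) (by norm_num) (by norm_num)
        _ = 1 / 2 * (∫ x, g (a w x) ∂μ) + 1 / 2 * ∫ x, g (a w' x) ∂μ := by
            rw [integral_add (i1.const_mul _) (i2.const_mul _), integral_const_mul,
              integral_const_mul]
        _ ≤ t := by linarith
    · have h1 := eLpNorm_smul_add_smul_sub_le le_rfl hw.1.2.1 hw'.1.2.1 hv hv (1 / 2) (1 / 2)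
      have h2 : (fun x => mid w w' x - v x) = fun x => ((1 / 2 : ℝ) • w x + (1 / 2 : ℝ) • w' x) -
          ((1 / 2 : ℝ) • v x + (1 / 2 : ℝ) • v x) := by
        funext x
        simp only [mid]
        module
      have h3 : ‖(1 / 2 : ℝ)‖ₑ = 2⁻¹ := by
        rw [← ofReal_norm, Real.norm_of_nonneg (by norm_num), one_div,
          ENNReal.ofReal_inv_of_pos two_pos, ENNReal.ofReal_ofNat]
      rw [h2]
      refine h1.trans ?_
      rw [h3]
      calc _ ≤ 2⁻¹ * ((k : ℝ≥0∞) + 1)⁻¹ + 2⁻¹ * ((k : ℝ≥0∞) + 1)⁻¹ := by gcongr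
        _ = _ := by rw [← add_mul, ENNReal.inv_two_add_inv_two, one_mul]
  obtain ⟨w, hw, hcau⟩ := exists_seq_eLpNorm_sub_le hp hS hne mid hmid (a := a) (μ := μ)
    (fun w hw => ha hw.1) (fun w hw w' hw' => hamid w w' hw.1 hw'.1)
    (fun w hw => integral_norm_rpow_le_of_growth hp hg hc hθ hgrowth (ha hw.1) hw.2.1)
  have hw10 : ∀ k, MemW10 Ω P (w k) := fun k => (hw k).1
  obtain ⟨C₁, hC₁, hKorn⟩ := exists_eLpNorm_weakGrad_le hA hp Ω
  obtain ⟨C₂, hC₂, hPoin⟩ := exists_eLpNorm_le_eLpNorm_weakGrad (V := V) hn hΩb hp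
  have hdiff : ∀ k l, eLpNorm (fun x => weakGrad Ω (w k) x - weakGrad Ω (w l) x) P μ ≤
      C₁ * eLpNorm (fun x => a (w k) x - a (w l) x) P μ ∧
      eLpNorm (fun x => w k x - w l x) P μ ≤
        C₂ * eLpNorm (fun x => weakGrad Ω (w k) x - weakGrad Ω (w l) x) P μ := by
    intro k l
    -- The estimates hold only for zero boundary values, so they are applied to differences. There
    -- `f` cancels.
    have hd : MemW10 Ω P (fun x => (1 : ℝ) • w k x + (-1 : ℝ) • w l x) :=
      (hw10 k).smul_add_smul hΩ hp1 (hw10 l) 1 (-1)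
    have hae : weakGrad Ω (fun x => (1 : ℝ) • w k x + (-1 : ℝ) • w l x) =ᵐ[μ]
        fun x => weakGrad Ω (w k) x - weakGrad Ω (w l) x := by
      filter_upwards [((hw10 k).1.smul_add_smul hΩ (hw10 l).1 1 (-1)).2] with x hx
      rw [hx]
      module
    have hKd := hKorn _ hd
    have hPd := hPoin _ hd
    have e1 : (fun x => applyGrad A (weakGrad Ω (fun x => (1 : ℝ) • w k x + (-1 : ℝ) • w l x) x))
        =ᵐ[μ] fun x => a (w k) x - a (w l) x := by
      filter_upwards [hae] with x hx
      rw [hx, ← applyGradL_apply, map_sub]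
      simp only [a]
      abel
    have e2 : (fun x => (1 : ℝ) • w k x + (-1 : ℝ) • w l x) = fun x => w k x - w l x := by
      funext x
      module
    rw [eLpNorm_congr_ae hae, eLpNorm_congr_ae e1] at hKd
    rw [eLpNorm_congr_ae hae, e2] at hPd
    exact ⟨hKd, hPd⟩
  have hcauD : ∀ ε : ℝ≥0∞, 0 < ε → ∃ N, ∀ k ≥ N, ∀ l ≥ N,
      eLpNorm (fun x => weakGrad Ω (w k) x - weakGrad Ω (w l) x) P μ ≤ ε := by
    intro ε hε
    obtain ⟨δ, hδ, hδε⟩ := ENNReal.exists_nnreal_pos_mul_lt hC₁ hε.ne'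
    obtain ⟨N, hN⟩ := hcau δ (by exact_mod_cast hδ)
    exact ⟨N, fun k hk l hl => (hdiff k l).1.trans ((mul_le_mul_right (hN k hk l hl) _).trans
      ((mul_comm _ _).trans_le hδε.le))⟩
  have hcauw : ∀ ε : ℝ≥0∞, 0 < ε → ∃ N, ∀ k ≥ N, ∀ l ≥ N,
      eLpNorm (fun x => w k x - w l x) P μ ≤ ε := by
    intro ε hε
    obtain ⟨δ, hδ, hδε⟩ := ENNReal.exists_nnreal_pos_mul_lt hC₂ hε.ne'
    obtain ⟨N, hN⟩ := hcauD δ (by exact_mod_cast hδ)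
    exact ⟨N, fun k hk l hl => (hdiff k l).2.trans ((mul_le_mul_right (hN k hk l hl) _).trans
      ((mul_comm _ _).trans_le hδε.le))⟩
  obtain ⟨F, hF, hFt⟩ := exists_tendsto_eLpNorm_of_cauchy hp1 (fun k => (hw10 k).1.3) hcauD
  obtain ⟨v', hv', hvt⟩ := exists_tendsto_eLpNorm_of_cauchy hp1 (fun k => (hw10 k).1.2) hcauw
  -- Membership in `S k` forces `w k → v` in `L¹`, which identifies the `L^p` limit.
  have hvv : v' =ᵐ[μ] v := by
    have h1 := tendsto_eLpNorm_one hp1 (fun k => (hw10 k).1.2.1.sub hv'.1) hvt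
    have h2 : Tendsto (fun k => eLpNorm (fun x => w k x - v x) 1 μ) atTop (nhds 0) := by
      refine tendsto_of_tendsto_of_tendsto_of_le_of_le tendsto_const_nhds
        ?_ (fun _ => zero_le) fun k => (hw k).2.2
      have := ENNReal.tendsto_inv_nat_nhds_zero.comp (tendsto_add_atTop_nat 1)
      refine this.congr fun k => ?_
      simp
    exact tendstoInMeasure_ae_unique
      (tendstoInMeasure_of_tendsto_eLpNorm one_ne_zero (fun k => (hw10 k).1.2.1) hv'.1 h1)
      (tendstoInMeasure_of_tendsto_eLpNorm one_ne_zero (fun k => (hw10 k).1.2.1) hv h2)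
  have hvt' : Tendsto (fun k => eLpNorm (fun x => w k x - v x) P μ) atTop (nhds 0) := by
    refine hvt.congr fun k => eLpNorm_congr_ae ?_
    filter_upwards [hvv] with x hx
    rw [hx]
  obtain ⟨hvW, hvF⟩ := memW10_of_tendsto hΩ hΩb hp1 hw10 (hv'.ae_eq hvv) hF hvt' hFt
  refine ⟨hvW, ?_⟩
  have haF : MemLp (fun x => applyGradL A (F x) + f x) P μ := (memLp_applyGradL A hF).add hf
  have hat : Tendsto (fun k => eLpNorm (fun x => a (w k) x - (applyGradL A (F x) + f x)) P μ)
      atTop (nhds 0) := by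
    have h0 := ENNReal.Tendsto.const_mul hFt (Or.inr (ENNReal.ofReal_ne_top (r := ‖applyGradL A‖)))
    rw [mul_zero] at h0
    refine tendsto_of_tendsto_of_tendsto_of_le_of_le tendsto_const_nhds h0 (fun _ => zero_le)
      fun k => ?_
    refine le_trans (le_of_eq ?_) (eLpNorm_applyGradL_le A _ μ P)
    congr 1
    funext x
    simp only [a, map_sub]
    abel
  have := integral_comp_le_of_tendsto hp hg hc hθ hgrowth (fun k => ha (hw10 k)) haF hat
    fun k => (hw k).2.1
  refine le_trans (le_of_eq (integral_congr_ae ?_)) this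
  filter_upwards [hvF] with x hx
  rw [hx]

end LowerSemicontinuity

/-! ### Dimension zero -/

section ZeroDimensional

variable {V W : Type*} [NormedAddCommGroup V] [NormedSpace ℝ V]
  [NormedAddCommGroup W] [NormedSpace ℝ W]

/-- Over a single point every function is a constant, and is itself a test function if `Ω` is
nonempty. This case stands apart because Poincaré's inequality needs a direction. -/
theorem memW10_of_dim_zero {Ω : Set (E 0)} {p : ℝ≥0∞} (hΩb : Bornology.IsBounded Ω) (u : E 0 → V) :
    MemW10 Ω p u := by
  have : IsFiniteMeasure (volume.restrict Ω : Measure (E 0)) :=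
    ⟨by rw [Measure.restrict_apply_univ]; exact hΩb.measure_lt_top⟩
  have hu : u = fun _ => u 0 := funext fun x => by rw [Subsingleton.elim x 0]
  have hL : ∀ T : E 0 →L[ℝ] V, T = 0 := fun T => by
    ext x
    rw [Subsingleton.elim x 0, map_zero, map_zero]
  have hD : ∀ D : E 0 → E 0 →L[ℝ] V, D = fun _ => 0 := fun D => funext fun x => hL _
  have hw : IsWeakGrad Ω u fun _ => 0 :=
    { locallyIntegrableOn := by
        rw [hu]
        exact (integrable_const (u 0)).integrableOn.locallyIntegrableOn
      locallyIntegrableOn_grad :=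
        (integrable_const (0 : E 0 →L[ℝ] V)).integrableOn.locallyIntegrableOn
      integral_eq := fun φ _ e => by simp [Subsingleton.elim e 0] }
  refine ⟨⟨⟨_, hw⟩, by rw [hu]; exact memLp_const _, by rw [hD (weakGrad Ω u)]; exact memLp_const _⟩,
    fun ε hε => ?_⟩
  rcases Ω.eq_empty_or_nonempty with h0 | ⟨y, hy⟩
  · refine ⟨fun _ => 0, ⟨contDiff_const, HasCompactSupport.zero, by simp [tsupport]⟩, ?_, ?_⟩ <;>
      simpa [h0] using hε
  · have hΩ : Ω = Set.univ := Set.eq_univ_of_forall fun x => Subsingleton.elim y x ▸ hy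
    refine ⟨u, ⟨by rw [hu]; exact contDiff_const, ?_, by simp [hΩ]⟩, by simpa using hε, ?_⟩
    · exact (Set.subsingleton_of_subsingleton.isCompact : IsCompact (tsupport u))
    · refine lt_of_le_of_lt (eLpNorm_mono_real (g := fun _ => (0 : ℝ)) fun x => ?_)
        (by rw [eLpNorm_zero']; exact hε)
      rw [hL (weakGrad Ω u x - fderiv ℝ u x), norm_zero]

theorem energy_of_dim_zero (A : Fin 0 → V →L[ℝ] W) {Ω : Set (E 0)} (hΩb : Bornology.IsBounded Ω)
    (p : ℝ≥0∞) (g : W → ℝ) (u₀ : E 0 → V) (u : Lp V 1 ((volume : Measure (E 0)).restrict Ω)) :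
    energy A Ω p g u₀ u = ((∫ _ in Ω, g 0 : ℝ) : EReal) := by
  have h : MemDirichlet Ω p u₀ u := memW10_of_dim_zero hΩb _
  rw [energy, if_pos h]
  simp [applyGrad]

end ZeroDimensional

/-! ### From zero boundary values to the Dirichlet class and the functional. -/

section Energy

variable {n : ℕ} {V W : Type*} [NormedAddCommGroup V] [NormedSpace ℝ V] [FiniteDimensional ℝ V]
  [NormedAddCommGroup W] [NormedSpace ℝ W] [FiniteDimensional ℝ W] {Ω : Set (E n)} {p : ℝ≥0∞}

theorem applyGrad_weakGrad_ae_eq (A : Fin n → V →L[ℝ] W) (hΩ : IsOpen Ω) {u₀ u : E n → V}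
    (hu₀ : MemW1 Ω p u₀) (hu : MemDirichlet Ω p u₀ u) :
    (fun x => applyGrad A (weakGrad Ω u x)) =ᵐ[volume.restrict Ω] fun x =>
      applyGradL A (weakGrad Ω (fun x => u x - u₀ x) x) + applyGradL A (weakGrad Ω u₀ x) := by
  have : CompleteSpace V := FiniteDimensional.complete ℝ V
  have h1 := (hu.1.smul_add_smul hΩ hu₀ 1 1).2
  have h2 : (fun x => (1 : ℝ) • (u x - u₀ x) + (1 : ℝ) • u₀ x) = u := by
    funext x
    simp
  rw [h2] at h1
  filter_upwards [h1] with x hx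
  rw [← applyGradL_apply, hx, one_smul, one_smul, map_add]

/-- If it failed at `u`, functions of energy at most `y < energy u` would exist arbitrarily near
`u`. Closedness of the sublevel set then puts `u` itself below `y`. -/
theorem lowerSemicontinuous_energy (hn : n ≠ 0) {A : Fin n → V →L[ℝ] W} (hA : IsRElliptic A)
    (hΩ : IsOpen Ω) (hΩb : Bornology.IsBounded Ω) {p : ℝ} (hp : 1 < p) {g : W → ℝ}
    (hg : ConvexOn ℝ Set.univ g) {c θ C : ℝ} (hc : 0 < c) (hθ : 0 < θ)
    (hgrowth : ∀ z : W, c * ‖z‖ ^ p - θ ≤ g z ∧ g z ≤ C * (1 + ‖z‖ ^ p)) {u₀ : E n → V}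
    (hu₀ : MemW1 Ω (ENNReal.ofReal p) u₀) :
    LowerSemicontinuous (energy A Ω (ENNReal.ofReal p) g u₀) := by
  intro u y hy
  by_contra hcon
  rw [Filter.not_eventually] at hcon
  simp only [not_lt] at hcon
  have hint : ∀ {w : Lp V 1 ((volume : Measure (E n)).restrict Ω)},
      MemDirichlet Ω (ENNReal.ofReal p) u₀ w →
      ∫ x in Ω, g (applyGrad A (weakGrad Ω w x)) = ∫ x in Ω, g (applyGradL A
        (weakGrad Ω (fun x => w x - u₀ x) x) + applyGradL A (weakGrad Ω u₀ x)) := fun hw =>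
    integral_congr_ae ((applyGrad_weakGrad_ae_eq A hΩ hu₀ hw).fun_comp g)
  have hmem : ∀ {w : Lp V 1 ((volume : Measure (E n)).restrict Ω)},
      energy A Ω (ENNReal.ofReal p) g u₀ w ≤ y → MemDirichlet Ω (ENNReal.ofReal p) u₀ w ∧
        ((∫ x in Ω, g (applyGrad A (weakGrad Ω w x)) : ℝ) : EReal) ≤ y := by
    intro w hw
    by_cases hm : MemDirichlet Ω (ENNReal.ofReal p) u₀ w
    · rw [energy, if_pos hm] at hw
      exact ⟨hm, hw⟩
    · rw [energy, if_neg hm] at hw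
      exact absurd (lt_of_lt_of_le hy le_top) (not_lt.mpr hw)
  obtain ⟨w₀, hw₀⟩ := hcon.exists
  -- Only real levels matter: `y` lies below another value, so it is not `⊤`, and it bounds a real
  -- energy from above, so it is not `⊥`.
  induction y with
  | bot => exact absurd (hmem hw₀).2 (not_le.mpr (EReal.bot_lt_coe _))
  | top => exact not_top_lt hy
  | coe t =>
    obtain ⟨h1, h2⟩ := memW10_and_integral_le_of_approx hn hA hΩ hΩb hp hg hc hθ hgrowth
      (memLp_applyGradL A hu₀.3) (v := fun x => u x - u₀ x) (t := t)
      ((Lp.aestronglyMeasurable u).sub hu₀.2.1) fun δ hδ => by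
        obtain ⟨w, hw, hwδ⟩ := (hcon.and_eventually (Metric.eball_mem_nhds u hδ)).exists
        obtain ⟨hm, hle⟩ := hmem hw
        refine ⟨fun x => w x - u₀ x, hm, ?_, ?_⟩
        · rw [← hint hm]
          exact_mod_cast hle
        · have h3 : (fun x => w x - u₀ x - (u x - u₀ x)) = ⇑w - ⇑u := by
            funext x
            simp
          rw [h3, ← Lp.edist_def]
          exact le_of_lt hwδ
    have hm : MemDirichlet Ω (ENNReal.ofReal p) u₀ u := h1
    rw [energy, if_pos hm, hint hm] at hy
    exact absurd (EReal.coe_lt_coe_iff.mp hy) (not_lt.mpr h2)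

end Energy

end DirichletClass

theorem proposition4p2 {n : ℕ} {V W : Type*}
    [NormedAddCommGroup V] [NormedSpace ℝ V] [FiniteDimensional ℝ V]
    [NormedAddCommGroup W] [NormedSpace ℝ W] [FiniteDimensional ℝ W]
    (A : Fin n → V →L[ℝ] W) (hA : DirichletClass.IsRElliptic A)
    (Ω : Set (EuclideanSpace ℝ (Fin n))) (hΩ : IsOpen Ω) (hΩb : Bornology.IsBounded Ω)
    (p : ℝ) (hp : 1 < p)
    (g : W → ℝ) (hg : ConvexOn ℝ Set.univ g)
    (c θ C : ℝ) (hc : 0 < c) (hθ : 0 < θ) (hC : 0 < C)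
    (hgrowth : ∀ z : W, c * ‖z‖ ^ p - θ ≤ g z ∧ g z ≤ C * (1 + ‖z‖ ^ p))
    (u₀ : EuclideanSpace ℝ (Fin n) → V)
    (hu₀ : DirichletClass.MemW1 Ω (ENNReal.ofReal p) u₀) :
    (∀ u : Lp V 1 ((volume : Measure (EuclideanSpace ℝ (Fin n))).restrict Ω),
      DirichletClass.MemDirichlet Ω (ENNReal.ofReal p) u₀ u →
        IntegrableOn (fun x => g (DirichletClass.applyGrad A (DirichletClass.weakGrad Ω u x))) Ω) ∧
    LowerSemicontinuous (DirichletClass.energy A Ω (ENNReal.ofReal p) g u₀) := by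
  have : IsFiniteMeasure (volume.restrict Ω : Measure (EuclideanSpace ℝ (Fin n))) :=
    ⟨by rw [Measure.restrict_apply_univ]; exact hΩb.measure_lt_top⟩
  refine ⟨fun u hu => ?_, ?_⟩
  · refine DirichletClass.integrable_comp_of_growth hp hg hc hθ hgrowth ?_
    exact ((DirichletClass.memLp_applyGradL A hu.1.3).add
      (DirichletClass.memLp_applyGradL A hu₀.3)).ae_eq
        (DirichletClass.applyGrad_weakGrad_ae_eq A hΩ hu₀ hu).symm
  · rcases eq_or_ne n 0 with rfl | hn
    · have h0 : DirichletClass.energy A Ω (ENNReal.ofReal p) g u₀ =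
          fun _ => ((∫ _ in Ω, g 0 : ℝ) : EReal) :=
        funext fun u => DirichletClass.energy_of_dim_zero A hΩb _ g u₀ u
      rw [h0]
      exact lowerSemicontinuous_const
    · exact DirichletClass.lowerSemicontinuous_energy hn hA hΩ hΩb hp hg hc hθ hgrowth hu₀
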